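/- Let $G=(V,E)$ be a finite simple graph with $n\ge 1$ nodes and $m$ edges, given by adjacency lists, and let $\lambda\in[0,1]$. A wedge of $G$ is a triple of distinct vertices $(x,y,z)$ with $xy\in E$, $yz\in E$, $xz\notin E$. The wedge graph $Z(G)$ has as nodes the edges of $G$ that contribute to at least one wedge; two nodes are adjacent if the corresponding edges $xy$, $yz$ form a wedge. Let $n'$ and $m'$ be the numbers of nodes and edges of $Z(G)$. The procedure Apr-MinSTC, applied to a graph $F$, builds $Z(F)$, finds a maximal matching of $Z(F)$, labels as weak the edges of $F$ that are endpoints (in $Z(F)$) of matching edges, and labels all other edges of $F$ strong. The algorithm STC-Peel on $(G,\lambda)$ does the following, with arbitrary choices and ties resolved arbitrarily: (1) label $G$ by Apr-MinSTC; (2) let $H$ be $G$ with weight $1$ on strong and $\lambda$ on weak edges; (3) starting from $V$, repeatedly remove a vertex of minimum weighted degree in the current induced subgraph of $H$, and let $U$ be a set of maximum density (total weight of the edges inside the set divided by its size) among the non-empty sets produced, $V$ included; (4) label the induced subgraph $G(U)$ by Apr-MinSTC, and return $U$ with this labeling. Then STC-Peel can be implemented, on a random access machine with words of $O(\log n)$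 bits and unit-cost exact real arithmetic and comparisons (for the weights), by one program that runs in time $$O\Big(\sum_{v\in V}\deg(v)^2+(m+n\log n)+(m'+n')\Big),$$ where the constants are absolute (independent of $G$, $\lambda$ and the order of the adjacency lists) and a constant number of steps is allowed for $n=1$. The time includes the construction of the wedge graphs $Z(G)$ and $Z(G(U))$, both labelings by maximal matchings, the construction of $H$, and the peeling. Moreover, on every class of graphs with $\log n=O(m)$ (for instance, graphs without isolated vertices), this bound is in $O(nm)$: for every real $K$ there is a $C$ such that every graph with $\log n\le K m$ satisfies $$\sum_{v\in V}\deg(v)^2+(m+n\log n)+(m'+n')\le C\,nm .$$ -/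

import Mathlib

namespace STCPeel

/-! ## Wedge graphs -/

section Graph

variable {V : Type*}

/-- `(x, y, z)` is a wedge: `xy` and `yz` are edges, `x ≠ z`, and `xz` is not an edge. -/
def IsWedge (G : SimpleGraph V) (x y z : V) : Prop :=
  G.Adj x y ∧ G.Adj y z ∧ x ≠ z ∧ ¬ G.Adj x z

theorem IsWedge.symm {G : SimpleGraph V} {x y z : V} (h : IsWedge G x y z) : IsWedge G z y x :=
  ⟨h.2.1.symm, h.1.symm, h.2.2.1.symm, fun k => h.2.2.2 k.symm⟩

/-- The nodes of `Z(G)`: the edges of `G` that contribute to at least one wedge. -/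
def wedgeVerts (G : SimpleGraph V) : Set (Sym2 V) :=
  {e | ∃ x y z, IsWedge G x y z ∧ (e = s(x, y) ∨ e = s(y, z))}

/-- The wedge graph `Z(G)`: two nodes are joined when the two edges of `G` form a wedge. -/
def wedgeGraph (G : SimpleGraph V) : SimpleGraph (wedgeVerts G) where
  Adj e f := ∃ x y z, IsWedge G x y z ∧ e.1 = s(x, y) ∧ f.1 = s(y, z)
  symm := ⟨by
    rintro e f ⟨x, y, z, h, he, hf⟩
    exact ⟨z, y, x, h.symm, by rw [hf, Sym2.eq_swap], by rw [he, Sym2.eq_swap]⟩⟩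
  loopless := ⟨by
    rintro e ⟨x, y, z, h, he, hf⟩
    rw [he, Sym2.eq_swap] at hf
    exact h.2.2.1 (Sym2.congr_right.mp hf)⟩

/-- `G(U)`, kept on the vertex set of `G`: the edges of `G` with both endpoints in `U`. -/
def sub (G : SimpleGraph V) (U : Finset V) : SimpleGraph V :=
  (G.induce (U : Set V)).spanningCoe

/-! ## The algorithm STC-Peel as a relation between its input and its results

Ties and arbitrary choices are resolved in any way. A labeling is given by its set of weak edges;
the other edges are strong. -/

/-- `weak` is a possible result of Apr-MinSTC on `G`: the weak edges are the endpoints, in the wedge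
graph, of the edges of a maximal matching of the wedge graph. -/
def IsAprMinSTC (G : SimpleGraph V) (weak : Set (Sym2 V)) : Prop :=
  ∃ M : (wedgeGraph G).Subgraph,
    Maximal (fun M' : (wedgeGraph G).Subgraph => M'.IsMatching) M ∧ weak = Subtype.val '' M.verts

open Classical in
/-- Edge weights: `lam` for weak edges and `1` for strong edges. -/
noncomputable def weight (weak : Set (Sym2 V)) (lam : ℝ) (e : Sym2 V) : ℝ :=
  if e ∈ weak then lam else 1

open Classical in
/-- Weighted degree of `v` inside `U`. -/
noncomputable def wdeg (G : SimpleGraph V) (w : Sym2 V → ℝ) (U : Finset V) (v : V) : ℝ :=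
  ∑ u ∈ U with G.Adj v u, w s(v, u)

open Classical in
/-- Density of `U`: total weight of the edges inside `U`, divided by the size of `U`. -/
noncomputable def density [Fintype V] (G : SimpleGraph V) (w : Sym2 V → ℝ) (U : Finset V) : ℝ :=
  (∑ e ∈ (sub G U).edgeFinset, w e) / (U.card : ℝ)

end Graph

/-- What is left after the first `i` vertices of the removal order have been removed. -/
def remaining {n : ℕ} (order : Equiv.Perm (Fin n)) (i : ℕ) : Finset (Fin n) :=
  Finset.univ.filter fun v => i ≤ (order.symm v : ℕ)

/-- In every round a vertex of minimum weighted degree among the remaining ones is removed. -/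
def IsPeelOrder {n : ℕ} (G : SimpleGraph (Fin n)) (w : Sym2 (Fin n) → ℝ)
    (order : Equiv.Perm (Fin n)) : Prop :=
  ∀ i : Fin n, ∀ v ∈ remaining order i,
    wdeg G w (remaining order i) (order i) ≤ wdeg G w (remaining order i) v

/-- `U` is a densest one among the (non-empty) vertex sets produced by the removal order. -/
def IsBestRemaining {n : ℕ} (G : SimpleGraph (Fin n)) (w : Sym2 (Fin n) → ℝ)
    (order : Equiv.Perm (Fin n)) (U : Finset (Fin n)) : Prop :=
  ∃ i : Fin n, U = remaining order i ∧
    ∀ j : Fin n, density G w (remaining order j) ≤ density G w U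

/-- A run of STC-Peel on `(G, lam)`: a labeling `weak` of `G`, a removal order of the graph `H`
weighted by that labeling, a densest set `U`, and a labeling `weak'` of `G(U)`. -/
structure IsRun {n : ℕ} (G : SimpleGraph (Fin n)) (lam : ℝ) (weak : Set (Sym2 (Fin n)))
    (order : Equiv.Perm (Fin n)) (U : Finset (Fin n)) (weak' : Set (Sym2 (Fin n))) : Prop where
  label : IsAprMinSTC G weak
  peel : IsPeelOrder G (weight weak lam) order
  best : IsBestRemaining G (weight weak lam) order U
  relabel : IsAprMinSTC (sub G U) weak'

/-! ## The machine model

A random access machine in structured form. It has word variables and word arrays, whose entries are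
natural numbers below a word bound `W` (a machine word), and real variables and real arrays with
exact arithmetic and comparison (the weights are reals). Reals cannot be turned into words. A program
is a fixed finite text, so it uses finitely many variables and arrays. -/

structure State where
  /-- word variables -/
  w : ℕ → ℕ
  /-- word arrays -/
  a : ℕ → ℕ → ℕ
  /-- real variables -/
  r : ℕ → ℝ
  /-- real arrays -/
  ra : ℕ → ℕ → ℝ

/-- Word expressions. -/
inductive WExp where
  | const (c : ℕ)
  | var (x : ℕ)
  | arr (A : ℕ) (i : WExp)
  | add (e f : WExp)
  | sub (e f : WExp)
  | mul (e f : WExp)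
  | div (e f : WExp)

/-- Real expressions. -/
inductive RExp where
  | ofWord (e : WExp)
  | var (x : ℕ)
  | arr (A : ℕ) (i : WExp)
  | add (e f : RExp)
  | sub (e f : RExp)
  | mul (e f : RExp)
  | div (e f : RExp)

/-- Tests. -/
inductive Test where
  | lt (e f : WExp)
  | eq (e f : WExp)
  | rlt (e f : RExp)
  | not (b : Test)
  | and (b c : Test)

/-- Programs. -/
inductive Cmd where
  | skip
  | set (x : ℕ) (e : WExp)
  | store (A : ℕ) (i e : WExp)
  | rset (x : ℕ) (e : RExp)
  | rstore (A : ℕ) (i : WExp) (e : RExp)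
  | seq (p q : Cmd)
  | cond (b : Test) (p q : Cmd)
  | loop (b : Test) (p : Cmd)

def WExp.eval (s : State) : WExp → ℕ
  | const c => c
  | var x => s.w x
  | arr A i => s.a A (i.eval s)
  | add e f => e.eval s + f.eval s
  | sub e f => e.eval s - f.eval s
  | mul e f => e.eval s * f.eval s
  | div e f => e.eval s / f.eval s

/-- Number of elementary operations in the evaluation. -/
def WExp.cost : WExp → ℕ
  | const _ => 1
  | var _ => 1
  | arr _ i => i.cost + 1
  | add e f => e.cost + f.cost + 1
  | sub e f => e.cost + f.cost + 1
  | mul e f => e.cost + f.cost + 1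
  | div e f => e.cost + f.cost + 1

noncomputable def RExp.eval (s : State) : RExp → ℝ
  | ofWord e => (e.eval s : ℝ)
  | var x => s.r x
  | arr A i => s.ra A (i.eval s)
  | add e f => e.eval s + f.eval s
  | sub e f => e.eval s - f.eval s
  | mul e f => e.eval s * f.eval s
  | div e f => e.eval s / f.eval s

def RExp.cost : RExp → ℕ
  | ofWord e => e.cost + 1
  | var _ => 1
  | arr _ i => i.cost + 1
  | add e f => e.cost + f.cost + 1
  | sub e f => e.cost + f.cost + 1
  | mul e f => e.cost + f.cost + 1
  | div e f => e.cost + f.cost + 1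

def Test.holds (s : State) : Test → Prop
  | lt e f => e.eval s < f.eval s
  | eq e f => e.eval s = f.eval s
  | rlt e f => e.eval s < f.eval s
  | not b => ¬ b.holds s
  | and b c => b.holds s ∧ c.holds s

def Test.cost : Test → ℕ
  | lt e f => e.cost + f.cost + 1
  | eq e f => e.cost + f.cost + 1
  | rlt e f => e.cost + f.cost + 1
  | not b => b.cost + 1
  | and b c => b.cost + c.cost + 1

/-- `Exec W p s t s'`: on a machine with word bound `W`, program `p` started in state `s` halts in
state `s'` after exactly `t` elementary steps. An assignment of a word that is not below `W` cannot
be executed. (The intermediate values of an expression are bounded by a power of `W` that depends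
only on the program text, so they occupy a constant number of words.) -/
inductive Exec (W : ℕ) : Cmd → State → ℕ → State → Prop where
  | skip (s : State) : Exec W .skip s 1 s
  | set (s : State) (x : ℕ) (e : WExp) (h : e.eval s < W) :
      Exec W (.set x e) s (e.cost + 1) { s with w := Function.update s.w x (e.eval s) }
  | store (s : State) (A : ℕ) (i e : WExp) (h : e.eval s < W) :
      Exec W (.store A i e) s (i.cost + e.cost + 1)
        { s with a := Function.update s.a A (Function.update (s.a A) (i.eval s) (e.eval s)) }
  | rset (s : State) (x : ℕ) (e : RExp) :
      Exec W (.rset x e) s (e.cost + 1) { s with r := Function.update s.r x (e.eval s) }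
  | rstore (s : State) (A : ℕ) (i : WExp) (e : RExp) :
      Exec W (.rstore A i e) s (i.cost + e.cost + 1)
        { s with ra := Function.update s.ra A (Function.update (s.ra A) (i.eval s) (e.eval s)) }
  | seq {p q : Cmd} {s s₁ s₂ : State} {t₁ t₂ : ℕ} (h₁ : Exec W p s t₁ s₁)
      (h₂ : Exec W q s₁ t₂ s₂) : Exec W (.seq p q) s (t₁ + t₂) s₂
  | condTrue {b : Test} {p q : Cmd} {s s' : State} {t : ℕ} (hb : b.holds s)
      (h : Exec W p s t s') : Exec W (.cond b p q) s (b.cost + t) s'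
  | condFalse {b : Test} {p q : Cmd} {s s' : State} {t : ℕ} (hb : ¬ b.holds s)
      (h : Exec W q s t s') : Exec W (.cond b p q) s (b.cost + t) s'
  | loopTrue {b : Test} {p : Cmd} {s s₁ s₂ : State} {t₁ t₂ : ℕ} (hb : b.holds s)
      (h₁ : Exec W p s t₁ s₁) (h₂ : Exec W (.loop b p) s₁ t₂ s₂) :
      Exec W (.loop b p) s (b.cost + t₁ + t₂) s₂
  | loopFalse {b : Test} {p : Cmd} {s : State} (hb : ¬ b.holds s) :
      Exec W (.loop b p) s b.cost s

/-! ## Input and output conventions -/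

/-- Adjacency list representation of a graph `H` whose nodes are numbered by `name`: the numbers of
the neighbours of node `i` stand, once each and in any order, in
`nb (off i), …, nb (off (i + 1) - 1)`. -/
structure IsAdjList {X : Type*} {N : ℕ} (H : SimpleGraph X) (name : Fin N ≃ X)
    (off nb : ℕ → ℕ) : Prop where
  zero : off 0 = 0
  mono : ∀ i : Fin N, off i ≤ off (i + 1)
  sound : ∀ i : Fin N, ∀ p, off i ≤ p → p < off (i + 1) →
    ∃ j : Fin N, nb p = j ∧ H.Adj (name i) (name j)
  complete : ∀ i j : Fin N, H.Adj (name i) (name j) →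
    ∃! p, off i ≤ p ∧ p < off (i + 1) ∧ nb p = j

/-- `off`, `nb` are adjacency lists of the input graph; unused cells hold `0`. -/
structure IsInput {n : ℕ} (G : SimpleGraph (Fin n)) (off nb : ℕ → ℕ) : Prop where
  adj : IsAdjList G (Equiv.refl (Fin n)) off nb
  off_unused : ∀ i, n < i → off i = 0
  nb_unused : ∀ p, off n ≤ p → nb p = 0

/-- Start: `n` in word variable 0, the adjacency lists in word arrays 0 and 1, `lam` in real
variable 0, and `0` everywhere else. -/
def initState (n : ℕ) (lam : ℝ) (off nb : ℕ → ℕ) : State where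
  w x := if x = 0 then n else 0
  a A := if A = 0 then off else if A = 1 then nb else fun _ => 0
  r x := if x = 0 then lam else 0
  ra _ _ := 0

/-- The wedge graph of `G` in memory: its nodes are numbered `0, …, N - 1`, node `i` is the edge of
`G` with endpoints `x i` and `y i`, and `off`, `nb` are adjacency lists. -/
def IsWedgeGraphArrays {n : ℕ} (G : SimpleGraph (Fin n)) (N : ℕ) (x y off nb : ℕ → ℕ) : Prop :=
  ∃ name : Fin N ≃ wedgeVerts G,
    (∀ i : Fin N, (name i).1.map (fun v : Fin n => (v : ℕ)) = s(x i, y i)) ∧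
    IsAdjList (wedgeGraph G) name off nb

/-- A function `f` on edges in memory: `arr p` is the value at the edge that entry `p` of the input
adjacency lists stands for. -/
def IsEdgeArray {n : ℕ} {α : Type*} (G : SimpleGraph (Fin n)) (off nb : ℕ → ℕ)
    (f : Sym2 (Fin n) → α) (arr : ℕ → α) : Prop :=
  ∀ u v : Fin n, G.Adj u v → ∀ p, off u ≤ p → p < off (u + 1) → nb p = v → arr p = f s(u, v)

/-- The final memory holds all the results of a run of STC-Peel: the wedge graph of `G`, the labeling
of `G` (`1` for weak, `0` for strong), the weighted graph `H`, the removal order, the set `U`, the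
wedge graph of `G(U)` and the labeling of `G(U)`. -/
def IsOutput {n : ℕ} (G : SimpleGraph (Fin n)) (lam : ℝ) (off nb : ℕ → ℕ) (s : State) : Prop :=
  ∃ (weak : Set (Sym2 (Fin n))) (order : Equiv.Perm (Fin n)) (U : Finset (Fin n))
    (weak' : Set (Sym2 (Fin n))),
    IsRun G lam weak order U weak' ∧
    IsWedgeGraphArrays G (s.w 1) (s.a 2) (s.a 3) (s.a 4) (s.a 5) ∧
    IsEdgeArray G off nb (weak.indicator fun _ => 1) (s.a 6) ∧
    IsEdgeArray G off nb (weight weak lam) (s.ra 0) ∧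
    (∀ i : Fin n, s.a 7 i = order i) ∧
    (∀ v : Fin n, s.a 8 v = if v ∈ U then 1 else 0) ∧
    IsWedgeGraphArrays (sub G U) (s.w 2) (s.a 9) (s.a 10) (s.a 11) (s.a 12) ∧
    IsEdgeArray (sub G U) off nb (weak'.indicator fun _ => 1) (s.a 13)

open Classical in
/-- `Σ_v deg(v)² + (m + n log n) + (m' + n')`. -/
noncomputable def timeBound {n : ℕ} (G : SimpleGraph (Fin n)) : ℝ :=
  ∑ v, (G.degree v : ℝ) ^ 2 + ((G.edgeSet.ncard : ℝ) + n * Real.log n) +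
    (((wedgeGraph G).edgeSet.ncard : ℝ) + ((wedgeVerts G).ncard : ℝ))

end STCPeel

/-!
Both labelings, of `G` and of `G(U)`, run the same program, which enumerates the wedges by going
through all pairs of neighbours of every vertex `y`. This takes time `O(∑ deg(y)²)` because
adjacency and labels are kept in `n × n` matrices, which need no initialization: all memory is `0`
at the start, and only cells of edges of `G` are ever written. The greedy rule "if both edges of
the wedge are unlabeled, label them weak" finds a maximal matching of the wedge graph, and a second
enumeration of the wedges yields its adjacency lists.

A comparison-based heap would make the peeling cost `O(m log n)`, which is too much. But the
weighted degree of a vertex is `a + λ b`, where `a` and `b` count its strong and weak edges to the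
remaining vertices, and vertices with the same pair `(a, b)` can share a cell. Make the cells a
tree, in which `(a, b)` hangs below `(a - 1, b)` and `(0, b)` below `(0, b - 1)`, and keep in every
cell the least key of its subtree. A change of the key of `u` affects only a path of length
`a + b ≤ deg(u)`, and each edge `vu` lowers the key of `u` once, so all updates together take time
`O(∑_v ∑_{u ∈ N(v)} deg(u)) = O(∑ deg(u)²)`. The sets of the peeling are then compared in the
reverse order, since the total weight inside a set grows, with each vertex put back, by the
weighted degree at which that vertex was removed.

In the second part, `∑ deg(v)² ≤ n ∑ deg(v) = 2nm`; an edge of the wedge graph comes from two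
neighbours of one vertex, so `m' ≤ ∑ deg(v)²`; and `n' ≤ m`.
-/

namespace STCPeel

local infixr:60 " ;; " => Cmd.seq
local infixl:65 " +ₑ " => WExp.add
local infixl:65 " -ₑ " => WExp.sub
local infixl:70 " *ₑ " => WExp.mul

/-! ## Weakest preconditions with step counts -/

namespace State

/-- Assignment to a word variable. -/
def setW (s : State) (x v : ℕ) : State := { s with w := Function.update s.w x v }

/-- Assignment to a cell of a word array. -/
def setA (s : State) (A i v : ℕ) : State :=
  { s with a := Function.update s.a A (Function.update (s.a A) i v) }

/-- Assignment to a real variable. -/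
noncomputable def setR (s : State) (x : ℕ) (v : ℝ) : State :=
  { s with r := Function.update s.r x v }

/-- Assignment to a cell of a real array. -/
noncomputable def setRA (s : State) (A i : ℕ) (v : ℝ) : State :=
  { s with ra := Function.update s.ra A (Function.update (s.ra A) i v) }

variable (s : State) (x y v A B i : ℕ) (c : ℝ)

@[simp] theorem setW_w : (s.setW x v).w y = if y = x then v else s.w y := by
  simp [setW, Function.update_apply]
@[simp] theorem setW_a : (s.setW x v).a = s.a := rfl
@[simp] theorem setW_r : (s.setW x v).r = s.r := rfl
@[simp] theorem setW_ra : (s.setW x v).ra = s.ra := rfl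
@[simp] theorem setA_w : (s.setA A i v).w = s.w := rfl
@[simp] theorem setA_a_self : (s.setA A i v).a A = Function.update (s.a A) i v := by
  simp [setA]
@[simp] theorem setA_a_of_ne (h : B ≠ A) : (s.setA A i v).a B = s.a B := by
  simp [setA, h]
@[simp] theorem setA_r : (s.setA A i v).r = s.r := rfl
@[simp] theorem setA_ra : (s.setA A i v).ra = s.ra := rfl
@[simp] theorem setR_w : (s.setR x c).w = s.w := rfl
@[simp] theorem setR_a : (s.setR x c).a = s.a := rfl
@[simp] theorem setR_r : (s.setR x c).r y = if y = x then c else s.r y := by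
  simp [setR, Function.update_apply]
@[simp] theorem setRA_w : (s.setRA A i c).w = s.w := rfl
@[simp] theorem setRA_a : (s.setRA A i c).a = s.a := rfl
@[simp] theorem setRA_ra_self : (s.setRA A i c).ra A = Function.update (s.ra A) i c := by
  simp [setRA]
@[simp] theorem setRA_ra_of_ne (h : B ≠ A) : (s.setRA A i c).ra B = s.ra B := by
  simp [setRA, h]

/-- All words of the state fit into a machine word. -/
structure Bdd (W : ℕ) (s : State) : Prop where
  w : ∀ x, s.w x < W
  a : ∀ A i, s.a A i < W

variable {s x v A i} {W : ℕ}

theorem Bdd.setW (h : s.Bdd W) (hv : v < W) : (s.setW x v).Bdd W := by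
  refine ⟨fun y => ?_, h.a⟩
  rw [setW_w]
  split_ifs
  exacts [hv, h.w y]

theorem Bdd.setA (h : s.Bdd W) (hv : v < W) : (s.setA A i v).Bdd W := by
  refine ⟨h.w, fun B j => ?_⟩
  by_cases hB : B = A
  · subst hB
    rw [setA_a_self, Function.update_apply]
    split_ifs
    exacts [hv, h.a _ _]
  · rw [setA_a_of_ne _ _ _ _ _ hB]
    exact h.a _ _

theorem Bdd.pos (h : s.Bdd W) : 0 < W :=
  (Nat.zero_le _).trans_lt (h.w 0)

/-- The states `s` and `s'` differ at most in the word variables listed in `X`. -/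
structure EqOff (X : List ℕ) (s s' : State) : Prop where
  w : ∀ x, x ∉ X → s'.w x = s.w x
  a : s'.a = s.a
  r : s'.r = s.r
  ra : s'.ra = s.ra

theorem eqOff_setW {X : List ℕ} (hx : x ∈ X) : EqOff X s (s.setW x v) where
  w y hy := by rw [setW_w, if_neg (ne_of_mem_of_not_mem hx hy).symm]
  a := rfl
  r := rfl
  ra := rfl

theorem EqOff.trans {X : List ℕ} {s s' s'' : State} (h : EqOff X s s') (h' : EqOff X s' s'') :
    EqOff X s s'' where
  w x hx := (h'.w x hx).trans (h.w x hx)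
  a := h'.a.trans h.a
  r := h'.r.trans h.r
  ra := h'.ra.trans h.ra

theorem EqOff.mono {X Y : List ℕ} {s s' : State} (h : EqOff X s s') (hXY : X ⊆ Y) :
    EqOff Y s s' :=
  ⟨fun x hx => h.w x fun hx' => hx (hXY hx'), h.a, h.r, h.ra⟩

end State

/-- `p`, started in `s`, halts after some number of steps `t` in some state `s'` with `Q t s'`. -/
def WP (W : ℕ) (p : Cmd) (s : State) (Q : ℕ → State → Prop) : Prop :=
  ∃ t s', Exec W p s t s' ∧ Q t s'

section Rules

variable {W : ℕ} {p q : Cmd} {s : State} {Q Q' : ℕ → State → Prop}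

theorem WP.mono (h : WP W p s Q) (hQ : ∀ t s', Q t s' → Q' t s') : WP W p s Q' := by
  obtain ⟨t, s', he, hq⟩ := h
  exact ⟨t, s', he, hQ _ _ hq⟩

@[simp] theorem wp_skip : WP W .skip s Q ↔ Q 1 s := by
  constructor
  · rintro ⟨t, s', ⟨⟩, hq⟩
    exact hq
  · exact fun h => ⟨_, _, .skip s, h⟩

@[simp] theorem wp_set {x : ℕ} {e : WExp} :
    WP W (.set x e) s Q ↔ e.eval s < W ∧ Q (e.cost + 1) (s.setW x (e.eval s)) := by
  constructor
  · rintro ⟨t, s', he, hq⟩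
    cases he with
    | set _ _ _ h => exact ⟨h, hq⟩
  · exact fun h => ⟨_, _, .set s x e h.1, h.2⟩

@[simp] theorem wp_store {A : ℕ} {i e : WExp} :
    WP W (.store A i e) s Q ↔
      e.eval s < W ∧ Q (i.cost + e.cost + 1) (s.setA A (i.eval s) (e.eval s)) := by
  constructor
  · rintro ⟨t, s', he, hq⟩
    cases he with
    | store _ _ _ _ h => exact ⟨h, hq⟩
  · exact fun h => ⟨_, _, .store s A i e h.1, h.2⟩

@[simp] theorem wp_rset {x : ℕ} {e : RExp} :
    WP W (.rset x e) s Q ↔ Q (e.cost + 1) (s.setR x (e.eval s)) := by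
  constructor
  · rintro ⟨t, s', ⟨⟩, hq⟩
    exact hq
  · exact fun h => ⟨_, _, .rset s x e, h⟩

@[simp] theorem wp_rstore {A : ℕ} {i : WExp} {e : RExp} :
    WP W (.rstore A i e) s Q ↔ Q (i.cost + e.cost + 1) (s.setRA A (i.eval s) (e.eval s)) := by
  constructor
  · rintro ⟨t, s', ⟨⟩, hq⟩
    exact hq
  · exact fun h => ⟨_, _, .rstore s A i e, h⟩

@[simp] theorem wp_seq :
    WP W (p ;; q) s Q ↔ WP W p s fun t s' => WP W q s' fun t' s'' => Q (t + t') s'' := by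
  constructor
  · rintro ⟨t, s', he, hq⟩
    cases he with
    | seq h₁ h₂ => exact ⟨_, _, h₁, _, _, h₂, hq⟩
  · rintro ⟨t, s', h₁, t', s'', h₂, hq⟩
    exact ⟨_, _, .seq h₁ h₂, hq⟩

@[simp] theorem wp_cond {b : Test} :
    WP W (.cond b p q) s Q ↔
      (b.holds s → WP W p s fun t s' => Q (b.cost + t) s') ∧
      (¬ b.holds s → WP W q s fun t s' => Q (b.cost + t) s') := by
  constructor
  · rintro ⟨t, s', he, hq⟩
    cases he with
    | condTrue hb h => exact ⟨fun _ => ⟨_, _, h, hq⟩, fun k => absurd hb k⟩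
    | condFalse hb h => exact ⟨fun k => absurd k hb, fun _ => ⟨_, _, h, hq⟩⟩
  · rintro ⟨h₁, h₂⟩
    by_cases hb : b.holds s
    · obtain ⟨t, s', h, hq⟩ := h₁ hb
      exact ⟨_, _, .condTrue hb h, hq⟩
    · obtain ⟨t, s', h, hq⟩ := h₂ hb
      exact ⟨_, _, .condFalse hb h, hq⟩

end Rules

attribute [simp] WExp.eval WExp.cost RExp.eval RExp.cost Test.holds Test.cost

/-! ## What a program leaves unchanged -/

/-- The targets of assignments; an array is one target, whatever the index. -/
inductive Loc where
  | word (x : ℕ)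
  | wordArray (A : ℕ)
  | real (x : ℕ)
  | realArray (A : ℕ)
  deriving DecidableEq

/-- `p` contains an assignment to `l`. -/
@[simp] def Cmd.writes : Cmd → Loc → Bool
  | skip, _ => false
  | set x _, l => decide (l = .word x)
  | store A _ _, l => decide (l = .wordArray A)
  | rset x _, l => decide (l = .real x)
  | rstore A _ _, l => decide (l = .realArray A)
  | seq p q, l => p.writes l || q.writes l
  | cond _ p q, l => p.writes l || q.writes l
  | loop _ p, l => p.writes l

/-- `s'` may result from `s` by a run of `p`, as far as the text of `p` tells: the two states agree
on everything that `p` does not assign, and no word outgrows a machine word. -/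
structure Frame (W : ℕ) (p : Cmd) (s s' : State) : Prop where
  w : ∀ x, p.writes (.word x) = false → s'.w x = s.w x
  a : ∀ A, p.writes (.wordArray A) = false → s'.a A = s.a A
  r : ∀ x, p.writes (.real x) = false → s'.r x = s.r x
  ra : ∀ A, p.writes (.realArray A) = false → s'.ra A = s.ra A
  bdd : s.Bdd W → s'.Bdd W

section Frame

variable {W : ℕ} {p q : Cmd} {s s' s'' : State}

theorem Frame.refl : Frame W p s s :=
  ⟨fun _ _ => rfl, fun _ _ => rfl, fun _ _ => rfl, fun _ _ => rfl, id⟩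

theorem Frame.trans (h : Frame W p s s') (h' : Frame W p s' s'') : Frame W p s s'' :=
  ⟨fun x hx => (h'.w x hx).trans (h.w x hx), fun A hA => (h'.a A hA).trans (h.a A hA),
    fun x hx => (h'.r x hx).trans (h.r x hx), fun A hA => (h'.ra A hA).trans (h.ra A hA),
    fun hb => h'.bdd (h.bdd hb)⟩

theorem Frame.mono (h : Frame W p s s') (hpq : ∀ l, q.writes l = false → p.writes l = false) :
    Frame W q s s' :=
  ⟨fun x hx => h.w x (hpq _ hx), fun A hA => h.a A (hpq _ hA), fun x hx => h.r x (hpq _ hx),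
    fun A hA => h.ra A (hpq _ hA), h.bdd⟩

theorem Frame.seq_left (h : Frame W p s s') : Frame W (p ;; q) s s' :=
  h.mono fun l hl => by simp_all

theorem Frame.seq_right (h : Frame W q s s') : Frame W (p ;; q) s s' :=
  h.mono fun l hl => by simp_all

theorem frame_set {x v : ℕ} {e : WExp} (hv : v < W) : Frame W (.set x e) s (s.setW x v) where
  w y hy := by
    have hyx : y ≠ x := by simpa using hy
    simp [hyx]
  a _ _ := rfl
  r _ _ := rfl
  ra _ _ := rfl
  bdd hb := hb.setW hv

theorem frame_store {A j v : ℕ} {i e : WExp} (hv : v < W) :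
    Frame W (.store A i e) s (s.setA A j v) where
  w _ _ := rfl
  a B hB := State.setA_a_of_ne _ _ _ _ _ (by simpa using hB)
  r _ _ := rfl
  ra _ _ := rfl
  bdd hb := hb.setA hv

theorem frame_rset {x : ℕ} {c : ℝ} {e : RExp} : Frame W (.rset x e) s (s.setR x c) where
  w _ _ := rfl
  a _ _ := rfl
  r y hy := by
    have hyx : y ≠ x := by simpa using hy
    simp [hyx]
  ra _ _ := rfl
  bdd hb := ⟨hb.w, hb.a⟩

theorem frame_rstore {A j : ℕ} {c : ℝ} {i : WExp} {e : RExp} :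
    Frame W (.rstore A i e) s (s.setRA A j c) where
  w _ _ := rfl
  a _ _ := rfl
  r _ _ := rfl
  ra B hB := State.setRA_ra_of_ne _ _ _ _ _ (by simpa using hB)
  bdd hb := ⟨hb.w, hb.a⟩

theorem Exec.frame {t : ℕ} (h : Exec W p s t s') : Frame W p s s' := by
  induction h with
  | skip => exact .refl
  | set _ _ _ h => exact frame_set h
  | store _ _ _ _ h => exact frame_store h
  | rset => exact frame_rset
  | rstore => exact frame_rstore
  | seq _ _ ih₁ ih₂ => exact ih₁.seq_left.trans ih₂.seq_right
  | condTrue _ _ ih => exact ih.mono fun l hl => by simp_all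
  | condFalse _ _ ih => exact ih.mono fun l hl => by simp_all
  | loopTrue _ _ _ ih₁ ih₂ => exact .trans (ih₁.mono fun _ hl => hl) ih₂
  | loopFalse => exact .refl

theorem WP.mono_frame {Q Q' : ℕ → State → Prop} (h : WP W p s Q)
    (hQ : ∀ t s', Q t s' → Frame W p s s' → Q' t s') : WP W p s Q' := by
  obtain ⟨t, s', he, hq⟩ := h
  exact ⟨t, s', he, hQ _ _ hq he.frame⟩

end Frame

/-! ## Loops -/

/-- `while x < h do (body; x := x + 1)`. -/
def countTo (x h : ℕ) (body : Cmd) : Cmd :=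
  .loop (.lt (.var x) (.var h)) (body ;; .set x (.var x +ₑ .const 1))

/-- `for x = 0, …, h - 1 do body`. -/
def upTo (x h : ℕ) (body : Cmd) : Cmd :=
  .set x (.const 0) ;; countTo x h body

section Loops

variable {W : ℕ} {body : Cmd} {s : State} {Q : ℕ → State → Prop}

@[simp] theorem writes_countTo {x h : ℕ} {l : Loc} :
    (countTo x h body).writes l = (body.writes l || decide (l = .word x)) := rfl

@[simp] theorem writes_upTo {x h : ℕ} {l : Loc} :
    (upTo x h body).writes l =
      (decide (l = .word x) || (body.writes l || decide (l = .word x))) := rfl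

/-- In `I d t s`, the number `d` bounds the rounds still to come and `t` is the time used so far. -/
theorem wp_loop {b : Test} {d : ℕ} (I : ℕ → ℕ → State → Prop) (start : I d 0 s)
    (step : ∀ d t s, I d t s → b.holds s →
      WP W body s fun t' s' => ∃ d' < d, I d' (t + (b.cost + t')) s')
    (post : ∀ d t s, I d t s → ¬ b.holds s → Q (t + b.cost) s) : WP W (.loop b body) s Q := by
  suffices H : ∀ d t s, I d t s → WP W (.loop b body) s fun t' s' => Q (t + t') s' by
    simpa only [zero_add] using H d 0 s start
  clear start
  intro d
  induction d using Nat.strong_induction_on with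
  | _ d ih =>
    intro t s hI
    by_cases hb : b.holds s
    · obtain ⟨t', s', hbody, d', hd', hI'⟩ := step d t s hI hb
      obtain ⟨t'', s'', hloop, hQ⟩ := ih d' hd' _ _ hI'
      exact ⟨_, _, .loopTrue hb hbody hloop, by rwa [add_assoc] at hQ⟩
    · exact ⟨_, _, .loopFalse hb, post d t s hI hb⟩

theorem wp_countTo {x h : ℕ} (I : ℕ → ℕ → State → Prop)
    (hx : body.writes (.word x) = false) (hh : body.writes (.word h) = false) (hxh : x ≠ h)
    (hb : s.Bdd W) (hle : s.w x ≤ s.w h) (start : I (s.w x) 0 s)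
    (step : ∀ i t s₁, s.w x ≤ i → i < s.w h → Frame W (countTo x h body) s s₁ → s₁.w x = i →
      I i t s₁ → WP W body s₁ fun t' s₂ => I (i + 1) (t + (t' + 7)) (s₂.setW x (i + 1)))
    (post : ∀ t s', Frame W (countTo x h body) s s' → I (s.w h) t s' → Q (t + 3) s') :
    WP W (countTo x h body) s Q := by
  have hbound : ∀ s', Frame W (countTo x h body) s s' → s'.w h = s.w h := fun s' hf =>
    hf.w h (by simp [hh, hxh.symm])
  refine wp_loop (d := s.w h - s.w x) (fun d t s' => d = s.w h - s'.w x ∧ s.w x ≤ s'.w x ∧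
    s'.w x ≤ s.w h ∧ Frame W (countTo x h body) s s' ∧ I (s'.w x) t s')
    ⟨rfl, le_rfl, hle, .refl, start⟩ ?_ ?_
  · rintro d t s₁ ⟨rfl, hlo, -, hf, hI⟩ hlt
    have hlt : s₁.w x < s.w h := by simpa [hbound s₁ hf] using hlt
    rw [wp_seq]
    refine (step _ t s₁ hlo hlt hf rfl hI).mono_frame fun t' s₂ hI' hf' => ?_
    have hx₂ : s₂.w x = s₁.w x := hf'.w x hx
    have hW : s₁.w x + 1 < W := lt_of_le_of_lt hlt (hb.w h)
    have hf₂ : Frame W (countTo x h body) s (s₂.setW x (s₁.w x + 1)) :=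
      hf.trans (Frame.mono (p := body ;; .set x (.var x +ₑ .const 1))
        (hf'.seq_left.trans (frame_set hW).seq_right) fun _ hl => hl)
    simp only [wp_set, WExp.eval, hx₂, WExp.cost, Test.cost, State.setW_w, if_true]
    refine ⟨hW, _, by omega, rfl, by omega, hlt, hf₂, ?_⟩
    convert hI' using 1
    omega
  · rintro d t s₁ ⟨rfl, -, hhi, hf, hI⟩ hlt
    have heq : s₁.w x = s.w h := by
      simp only [Test.holds, WExp.eval, hbound s₁ hf] at hlt
      omega
    exact post t s₁ hf (heq ▸ hI)

theorem wp_upTo_time {x h N : ℕ} (I : ℕ → ℕ → State → Prop)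
    (hx : body.writes (.word x) = false) (hh : body.writes (.word h) = false) (hxh : x ≠ h)
    (hb : s.Bdd W) (hN : s.w h = N) (start : I 0 0 (s.setW x 0))
    (step : ∀ i t s₁, i < N → Frame W (upTo x h body) s s₁ → s₁.w x = i → I i t s₁ →
      WP W body s₁ fun t' s₂ => I (i + 1) (t + (t' + 7)) (s₂.setW x (i + 1)))
    (post : ∀ t s', Frame W (upTo x h body) s s' → I N t s' → Q (t + 5) s') :
    WP W (upTo x h body) s Q := by
  have hinit : Frame W (upTo x h body) s (s.setW x 0) := (frame_set hb.pos).seq_left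
  have hh₀ : (s.setW x 0).w h = N := by simp [hxh.symm, hN]
  rw [upTo, wp_seq, wp_set]
  refine ⟨hb.pos, wp_countTo I hx hh hxh (hb.setW hb.pos) (by simp) (by simpa using start) ?_ ?_⟩
  · intro i t s₁ _ hi hf hx₁ hI
    rw [WExp.eval, hh₀] at hi
    exact step i t s₁ hi (hinit.trans hf.seq_right) hx₁ hI
  · intro t s' hf hI
    rw [WExp.eval, hh₀] at hI
    have hQ := post t s' (hinit.trans hf.seq_right) hI
    rwa [WExp.cost, show 1 + 1 + (t + 3) = t + 5 by omega]

theorem wp_upTo {x h N : ℕ} (I : ℕ → State → Prop) (T : ℕ → ℕ)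
    (hx : body.writes (.word x) = false) (hh : body.writes (.word h) = false) (hxh : x ≠ h)
    (hb : s.Bdd W) (hN : s.w h = N) (start : I 0 (s.setW x 0))
    (step : ∀ i s₁, i < N → Frame W (upTo x h body) s s₁ → s₁.w x = i → I i s₁ →
      WP W body s₁ fun t s₂ => t ≤ T i ∧ I (i + 1) (s₂.setW x (i + 1)))
    (post : ∀ t s', t ≤ ∑ i ∈ Finset.range N, (T i + 7) + 5 → Frame W (upTo x h body) s s' →
      I N s' → Q t s') :
    WP W (upTo x h body) s Q := by
  refine wp_upTo_time (fun i t s => t ≤ ∑ j ∈ Finset.range i, (T j + 7) ∧ I i s) hx hh hxh hb hN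
    ⟨by simp, start⟩ ?_ fun t s' hf hI => post _ _ (by omega) hf hI.2
  rintro i t s₁ hi hf hx₁ ⟨ht, hI⟩
  refine (step i s₁ hi hf hx₁ hI).mono fun t' s₂ ⟨_, hI₂⟩ => ⟨?_, hI₂⟩
  rw [Finset.sum_range_succ]
  omega

end Loops

/-! ## Loops over the adjacency lists -/

local notation "wN" => 0
local notation "wU" => 3
local notation "wPos" => 4
local notation "wEnd" => 5
local notation "wV" => 6
local notation "aOff" => 0
local notation "aNb" => 1
local notation "rLam" => 0

section AdjacencyLists

variable {n : ℕ} {G : SimpleGraph (Fin n)} {off nb : ℕ → ℕ}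

open Classical in
/-- The neighbours of a vertex. -/
noncomputable def nbrs (G : SimpleGraph (Fin n)) (u : Fin n) : Finset (Fin n) :=
  Finset.univ.filter (G.Adj u)

@[simp] theorem mem_nbrs {u v : Fin n} : v ∈ nbrs G u ↔ G.Adj u v := by
  simp [nbrs]

open Classical in
/-- The ordered pairs of adjacent vertices. -/
noncomputable def arcs (G : SimpleGraph (Fin n)) : Finset (Fin n × Fin n) :=
  Finset.univ.filter fun a => G.Adj a.1 a.2

@[simp] theorem mem_arcs {a : Fin n × Fin n} : a ∈ arcs G ↔ G.Adj a.1 a.2 := by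
  simp [arcs]

/-- Entry `p` of the adjacency lists belongs to the list of `u` and contains `v`. -/
structure IsEntry (off nb : ℕ → ℕ) (u v p : ℕ) : Prop where
  le : off u ≤ p
  lt : p < off (u + 1)
  nb_eq : nb p = v

theorem IsInput.exists_adj (hG : IsInput G off nb) {u : Fin n} {p : ℕ} (hp : off u ≤ p)
    (hp' : p < off (u + 1)) : ∃ v : Fin n, G.Adj u v ∧ IsEntry off nb u v p := by
  obtain ⟨v, hv, hadj⟩ := hG.adj.sound u p hp hp'
  exact ⟨v, hadj, hp, hp', hv⟩

theorem IsInput.exists_isEntry (hG : IsInput G off nb) {u v : Fin n} (h : G.Adj u v) :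
    ∃ p, IsEntry off nb u v p := by
  obtain ⟨p, hp, hp', hv⟩ := (hG.adj.complete u v h).exists
  exact ⟨p, hp, hp', hv⟩

theorem IsEntry.unique (hG : IsInput G off nb) {u v : Fin n} (h : G.Adj u v) {p q : ℕ}
    (hp : IsEntry off nb u v p) (hq : IsEntry off nb u v q) : p = q :=
  (hG.adj.complete u v h).unique ⟨hp.le, hp.lt, hp.nb_eq⟩ ⟨hq.le, hq.lt, hq.nb_eq⟩

open Classical in
/-- The neighbours of `u` that stand before position `i` in the adjacency list of `u`. -/
noncomputable def nbrsBefore (G : SimpleGraph (Fin n)) (off nb : ℕ → ℕ) (u : Fin n) (i : ℕ) :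
    Finset (Fin n) :=
  (nbrs G u).filter fun v => ∃ p < i, IsEntry off nb u v p

theorem nbrsBefore_subset (u : Fin n) (i : ℕ) : nbrsBefore G off nb u i ⊆ nbrs G u := by
  classical
  exact Finset.filter_subset _ _

theorem nbrsBefore_off (u : Fin n) : nbrsBefore G off nb u (off u) = ∅ := by
  simp only [nbrsBefore, Finset.filter_eq_empty_iff]
  rintro v _ ⟨p, hp, he⟩
  exact hp.not_ge he.le

theorem nbrsBefore_off_succ (hG : IsInput G off nb) (u : Fin n) :
    nbrsBefore G off nb u (off (u + 1)) = nbrs G u := by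
  simp only [nbrsBefore, Finset.filter_eq_self, mem_nbrs]
  intro v hv
  obtain ⟨p, hp⟩ := hG.exists_isEntry hv
  exact ⟨p, hp.lt, hp⟩

theorem notMem_nbrsBefore (hG : IsInput G off nb) {u v : Fin n} {i : ℕ}
    (hi : IsEntry off nb u v i) : v ∉ nbrsBefore G off nb u i := by
  simp only [nbrsBefore, Finset.mem_filter, mem_nbrs, not_and]
  rintro hadj ⟨p, hp, he⟩
  exact hp.ne (he.unique hG hadj hi)

theorem nbrsBefore_succ {u v : Fin n} {i : ℕ} (hadj : G.Adj u v) (hi : IsEntry off nb u v i) :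
    nbrsBefore G off nb u (i + 1) = insert v (nbrsBefore G off nb u i) := by
  ext x
  simp only [nbrsBefore, Finset.mem_filter, Finset.mem_insert, mem_nbrs, Nat.lt_succ_iff_lt_or_eq]
  constructor
  · rintro ⟨hx, p, hp | rfl, he⟩
    · exact .inr ⟨hx, p, hp, he⟩
    · exact .inl (Fin.ext (he.nb_eq.symm.trans hi.nb_eq))
  · rintro (rfl | ⟨hx, p, hp, he⟩)
    · exact ⟨hadj, i, .inr rfl, hi⟩
    · exact ⟨hx, p, .inl hp, he⟩

open Classical in
/-- The arcs that start at one of the first `i` vertices. -/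
noncomputable def arcsBefore (G : SimpleGraph (Fin n)) (i : ℕ) : Finset (Fin n × Fin n) :=
  (arcs G).filter fun a => (a.1 : ℕ) < i

theorem arcsBefore_zero : arcsBefore G 0 = ∅ := by
  simp [arcsBefore]

theorem arcsBefore_card : arcsBefore G n = arcs G := by
  simp [arcsBefore]

theorem arcsBefore_succ (u : Fin n) :
    arcsBefore G (u + 1) = arcsBefore G u ∪ (nbrs G u).image (Prod.mk u) := by
  ext ⟨a, b⟩
  simp only [arcsBefore, Finset.mem_filter, mem_arcs, Finset.mem_union, Finset.mem_image, mem_nbrs,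
    Prod.mk.injEq, Nat.lt_succ_iff_lt_or_eq, Fin.val_inj]
  constructor
  · rintro ⟨hab, hlt | rfl⟩
    · exact .inl ⟨hab, hlt⟩
    · exact .inr ⟨b, hab, rfl, rfl⟩
  · rintro (⟨hab, hlt⟩ | ⟨b, hab, rfl, rfl⟩)
    · exact ⟨hab, .inl hlt⟩
    · exact ⟨hab, .inr rfl⟩

end AdjacencyLists

section EachNeighbour

variable {n : ℕ} {G : SimpleGraph (Fin n)} {off nb : ℕ → ℕ} {W b p h v : ℕ} {body : Cmd}
  {s : State} {Q : ℕ → State → Prop}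

/-- `for p = p, …, h - 1 do (v := entry p of the adjacency lists; body)`. -/
def eachEntry (p h v : ℕ) (body : Cmd) : Cmd :=
  countTo p h (.set v (.arr aNb (.var p)) ;; body)

/-- `for all neighbours v of b do body`; `p` is the position of `v` in the adjacency lists. -/
def eachNb (b p h v : ℕ) (body : Cmd) : Cmd :=
  .set p (.arr aOff (.var b)) ;; .set h (.arr aOff (.var b +ₑ .const 1)) ;; eachEntry p h v body

@[simp] theorem writes_eachNb {l : Loc} :
    (eachNb b p h v body).writes l = (decide (l = .word p) || (decide (l = .word h) ||
      (decide (l = .word v) || body.writes l || decide (l = .word p)))) := rfl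

theorem wp_eachEntry (hG : IsInput G off nb) (u : Fin n)
    (I : Finset (Fin n) → State → Prop) (T : Fin n → ℕ)
    (hbody : ∀ l ∈ [Loc.word p, .word h, .wordArray aNb], body.writes l = false)
    (hreg : [p, h, v].Nodup) (hb : s.Bdd W) (hnb : s.a aNb = nb) (hp : s.w p = off u)
    (hh : s.w h = off (u + 1))
    (inv : ∀ P s₁ s₂, State.EqOff [p, h, v] s₁ s₂ → I P s₁ → I P s₂) (start : I ∅ s)
    (step : ∀ P x s₁, P ⊆ nbrs G u → G.Adj u x → x ∉ P → Frame W (eachEntry p h v body) s s₁ →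
      s₁.w v = x → IsEntry off nb u x (s₁.w p) → I P s₁ →
      WP W body s₁ fun t s₂ => t ≤ T x ∧ I (insert x P) s₂)
    (post : ∀ t s', t ≤ ∑ x ∈ nbrs G u, (T x + 10) + 3 → Frame W (eachEntry p h v body) s s' →
      I (nbrs G u) s' → Q t s') :
    WP W (eachEntry p h v body) s Q := by
  simp only [List.mem_cons, List.not_mem_nil, or_false, forall_eq_or_imp, forall_eq] at hbody
  obtain ⟨hbp, hbh, hbnb⟩ := hbody
  obtain ⟨⟨hph, hpv⟩, hhv⟩ : (p ≠ h ∧ p ≠ v) ∧ h ≠ v := by simpa using hreg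
  refine wp_countTo (fun i t s => t ≤ ∑ x ∈ nbrsBefore G off nb u i, (T x + 10) ∧
    I (nbrsBefore G off nb u i) s) (by simp [hbp, hpv]) (by simp [hbh, hhv]) hph hb
    (by rw [hp, hh]; exact hG.adj.mono u) ?_ ?_ ?_
  · rw [hp, nbrsBefore_off]
    exact ⟨Nat.zero_le _, start⟩
  · rintro i t₀ s₁ hi hi' hf hi₁ ⟨_, hI⟩
    obtain ⟨x, hadj, hx⟩ := hG.exists_adj (hp ▸ hi) (hh ▸ hi')
    have hnb₁ : s₁.a aNb = nb := by rw [hf.a _ (by simp [hbnb]), hnb]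
    have hxW : (x : ℕ) < W := by
      rw [← hx.nb_eq, ← hnb]
      exact hb.a _ _
    have hread : (WExp.arr aNb (.var p)).eval s₁ = x := by
      rw [WExp.eval, WExp.eval, hi₁, hnb₁, hx.nb_eq]
    have hf' : Frame W (eachEntry p h v body) s (s₁.setW v x) :=
      hf.trans ((frame_set (e := .arr aNb (.var p)) hxW).mono fun l hl => by simp_all [eachEntry])
    rw [wp_seq, wp_set, hread]
    refine ⟨hxW, (step _ x _ (nbrsBefore_subset u i) hadj (notMem_nbrsBefore hG hx) hf'
      (by simp) (by simpa [hpv, hi₁] using hx) (inv _ _ _ (State.eqOff_setW (by simp)) hI)).mono ?_⟩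
    rintro t s₂ ⟨_, hI₂⟩
    rw [nbrsBefore_succ hadj hx, Finset.sum_insert (notMem_nbrsBefore hG hx)]
    refine ⟨?_, inv _ _ _ (State.eqOff_setW (by simp)) hI₂⟩
    simp only [WExp.cost]
    omega
  · rintro t s' hf ⟨ht, hI⟩
    rw [hh, nbrsBefore_off_succ hG] at ht hI
    exact post _ _ (by omega) hf hI

theorem wp_eachNb (hG : IsInput G off nb) (u : Fin n)
    (I : Finset (Fin n) → State → Prop) (T : Fin n → ℕ)
    (hbody : ∀ l ∈ [Loc.word p, .word h, .wordArray aNb], body.writes l = false)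
    (hreg : [b, p, h, v].Nodup) (hb : s.Bdd W) (hoff : s.a aOff = off) (hnb : s.a aNb = nb)
    (hu : s.w b = u)
    (inv : ∀ P s₁ s₂, State.EqOff [p, h, v] s₁ s₂ → I P s₁ → I P s₂) (start : I ∅ s)
    (step : ∀ P x s₁, P ⊆ nbrs G u → G.Adj u x → x ∉ P → Frame W (eachNb b p h v body) s s₁ →
      s₁.w v = x → IsEntry off nb u x (s₁.w p) → I P s₁ →
      WP W body s₁ fun t s₂ => t ≤ T x ∧ I (insert x P) s₂)
    (post : ∀ t s', t ≤ ∑ x ∈ nbrs G u, (T x + 10) + 11 → Frame W (eachNb b p h v body) s s' →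
      I (nbrs G u) s' → Q t s') :
    WP W (eachNb b p h v body) s Q := by
  obtain ⟨⟨hbp, -⟩, hreg'⟩ : (b ≠ p ∧ b ≠ h ∧ b ≠ v) ∧ [p, h, v].Nodup := by simpa using hreg
  have hph : p ≠ h := by
    rintro rfl
    simp at hreg'
  have hoffW : ∀ i, off i < W := fun i => hoff ▸ hb.a aOff i
  set s₀ := (s.setW p (off u)).setW h (off (u + 1)) with hs₀
  have hf₀ : Frame W (eachNb b p h v body) s s₀ :=
    (frame_set (hoffW _)).seq_left.trans (frame_set (hoffW _)).seq_left.seq_right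
  have h₀ : State.EqOff [p, h, v] s s₀ :=
    (State.eqOff_setW (by simp)).trans (State.eqOff_setW (by simp))
  simp only [eachNb, wp_seq, wp_set, WExp.eval, WExp.cost, State.setW_a, State.setW_w, hoff, hu,
    hbp, if_false, ← hs₀]
  refine ⟨hoffW _, hoffW _, wp_eachEntry hG u I T hbody hreg' (hf₀.bdd hb) (h₀.a ▸ hnb)
    (by simp [hs₀, hph]) (by simp [hs₀]) inv (inv _ _ _ h₀ start) ?_ ?_⟩
  · intro P x s₁ hP hadj hx hf
    exact step P x s₁ hP hadj hx (hf₀.trans hf.seq_right.seq_right)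
  · intro t s' ht hf hI
    exact post _ _ (by omega) (hf₀.trans hf.seq_right.seq_right) hI

end EachNeighbour

section EachArc

variable {n : ℕ} {G : SimpleGraph (Fin n)} {off nb : ℕ → ℕ} {lam : ℝ} {W : ℕ} {body : Cmd}
  {s : State} {Q : ℕ → State → Prop}

/-- The machine holds the input. -/
structure HoldsInput (off nb : ℕ → ℕ) (n : ℕ) (lam : ℝ) (W : ℕ) (s : State) : Prop where
  n_eq : s.w wN = n
  off_eq : s.a aOff = off
  nb_eq : s.a aNb = nb
  lam_eq : s.r rLam = lam
  bdd : s.Bdd W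

/-- The places where the input is stored. -/
def inputLocs : List Loc :=
  [.word wN, .wordArray aOff, .wordArray aNb, .real rLam]

theorem HoldsInput.frame {p : Cmd} {s' : State} (hs : HoldsInput off nb n lam W s)
    (hf : Frame W p s s') (hp : ∀ l ∈ inputLocs, p.writes l = false) :
    HoldsInput off nb n lam W s' where
  n_eq := (hf.w _ (hp _ (by simp [inputLocs]))).trans hs.n_eq
  off_eq := (hf.a _ (hp _ (by simp [inputLocs]))).trans hs.off_eq
  nb_eq := (hf.a _ (hp _ (by simp [inputLocs]))).trans hs.nb_eq
  lam_eq := (hf.r _ (hp _ (by simp [inputLocs]))).trans hs.lam_eq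
  bdd := hf.bdd hs.bdd

/-- A machine that holds the input and is at the arc from `u` to `v` in a loop over all arcs. -/
structure AtArc (off nb : ℕ → ℕ) (n : ℕ) (lam : ℝ) (W u v : ℕ) (s : State) : Prop
    extends HoldsInput off nb n lam W s where
  u_eq : s.w wU = u
  v_eq : s.w wV = v
  entry : IsEntry off nb u v (s.w wPos)

/-- `for all u, for all neighbours v of u do body`. -/
def eachArc (body : Cmd) : Cmd :=
  upTo wU wN (eachNb wU wPos wEnd wV body)

theorem eachArc_writes_eq_false {l : Loc} (hl : l ∉ [Loc.word wU, .word wPos, .word wEnd, .word wV])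
    (hbody : body.writes l = false) : (eachArc body).writes l = false := by
  simp_all [eachArc]

theorem wp_eachArc (hG : IsInput G off nb)
    (I : Finset (Fin n × Fin n) → State → Prop) (T : Fin n → Fin n → ℕ)
    (hbody : ∀ l ∈ inputLocs, body.writes l = false)
    (hreg : ∀ x ∈ [wU, wPos, wEnd], body.writes (.word x) = false)
    (hs : HoldsInput off nb n lam W s)
    (inv : ∀ D s₁ s₂, State.EqOff [wU, wPos, wEnd, wV] s₁ s₂ → I D s₁ → I D s₂)
    (start : I ∅ s)
    (step : ∀ D (u v : Fin n) s₁, D ⊆ arcs G → G.Adj u v → (u, v) ∉ D →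
      Frame W (eachArc body) s s₁ → AtArc off nb n lam W u v s₁ → I D s₁ →
      WP W body s₁ fun t s₂ => t ≤ T u v ∧ I (insert (u, v) D) s₂)
    (post : ∀ t s', t ≤ ∑ u, (∑ v ∈ nbrs G u, (T u v + 10) + 18) + 5 →
      Frame W (eachArc body) s s' → HoldsInput off nb n lam W s' → I (arcs G) s' → Q t s') :
    WP W (eachArc body) s Q := by
  classical
  have hframe : ∀ l ∈ inputLocs, (eachArc body).writes l = false := fun l hl =>
    eachArc_writes_eq_false (by revert l; decide) (hbody l hl)
  have hN : body.writes (.word wN) = false := hbody _ (by simp [inputLocs])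
  have hnb : body.writes (.wordArray aNb) = false := hbody _ (by simp [inputLocs])
  simp only [List.mem_cons, List.not_mem_nil, or_false, forall_eq_or_imp, forall_eq] at hreg
  obtain ⟨hU, hPos, hEnd⟩ := hreg
  refine wp_upTo (N := n) (fun i s => I (arcsBefore G i) s)
    (fun i => if hi : i < n then ∑ v ∈ nbrs G ⟨i, hi⟩, (T ⟨i, hi⟩ v + 10) + 11 else 0)
    (by simp [hU]) (by simp [hN]) (by decide) hs.bdd hs.n_eq
    (by simpa only [arcsBefore_zero] using inv _ _ _ (State.eqOff_setW (by simp)) start) ?_ ?_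
  · intro i s₁ hi hf hU₁ hI
    lift i to Fin n using hi
    have hs₁ := hs.frame hf hframe
    refine wp_eachNb hG i (fun P s => I (arcsBefore G i ∪ P.image (Prod.mk i)) s) (T i)
      (by simp [hPos, hEnd, hnb]) (by decide) hs₁.bdd hs₁.off_eq hs₁.nb_eq hU₁
      (fun P s₂ s₃ h => inv _ _ _ (h.mono (by simp))) (by simpa using hI) ?_ ?_
    · intro P v s₂ hP hadj hv hf₂ hv₂ hentry hI₂
      have hf' : Frame W (eachArc body) s s₂ :=
        hf.trans (hf₂.mono fun l hl => by simp_all [eachArc])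
      have hs₂ : AtArc off nb n lam W i v s₂ :=
        ⟨hs.frame hf' hframe, (hf₂.w _ (by simp [hU])).trans hU₁, hv₂, hentry⟩
      have hinsert : arcsBefore G i ∪ (insert v P).image (Prod.mk i) =
          insert (i, v) (arcsBefore G i ∪ P.image (Prod.mk i)) := by
        rw [Finset.image_insert, Finset.union_insert]
      rw [hinsert]
      refine step _ i v s₂ ?_ hadj ?_ hf' hs₂ hI₂
      · refine Finset.union_subset (Finset.filter_subset _ _) fun a ha => ?_
        obtain ⟨x, hx, rfl⟩ := Finset.mem_image.1 ha
        simpa using hP hx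
      · simpa [arcsBefore] using hv
    · intro t s₂ ht _ hI₂
      rw [arcsBefore_succ]
      exact ⟨by simpa using ht, inv _ _ _ (State.eqOff_setW (by simp)) hI₂⟩
  · intro t s' ht hf hI
    refine post t s' ?_ hf (hs.frame hf hframe) (arcsBefore_card (G := G) ▸ hI)
    rw [← Fin.sum_univ_eq_sum_range (fun i => (if hi : i < n then _ else 0) + 7)] at ht
    simpa [add_assoc] using ht

end EachArc

/-! ## Edge sets as matrices -/

local notation "wZ" => 9
local notation "wPosZ" => 7
local notation "wEndZ" => 8
local notation "aFlag" => 8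
local notation "aAdj" => 14
local notation "aMark" => 16
local notation "aWeak" => 17

/-- The index of the pair `(x, y)` in a matrix. -/
def pairIndex (x y : ℕ) : WExp :=
  .var x *ₑ .var wN +ₑ .var y

@[simp] theorem pairIndex_eval (x y : ℕ) (s : State) :
    (pairIndex x y).eval s = s.w x * s.w wN + s.w y := rfl

@[simp] theorem pairIndex_cost (x y : ℕ) : (pairIndex x y).cost = 5 := rfl

section Matrix

variable {n : ℕ}

theorem mul_add_inj {u v u' v' : Fin n} :
    (u : ℕ) * n + v = u' * n + v' ↔ u = u' ∧ v = v' := by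
  refine ⟨fun h => ?_, by rintro ⟨rfl, rfl⟩; rfl⟩
  have hpair : finProdFinEquiv (u, v) = finProdFinEquiv (u', v') :=
    Fin.ext (by simpa [add_comm, mul_comm] using h)
  simpa using finProdFinEquiv.injective hpair

/-- `f` is the symmetric matrix of the set `S` of edges. -/
def IsEdgeMatrix (S : Set (Sym2 (Fin n))) (f : ℕ → ℕ) : Prop :=
  ∀ u v : Fin n, f (u * n + v) = S.indicator (fun _ => 1) s(u, v)

theorem IsEdgeMatrix.eq_one_iff {S : Set (Sym2 (Fin n))} {f : ℕ → ℕ} (h : IsEdgeMatrix S f)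
    {u v : Fin n} : f (u * n + v) = 1 ↔ s(u, v) ∈ S := by
  simp [h u v]

theorem IsEdgeMatrix.eq_zero_iff {S : Set (Sym2 (Fin n))} {f : ℕ → ℕ} (h : IsEdgeMatrix S f)
    {u v : Fin n} : f (u * n + v) = 0 ↔ s(u, v) ∉ S := by
  simp [h u v]

theorem IsEdgeMatrix.update {S : Set (Sym2 (Fin n))} {f : ℕ → ℕ} (h : IsEdgeMatrix S f)
    (x y : Fin n) : IsEdgeMatrix (insert s(x, y) S)
      (Function.update (Function.update f (x * n + y) 1) (y * n + x) 1) := by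
  classical
  intro u v
  simp only [Function.update_apply, mul_add_inj, h u v, Set.indicator_apply, Set.mem_insert_iff,
    Sym2.eq_iff]
  by_cases hyx : u = y ∧ v = x
  · simp [hyx]
  · by_cases hxy : u = x ∧ v = y
    · simp [hxy]
    · simp [hyx, hxy]

/-- The matrix `f` agrees with that of `S` at the pairs in `D` and at the pairs of vertices that are
not adjacent in `G`. -/
def AgreesOn (G : SimpleGraph (Fin n)) (S : Set (Sym2 (Fin n))) (D : Finset (Fin n × Fin n))
    (f : ℕ → ℕ) : Prop :=
  ∀ u v : Fin n, (u, v) ∈ D ∨ ¬ G.Adj u v → f (u * n + v) = S.indicator (fun _ => 1) s(u, v)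

variable {G : SimpleGraph (Fin n)} {S : Set (Sym2 (Fin n))} {f : ℕ → ℕ}

theorem agreesOn_empty (hS : S ⊆ G.edgeSet) (hf : ∀ u v : Fin n, ¬ G.Adj u v → f (u * n + v) = 0) :
    AgreesOn G S ∅ f := by
  intro u v huv
  replace huv : ¬ G.Adj u v := by simpa using huv
  rw [hf u v huv, Set.indicator_of_notMem fun h => huv (hS h)]

open Classical in
theorem AgreesOn.insert {D : Finset (Fin n × Fin n)} (h : AgreesOn G S D f) {u v : Fin n}
    {c : ℕ} (hc : c = S.indicator (fun _ => 1) s(u, v)) :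
    AgreesOn G S (insert (u, v) D) (Function.update f (u * n + v) c) := by
  intro a b hab
  by_cases hne : a = u ∧ b = v
  · obtain ⟨rfl, rfl⟩ := hne
    rw [Function.update_self, hc]
  · rw [Function.update_of_ne (mt mul_add_inj.1 hne)]
    exact h a b (by simpa [hne] using hab)

theorem AgreesOn.isEdgeMatrix (h : AgreesOn G S (arcs G) f) : IsEdgeMatrix S f := fun u v =>
  h u v (by simpa using em (G.Adj u v))

@[simp] theorem sub_adj {U : Finset (Fin n)} {u v : Fin n} :
    (sub G U).Adj u v ↔ G.Adj u v ∧ u ∈ U ∧ v ∈ U := by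
  simp [sub]

theorem sub_le {U : Finset (Fin n)} : sub G U ≤ G := fun _ _ h => (sub_adj.1 h).1

theorem sub_univ : sub G Finset.univ = G := by
  ext
  simp

/-- Characteristic function of a set of vertices. -/
def IsFlags (U : Finset (Fin n)) (f : ℕ → ℕ) : Prop :=
  ∀ v : Fin n, f v = if v ∈ U then 1 else 0

theorem IsFlags.mul_eq_indicator {U : Finset (Fin n)} (hf : IsFlags U f) {u v : Fin n}
    (h : G.Adj u v) : f u * f v = (sub G U).edgeSet.indicator (fun _ => 1) s(u, v) := by
  classical
  simp only [hf u, hf v, Set.indicator_apply, SimpleGraph.mem_edgeSet, sub_adj, h, true_and]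
  split_ifs <;> simp_all

/-- The three edge matrices vanish at pairs of vertices that are not adjacent. -/
def VanishOutside (G : SimpleGraph (Fin n)) (s : State) : Prop :=
  ∀ A ∈ [aAdj, aMark, aWeak], ∀ u v : Fin n, ¬ G.Adj u v → s.a A (u * n + v) = 0

/-- Writes the adjacency matrix of the subgraph induced by the flags and clears the other edge
matrices. -/
def loadGraph : Cmd := eachArc
  (.store aAdj (pairIndex wU wV) (.arr aFlag (.var wU) *ₑ .arr aFlag (.var wV)) ;;
    .store aMark (pairIndex wU wV) (.const 0) ;; .store aWeak (pairIndex wU wV) (.const 0))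

theorem wp_loadGraph {off nb : ℕ → ℕ} (hG : IsInput G off nb) {W : ℕ} {lam : ℝ} {s : State}
    (hW : 1 < W) (hs : HoldsInput off nb n lam W s) {U : Finset (Fin n)}
    (hU : IsFlags U (s.a aFlag)) (h : VanishOutside G s) :
    WP W loadGraph s fun t s' => t ≤ ∑ u, (∑ _v ∈ nbrs G u, 40 + 18) + 5 ∧
      IsEdgeMatrix (sub G U).edgeSet (s'.a aAdj) ∧ IsEdgeMatrix (n := n) ∅ (s'.a aMark) ∧
      IsEdgeMatrix (n := n) ∅ (s'.a aWeak) := by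
  classical
  refine wp_eachArc hG (fun D s => AgreesOn G (sub G U).edgeSet D (s.a aAdj) ∧
      AgreesOn G ∅ D (s.a aMark) ∧ AgreesOn G ∅ D (s.a aWeak)) (fun _ _ => 30)
    (by decide) (by decide) hs (fun D s₁ s₂ heq => heq.a ▸ id) ?_ ?_ ?_
  · exact ⟨agreesOn_empty (SimpleGraph.edgeSet_mono sub_le) (h _ (by simp)),
      agreesOn_empty (Set.empty_subset _) (h _ (by simp)),
      agreesOn_empty (Set.empty_subset _) (h _ (by simp))⟩
  · intro D u v s₁ _ hadj _ hf hs₁ ⟨hAdj, hMark, hWeak⟩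
    have hflags : IsFlags U (s₁.a aFlag) := hf.a aFlag rfl ▸ hU
    have hprod := hflags.mul_eq_indicator hadj
    have hle : s₁.a aFlag u * s₁.a aFlag v ≤ 1 := by
      rw [hprod]
      exact Set.indicator_le_self' (fun _ _ => zero_le_one) _
    have hres := And.intro (hAdj.insert hprod)
      (And.intro (hMark.insert (u := u) (v := v) (c := 0) (by simp))
        (hWeak.insert (u := u) (v := v) (c := 0) (by simp)))
    simpa [hs₁.u_eq, hs₁.v_eq, hs₁.n_eq, hle.trans_lt hW, hs₁.bdd.pos] using hres
  · rintro t s' ht _ _ ⟨hAdj, hMark, hWeak⟩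
    exact ⟨ht, hAdj.isEdgeMatrix, hMark.isEdgeMatrix, hWeak.isEdgeMatrix⟩

end Matrix

/-! ## Wedges and a maximal matching -/

section Matching

variable {V : Type*}

theorem maximal_isMatching_of_forall {Z : SimpleGraph V} {M : Z.Subgraph} (hM : M.IsMatching)
    (h : ∀ e f, Z.Adj e f → e ∈ M.verts ∨ f ∈ M.verts) :
    Maximal (fun M' : Z.Subgraph => M'.IsMatching) M := by
  refine ⟨hM, fun M' hM' hle => ?_⟩
  have hadj_of_mem : ∀ e f, M'.Adj e f → e ∈ M.verts → M.Adj e f := by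
    intro e f hef he
    obtain ⟨g, hg, _⟩ := hM he
    rwa [(hM' (M'.edge_vert hef)).unique hef (hle.2 hg)]
  have hadj : ∀ e f, M'.Adj e f → M.Adj e f := by
    intro e f hef
    rcases h e f (M'.adj_sub hef) with he | hf
    · exact hadj_of_mem e f hef he
    · exact (hadj_of_mem f e hef.symm hf).symm
  refine ⟨fun e he => ?_, fun e f => hadj e f⟩
  obtain ⟨f, hf, _⟩ := hM' he
  exact M.edge_vert (hadj e f hf)

theorem exists_isMatching_insert {Z : SimpleGraph V} {M : Z.Subgraph} (hM : M.IsMatching)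
    {e f : V} (h : Z.Adj e f) (he : e ∉ M.verts) (hf : f ∉ M.verts) :
    ∃ M' : Z.Subgraph, M'.IsMatching ∧ M'.verts = insert f (insert e M.verts) := by
  have hef := SimpleGraph.Subgraph.IsMatching.subgraphOfAdj h
  refine ⟨M ⊔ Z.subgraphOfAdj h, hM.sup hef ?_, ?_⟩
  · rw [hM.support_eq_verts, hef.support_eq_verts]
    simp [he, hf]
  · ext g
    simp only [SimpleGraph.Subgraph.verts_sup, SimpleGraph.subgraphOfAdj_verts, Set.mem_union,
      Set.mem_insert_iff, Set.mem_singleton_iff]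
    tauto

variable {F : SimpleGraph V} {x y z : V}

theorem IsWedge.left_mem (h : IsWedge F x y z) : s(x, y) ∈ wedgeVerts F :=
  ⟨x, y, z, h, .inl rfl⟩

theorem IsWedge.right_mem (h : IsWedge F x y z) : s(y, z) ∈ wedgeVerts F :=
  ⟨x, y, z, h, .inr rfl⟩

theorem wedgeVerts_eq : wedgeVerts F = {e | ∃ x y z, IsWedge F x y z ∧ e = s(x, y)} := by
  ext e
  refine ⟨?_, fun ⟨x, y, z, h, he⟩ => ⟨x, y, z, h, .inl he⟩⟩
  rintro ⟨x, y, z, h, he | he⟩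
  exacts [⟨x, y, z, h, he⟩, ⟨z, y, x, h.symm, he.trans Sym2.eq_swap⟩]

theorem wedgeVerts_subset : wedgeVerts F ⊆ F.edgeSet := by
  rw [wedgeVerts_eq]
  rintro e ⟨x, y, z, h, rfl⟩
  exact h.1

end Matching

section Scan

variable {n : ℕ} {F G : SimpleGraph (Fin n)}

/-- The first edges of the wedges among the triples in `D`. -/
def firstEdges (F : SimpleGraph (Fin n)) (D : Set (Fin n × Fin n × Fin n)) : Set (Sym2 (Fin n)) :=
  {e | ∃ x y z, (x, y, z) ∈ D ∧ IsWedge F x y z ∧ e = s(x, y)}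

theorem firstEdges_insert {D : Set (Fin n × Fin n × Fin n)} {x y z : Fin n}
    (hw : IsWedge F x y z) :
    firstEdges F (insert (x, y, z) D) = insert s(x, y) (firstEdges F D) := by
  ext e
  simp only [firstEdges, Set.mem_insert_iff, Prod.mk.injEq, Set.mem_ofPred_eq]
  constructor
  · rintro ⟨x', y', z', ⟨rfl, rfl, rfl⟩ | hd, hw', rfl⟩
    exacts [.inl rfl, .inr ⟨x', y', z', hd, hw', rfl⟩]
  · rintro (rfl | ⟨x', y', z', hd, hw', rfl⟩)
    exacts [⟨x, y, z, .inl ⟨rfl, rfl, rfl⟩, hw, rfl⟩, ⟨x', y', z', .inr hd, hw', rfl⟩]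

theorem firstEdges_congr {D D' : Set (Fin n × Fin n × Fin n)}
    (h : ∀ x y z, IsWedge F x y z → ((x, y, z) ∈ D ↔ (x, y, z) ∈ D')) :
    firstEdges F D = firstEdges F D' := by
  ext e
  exact exists_congr fun x => exists_congr fun y => exists_congr fun z =>
    and_congr_left fun hw => h x y z hw.1

theorem firstEdges_univ : firstEdges F Set.univ = wedgeVerts F := by
  simp [firstEdges, wedgeVerts_eq]

/-- The state of the matrices of marks and of weak edges when the triples in `D` have been looked
at: the first edge of each wedge is marked, and the weak edges are the endpoints of a matching of
the wedge graph that covers each wedge. -/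
structure IsScanned (F : SimpleGraph (Fin n)) (D : Set (Fin n × Fin n × Fin n))
    (mark weak : ℕ → ℕ) : Prop where
  mark : IsEdgeMatrix (firstEdges F D) mark
  matching : ∃ M : (wedgeGraph F).Subgraph, M.IsMatching ∧
    IsEdgeMatrix (Subtype.val '' M.verts) weak ∧
    ∀ x y z, (x, y, z) ∈ D → IsWedge F x y z →
      s(x, y) ∈ Subtype.val '' M.verts ∨ s(y, z) ∈ Subtype.val '' M.verts

variable {D : Set (Fin n × Fin n × Fin n)} {x y z : Fin n} {mark weak : ℕ → ℕ}

theorem isScanned_empty (hmark : IsEdgeMatrix (n := n) ∅ mark)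
    (hweak : IsEdgeMatrix (n := n) ∅ weak) : IsScanned F ∅ mark weak where
  mark := by simpa [firstEdges] using hmark
  matching := by
    refine ⟨⊥, fun v hv => by simp at hv, by simpa using hweak, by simp⟩

theorem IsScanned.congr {D' : Set (Fin n × Fin n × Fin n)} (h : IsScanned F D mark weak)
    (hD : ∀ x y z, IsWedge F x y z → ((x, y, z) ∈ D ↔ (x, y, z) ∈ D')) :
    IsScanned F D' mark weak := by
  obtain ⟨hmark, M, hM, hweak, hcover⟩ := h
  exact ⟨firstEdges_congr hD ▸ hmark, M, hM, hweak,
    fun x y z hd hw => hcover x y z ((hD x y z hw).2 hd) hw⟩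

theorem IsScanned.insert_of_covered (h : IsScanned F D mark weak) (hw : IsWedge F x y z)
    (hcov : ¬ (weak (x * n + y) = 0 ∧ weak (y * n + z) = 0)) :
    IsScanned F (insert (x, y, z) D)
      (Function.update (Function.update mark (x * n + y) 1) (y * n + x) 1) weak := by
  obtain ⟨hmark, M, hM, hweak, hcover⟩ := h
  refine ⟨firstEdges_insert hw ▸ hmark.update x y, M, hM, hweak, ?_⟩
  rintro x' y' z' (heq | hd) hw'
  · obtain ⟨rfl, rfl, rfl⟩ : x' = x ∧ y' = y ∧ z' = z := by simpa using heq
    rw [hweak.eq_zero_iff, hweak.eq_zero_iff] at hcov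
    tauto
  · exact hcover x' y' z' hd hw'

theorem IsScanned.insert_of_not_covered (h : IsScanned F D mark weak) (hw : IsWedge F x y z)
    (hxy : weak (x * n + y) = 0) (hyz : weak (y * n + z) = 0) :
    IsScanned F (insert (x, y, z) D)
      (Function.update (Function.update mark (x * n + y) 1) (y * n + x) 1)
      (Function.update (Function.update (Function.update (Function.update weak (x * n + y) 1)
        (y * n + x) 1) (y * n + z) 1) (z * n + y) 1) := by
  obtain ⟨hmark, M, hM, hweak, hcover⟩ := h
  have hadj : (wedgeGraph F).Adj ⟨s(x, y), hw.left_mem⟩ ⟨s(y, z), hw.right_mem⟩ :=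
    ⟨x, y, z, hw, rfl, rfl⟩
  obtain ⟨M', hM', hverts⟩ := exists_isMatching_insert hM hadj
    (fun hm => hweak.eq_zero_iff.1 hxy ⟨_, hm, rfl⟩)
    (fun hm => hweak.eq_zero_iff.1 hyz ⟨_, hm, rfl⟩)
  have himage : (Subtype.val '' M'.verts : Set (Sym2 (Fin n))) =
      insert s(y, z) (insert s(x, y) (Subtype.val '' M.verts)) := by
    rw [hverts, Set.image_insert_eq, Set.image_insert_eq]
  refine ⟨firstEdges_insert hw ▸ hmark.update x y, M', hM',
    himage ▸ (hweak.update x y).update y z, ?_⟩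
  rw [himage]
  rintro x' y' z' (heq | hd) hw'
  · obtain ⟨rfl, rfl, rfl⟩ : x' = x ∧ y' = y ∧ z' = z := by simpa using heq
    exact .inl (.inr (.inl rfl))
  · exact (hcover x' y' z' hd hw').imp (fun h => .inr (.inr h)) fun h => .inr (.inr h)

theorem IsScanned.isAprMinSTC (h : IsScanned F Set.univ mark weak) :
    IsEdgeMatrix (wedgeVerts F) mark ∧ ∃ S, IsAprMinSTC F S ∧ IsEdgeMatrix S weak := by
  obtain ⟨hmark, M, hM, hweak, hcover⟩ := h
  refine ⟨firstEdges_univ ▸ hmark, _, ⟨M, maximal_isMatching_of_forall hM ?_, rfl⟩, hweak⟩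
  rintro e f ⟨x, y, z, hw, he, hf⟩
  simpa [← he, ← hf] using hcover x y z trivial hw

/-- The test whether `(v, u, z)` is a wedge, given that `vu` and `uz` are edges of `G`. -/
def wedgeTest : Test :=
  .and (.not (.eq (.var wV) (.var wZ))) (.and (.eq (.arr aAdj (pairIndex wV wU)) (.const 1))
    (.and (.eq (.arr aAdj (pairIndex wU wZ)) (.const 1))
      (.eq (.arr aAdj (pairIndex wV wZ)) (.const 0))))

/-- Marks the edge `vu` of the wedge `(v, u, z)` and adds the wedge to the matching when both of its
edges are free. -/
def recordWedge : Cmd :=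
  .store aMark (pairIndex wV wU) (.const 1) ;; .store aMark (pairIndex wU wV) (.const 1) ;;
  .cond (.and (.eq (.arr aWeak (pairIndex wV wU)) (.const 0))
      (.eq (.arr aWeak (pairIndex wU wZ)) (.const 0)))
    (.store aWeak (pairIndex wV wU) (.const 1) ;; .store aWeak (pairIndex wU wV) (.const 1) ;;
      .store aWeak (pairIndex wU wZ) (.const 1) ;; .store aWeak (pairIndex wZ wU) (.const 1))
    .skip

/-- Marks the edges that lie in wedges, and finds a maximal matching of the wedge graph. -/
def scanWedges : Cmd :=
  eachArc (eachNb wU wPosZ wEndZ wZ (.cond wedgeTest recordWedge .skip))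

variable {W : ℕ} {s : State}

theorem wedgeTest_holds (hn : s.w wN = n) (hy : s.w wU = y) (hx : s.w wV = x) (hz : s.w wZ = z)
    (hadj : IsEdgeMatrix F.edgeSet (s.a aAdj)) : wedgeTest.holds s ↔ IsWedge F x y z := by
  simp only [wedgeTest, Test.holds, WExp.eval, pairIndex_eval, hn, hy, hx, hz, hadj.eq_one_iff,
    hadj.eq_zero_iff, SimpleGraph.mem_edgeSet, Fin.val_inj, IsWedge]
  tauto

theorem wp_recordWedge (hW : 1 < W) (hn : s.w wN = n) (hy : s.w wU = y) (hx : s.w wV = x)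
    (hz : s.w wZ = z) (hw : IsWedge F x y z) (h : IsScanned F D (s.a aMark) (s.a aWeak)) :
    WP W recordWedge s fun t s' => t ≤ 80 ∧
      IsScanned F (insert (x, y, z) D) (s'.a aMark) (s'.a aWeak) := by
  simp only [recordWedge, wp_seq, wp_store, wp_cond, wp_skip, WExp.eval, WExp.cost, pairIndex_eval,
    pairIndex_cost, hn, hx, hy, hz, hW, true_and, State.setA_w, Test.cost, Test.holds]
  refine ⟨fun hfree => ⟨by omega, ?_⟩, fun hcov => ⟨by omega, ?_⟩⟩
  · simpa using h.insert_of_not_covered hw (by simpa using hfree.1) (by simpa using hfree.2)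
  · simpa using h.insert_of_covered hw (by simpa using hcov)

theorem wp_scanWedges (hF : F ≤ G) {off nb : ℕ → ℕ} (hG : IsInput G off nb) {lam : ℝ} (hW : 1 < W)
    (hs : HoldsInput off nb n lam W s) (hadj : IsEdgeMatrix F.edgeSet (s.a aAdj))
    (hmark : IsEdgeMatrix (n := n) ∅ (s.a aMark)) (hweak : IsEdgeMatrix (n := n) ∅ (s.a aWeak)) :
    WP W scanWedges s fun t s' =>
      t ≤ ∑ u, (∑ _v ∈ nbrs G u, (∑ _z ∈ nbrs G u, 130 + 21) + 18) + 5 ∧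
      IsEdgeMatrix (wedgeVerts F) (s'.a aMark) ∧
      ∃ weak, IsAprMinSTC F weak ∧ IsEdgeMatrix weak (s'.a aWeak) := by
  classical
  refine wp_eachArc hG
    (fun A s => IsScanned F {d | (d.2.1, d.1) ∈ A} (s.a aMark) (s.a aWeak))
    (fun u _ => ∑ _z ∈ nbrs G u, 130 + 11) (by decide) (by decide) hs
    (fun D s₁ s₂ heq => heq.a ▸ id) (by simpa using isScanned_empty hmark hweak) ?_ ?_
  · intro A y x s₁ _ _ _ hf hs₁ hI
    refine wp_eachNb hG y (fun P s => IsScanned F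
      {d | (d.2.1, d.1) ∈ A ∨ d.1 = x ∧ d.2.1 = y ∧ d.2.2 ∈ P} (s.a aMark) (s.a aWeak))
      (fun _ => 120) (by decide) (by decide) hs₁.bdd hs₁.off_eq hs₁.nb_eq hs₁.u_eq
      (fun P s₂ s₃ heq => heq.a ▸ id) (by simpa using hI) ?_ ?_
    · intro P z s₂ _ _ _ hf₂ hz _ hI₂
      have hn₂ : s₂.w wN = n := (hf₂.w wN rfl).trans hs₁.n_eq
      have hy₂ : s₂.w wU = y := (hf₂.w wU rfl).trans hs₁.u_eq
      have hx₂ : s₂.w wV = x := (hf₂.w wV rfl).trans hs₁.v_eq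
      have hadj₂ : IsEdgeMatrix F.edgeSet (s₂.a aAdj) := by
        rwa [hf₂.a aAdj rfl, hf.a aAdj rfl]
      have hD : {d : Fin n × Fin n × Fin n |
            (d.2.1, d.1) ∈ A ∨ d.1 = x ∧ d.2.1 = y ∧ d.2.2 ∈ insert z P} =
          insert (x, y, z) {d | (d.2.1, d.1) ∈ A ∨ d.1 = x ∧ d.2.1 = y ∧ d.2.2 ∈ P} := by
        ext ⟨x', y', z'⟩
        simp only [Finset.mem_insert, Set.mem_ofPred_eq, Set.mem_insert_iff, Prod.mk.injEq]
        tauto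
      rw [hD, wp_cond, wedgeTest_holds hn₂ hy₂ hx₂ hz hadj₂]
      refine ⟨fun hw => (wp_recordWedge hW hn₂ hy₂ hx₂ hz hw hI₂).mono fun t s₃ ⟨ht, hI₃⟩ =>
        ⟨(Nat.add_le_add_left ht wedgeTest.cost).trans (by decide), hI₃⟩, fun hw => ?_⟩
      refine wp_skip.2 ⟨by decide, hI₂.congr fun x' y' z' hw' => ?_⟩
      rw [Set.mem_insert_iff, or_iff_right]
      rintro ⟨⟩
      exact hw hw'
    · intro t s₂ ht _ hI₂
      refine ⟨ht, hI₂.congr fun x' y' z' hw => ?_⟩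
      have hz : y' = y → G.Adj y z' := fun h => h ▸ hF hw.2.1
      simp only [mem_nbrs, Finset.mem_insert, Set.mem_ofPred_eq, Prod.mk.injEq]
      tauto
  · intro t s' ht _ _ hI
    refine ⟨by simpa only [add_assoc] using ht, (hI.congr fun x y z hw => ?_).isAprMinSTC⟩
    simpa using hF hw.1.symm

end Scan

/-! ## The wedge graph in memory -/

local notation "wNodes" => 2
local notation "aX" => 9
local notation "aY" => 10
local notation "aId" => 15

section Number

variable {n N i : ℕ} {F G : SimpleGraph (Fin n)} {D : Finset (Fin n × Fin n)} {X Y id : ℕ → ℕ}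
  {u v u' v' : Fin n}

/-- Node `i` of the wedge graph is the edge `uv`: the arrays `X` and `Y` hold the endpoints of the
nodes, and the matrix `id` holds the number of the node at both pairs of its endpoints. -/
structure IsNode (X Y id : ℕ → ℕ) (i : ℕ) (u v : Fin n) : Prop where
  left : X i = u
  right : Y i = v
  id_eq : id (u * n + v) = i
  id_swap_eq : id (v * n + u) = i

theorem IsNode.index_eq (h : IsNode X Y id i u v) (he : s(u, v) = s(u', v')) :
    id (u' * n + v') = i := by
  rcases Sym2.eq_iff.1 he with ⟨rfl, rfl⟩ | ⟨rfl, rfl⟩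
  exacts [h.id_eq, h.id_swap_eq]

theorem isNode_update : IsNode (Function.update X N u) (Function.update Y N v)
    (Function.update (Function.update id (u * n + v) N) (v * n + u) N) N u v := by
  constructor <;> simp [Function.update_apply]

theorem IsNode.update (h : IsNode X Y id i u' v') (hi : i ≠ N) (hne : s(u', v') ≠ s(u, v)) :
    IsNode (Function.update X N u) (Function.update Y N v)
      (Function.update (Function.update id (u * n + v) N) (v * n + u) N) i u' v' := by
  rw [Ne, Sym2.eq_iff, not_or] at hne
  obtain ⟨hne, hne_swap⟩ := hne
  have hne' : ¬ (v' = v ∧ u' = u) := fun h => hne h.symm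
  have hne_swap' : ¬ (v' = u ∧ u' = v) := fun h => hne_swap h.symm
  constructor <;> simp only [Function.update_apply, mul_add_inj, hi, hne, hne_swap, hne',
    hne_swap', if_false, h.left, h.right, h.id_eq, h.id_swap_eq]

/-- The arcs of `D` that are the nodes of the wedge graph, oriented upwards. -/
def upwardNodes (F : SimpleGraph (Fin n)) (D : Finset (Fin n × Fin n)) : Set (Fin n × Fin n) :=
  {a | a ∈ D ∧ a.1 < a.2 ∧ s(a.1, a.2) ∈ wedgeVerts F}

theorem upwardNodes_insert (huv : u < v ∧ s(u, v) ∈ wedgeVerts F) :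
    upwardNodes F (insert (u, v) D) = insert (u, v) (upwardNodes F D) := by
  ext a
  simp only [upwardNodes, Finset.mem_insert, Set.mem_ofPred_eq, Set.mem_insert_iff]
  refine ⟨by tauto, ?_⟩
  rintro (rfl | ha)
  exacts [⟨.inl rfl, huv⟩, ⟨.inr ha.1, ha.2⟩]

theorem upwardNodes_insert_of_not (huv : ¬ (u < v ∧ s(u, v) ∈ wedgeVerts F)) :
    upwardNodes F (insert (u, v) D) = upwardNodes F D := by
  ext a
  simp only [upwardNodes, Finset.mem_insert, Set.mem_ofPred_eq]
  refine ⟨?_, by tauto⟩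
  rintro ⟨rfl | ha, ha'⟩
  exacts [absurd ha' huv, ⟨ha, ha'⟩]

/-- The numbers below `N` are those of the upward nodes in `D`. -/
structure IsPartialNumbering (F : SimpleGraph (Fin n)) (D : Finset (Fin n × Fin n)) (N : ℕ)
    (X Y id : ℕ → ℕ) : Prop where
  sound : ∀ i < N, ∃ a ∈ upwardNodes F D, IsNode X Y id i a.1 a.2
  complete : ∀ a ∈ upwardNodes F D, ∃ i < N, IsNode X Y id i a.1 a.2

theorem isPartialNumbering_empty : IsPartialNumbering F ∅ 0 X Y id :=
  ⟨fun _ hi => absurd hi (Nat.not_lt_zero _), fun _ ha => absurd ha.1 (Finset.notMem_empty _)⟩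

theorem IsPartialNumbering.le (h : IsPartialNumbering F D N X Y id) : N ≤ n * n := by
  choose a _ ha using fun i : Fin N => h.sound i i.2
  have hinj : Function.Injective a := fun i j hij =>
    Fin.ext ((ha i).id_eq.symm.trans (hij ▸ (ha j).id_eq))
  simpa using Fintype.card_le_of_injective a hinj

theorem IsPartialNumbering.insert_of_not (h : IsPartialNumbering F D N X Y id)
    (huv : ¬ (u < v ∧ s(u, v) ∈ wedgeVerts F)) :
    IsPartialNumbering F (insert (u, v) D) N X Y id := by
  constructor <;> rw [upwardNodes_insert_of_not huv]
  exacts [h.sound, h.complete]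

theorem IsPartialNumbering.insert (h : IsPartialNumbering F D N X Y id) (hD : (u, v) ∉ D)
    (huv : u < v ∧ s(u, v) ∈ wedgeVerts F) :
    IsPartialNumbering F (insert (u, v) D) (N + 1) (Function.update X N u) (Function.update Y N v)
      (Function.update (Function.update id (u * n + v) N) (v * n + u) N) := by
  have hne : ∀ a ∈ upwardNodes F D, s(a.1, a.2) ≠ s(u, v) := by
    rintro a ⟨ha, hlt, -⟩ heq
    rcases Sym2.eq_iff.1 heq with ⟨h₁, h₂⟩ | ⟨h₁, h₂⟩
    · exact hD (h₁ ▸ h₂ ▸ ha)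
    · exact (h₁ ▸ h₂ ▸ hlt : v < u).not_gt huv.1
  constructor <;> rw [upwardNodes_insert huv]
  · intro i hi
    rcases (Nat.lt_succ_iff_lt_or_eq.1 hi) with hi | rfl
    · obtain ⟨a, ha, hnode⟩ := h.sound i hi
      exact ⟨a, .inr ha, hnode.update hi.ne (hne a ha)⟩
    · exact ⟨_, .inl rfl, isNode_update⟩
  · rintro a (rfl | ha)
    · exact ⟨N, N.lt_succ_self, isNode_update⟩
    · obtain ⟨i, hi, hnode⟩ := h.complete a ha
      exact ⟨i, hi.trans N.lt_succ_self, hnode.update hi.ne (hne a ha)⟩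

/-- The arrays `X`, `Y` and the matrix `id` represent the numbering `name` of the wedge graph. -/
def IsNumbering (name : Fin N ≃ wedgeVerts F) (X Y id : ℕ → ℕ) : Prop :=
  ∀ i : Fin N, ∃ u v : Fin n, IsNode X Y id i u v ∧ (name i).1 = s(u, v)

theorem IsNumbering.id_eq {name : Fin N ≃ wedgeVerts F} (h : IsNumbering name X Y id)
    (huv : s(u, v) ∈ wedgeVerts F) : id (u * n + v) = name.symm ⟨s(u, v), huv⟩ := by
  obtain ⟨u', v', hnode, hname⟩ := h (name.symm ⟨s(u, v), huv⟩)
  exact hnode.index_eq (by rw [← hname, Equiv.apply_symm_apply])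

theorem IsPartialNumbering.exists_isNumbering (h : IsPartialNumbering F D N X Y id)
    (hD : ∀ u v, F.Adj u v → (u, v) ∈ D) : ∃ name : Fin N ≃ wedgeVerts F,
      IsNumbering name X Y id := by
  choose a ha hnode using fun i : Fin N => h.sound i i.2
  have hbij : Function.Bijective
      fun i : Fin N => (⟨s((a i).1, (a i).2), (ha i).2.2⟩ : wedgeVerts F) := by
    refine ⟨fun i j hij => ?_, ?_⟩
    · exact Fin.ext (((hnode i).index_eq (congrArg Subtype.val hij)).symm.trans (hnode j).id_eq)
    · have hupward : ∀ u v : Fin n, u < v → s(u, v) ∈ wedgeVerts F →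
          ∃ i : Fin N, s((a i).1, (a i).2) = s(u, v) := by
        intro u v hlt hmem
        obtain ⟨i, hi, huv⟩ := h.complete (u, v) ⟨hD u v (wedgeVerts_subset hmem), hlt, hmem⟩
        have hi' := hnode ⟨i, hi⟩
        refine ⟨⟨i, hi⟩, ?_⟩
        rw [Fin.ext (hi'.left.symm.trans huv.left), Fin.ext (hi'.right.symm.trans huv.right)]
      rintro ⟨e, he⟩
      simp only [Subtype.mk.injEq]
      induction e with
      | _ u v =>
        rcases lt_or_gt_of_ne (wedgeVerts_subset he : F.Adj u v).ne with hlt | hgt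
        · exact hupward u v hlt he
        · rw [Sym2.eq_swap] at he ⊢
          exact hupward v u hgt he
  exact ⟨.ofBijective _ hbij, fun i => ⟨(a i).1, (a i).2, hnode i, rfl⟩⟩

/-- Numbers the nodes of the wedge graph. -/
def numberNodes : Cmd :=
  .set wNodes (.const 0) ;; eachArc
    (.cond (.and (.lt (.var wU) (.var wV)) (.eq (.arr aMark (pairIndex wU wV)) (.const 1)))
      (.store aX (.var wNodes) (.var wU) ;; .store aY (.var wNodes) (.var wV) ;;
        .store aId (pairIndex wU wV) (.var wNodes) ;; .store aId (pairIndex wV wU) (.var wNodes) ;;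
        .set wNodes (.var wNodes +ₑ .const 1))
      .skip)

theorem wp_numberNodes (hF : F ≤ G) {off nb : ℕ → ℕ} (hG : IsInput G off nb) {W : ℕ} {lam : ℝ}
    {s : State} (hW : n * n + 1 < W) (hs : HoldsInput off nb n lam W s)
    (hmark : IsEdgeMatrix (wedgeVerts F) (s.a aMark)) :
    WP W numberNodes s fun t s' => t ≤ ∑ u, (∑ _v ∈ nbrs G u, 60 + 18) + 7 ∧
      s'.w wNodes ≤ n * n ∧ ∃ name : Fin (s'.w wNodes) ≃ wedgeVerts F,
        IsNumbering name (s'.a aX) (s'.a aY) (s'.a aId) := by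
  classical
  have hinit : Frame W (.set wNodes (.const 0)) s (s.setW wNodes 0) := frame_set hs.bdd.pos
  refine wp_seq.2 (wp_set.2 ⟨hs.bdd.pos, ?_⟩)
  refine wp_eachArc hG (fun D s =>
      IsPartialNumbering F D (s.w wNodes) (s.a aX) (s.a aY) (s.a aId)) (fun _ _ => 50)
    (by decide) (by decide) (hs.frame hinit (by decide))
    (fun D s₁ s₂ heq h => by rwa [heq.a, heq.w wNodes (by decide)])
    (by simpa using isPartialNumbering_empty) ?_ ?_
  · intro D u v s₁ _ _ hD hf hs₁ hI
    have hmark₁ : IsEdgeMatrix (wedgeVerts F) (s₁.a aMark) := hf.a aMark rfl ▸ hmark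
    have hle := hI.le
    have hn : n ≤ n * n := Nat.le_mul_self n
    simp only [wp_cond, Test.holds, WExp.eval, pairIndex_eval, hs₁.u_eq, hs₁.v_eq, hs₁.n_eq,
      hmark₁.eq_one_iff, Fin.val_fin_lt]
    constructor
    · intro huv
      have hres := hI.insert hD huv
      have hu : (u : ℕ) < W := by omega
      have hv : (v : ℕ) < W := by omega
      have hN : s₁.w wNodes < W := by omega
      have hN' : s₁.w wNodes + 1 < W := by omega
      simpa [hs₁.u_eq, hs₁.v_eq, hs₁.n_eq, hu, hv, hN, hN'] using hres
    · intro huv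
      exact wp_skip.2 ⟨by decide, hI.insert_of_not huv⟩
  · intro t s' ht _ _ hI
    refine ⟨?_, hI.le, hI.exists_isNumbering fun u v huv => by simpa using hF huv⟩
    simp only [WExp.cost, Nat.reduceAdd] at ht ⊢
    omega

end Number

/-! ## The size of the input -/

section Size

variable {n : ℕ} {F G : SimpleGraph (Fin n)}

/-- `∑ (deg u + 1) ^ 2`, the measure of all running times. -/
noncomputable def size (G : SimpleGraph (Fin n)) : ℕ :=
  ∑ u, ((nbrs G u).card + 1) ^ 2

theorem sum_nbrs_card (G : SimpleGraph (Fin n)) :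
    ∑ u, ∑ v ∈ nbrs G u, (nbrs G v).card = ∑ u, (nbrs G u).card ^ 2 := by
  have hswap : ∑ u, ∑ v ∈ nbrs G u, (nbrs G v).card = ∑ v, ∑ _u ∈ nbrs G v, (nbrs G v).card :=
    Finset.sum_comm' fun u v => by simp [G.adj_comm]
  rw [hswap]
  simp [pow_two]

theorem sum_le_size {c : ℕ} {f : Fin n → ℕ} (h : ∀ u, f u ≤ c * ((nbrs G u).card + 1) ^ 2) :
    ∑ u, f u ≤ c * size G := by
  rw [size, Finset.mul_sum]
  exact Finset.sum_le_sum fun u _ => h u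

theorem card_nbrs_lt (u : Fin n) : (nbrs G u).card < n := by
  have hssub : nbrs G u ⊂ Finset.univ :=
    Finset.ssubset_univ_iff.2 fun h => G.irrefl (mem_nbrs.1 (h ▸ Finset.mem_univ u))
  simpa using Finset.card_lt_card hssub

theorem size_le : size G ≤ n ^ 3 := by
  calc size G ≤ ∑ _u : Fin n, n ^ 2 :=
        Finset.sum_le_sum fun u _ => Nat.pow_le_pow_left (card_nbrs_lt u) 2
    _ = n ^ 3 := by
        rw [Finset.sum_const, Finset.card_univ, Fintype.card_fin, smul_eq_mul]
        ring

theorem le_size : n ≤ size G := by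
  have h : ∑ _u : Fin n, 1 ≤ size G :=
    Finset.sum_le_sum fun u _ => Nat.one_le_pow _ _ (Nat.succ_pos _)
  simpa using h

end Size

section Size

variable {n N : ℕ} {F G : SimpleGraph (Fin n)} {name : Fin N ≃ wedgeVerts F} {X Y id : ℕ → ℕ}

theorem sum_arcs {M : Type*} [AddCommMonoid M] (f : Fin n → Fin n → M) :
    ∑ a ∈ arcs G, f a.1 a.2 = ∑ u, ∑ v ∈ nbrs G u, f u v := by
  classical
  simp only [arcs, nbrs, Finset.sum_filter]
  rw [← Finset.univ_product_univ, Finset.sum_product]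

theorem IsNumbering.sum_le (h : IsNumbering name X Y id) (hF : F ≤ G) (g : ℕ → ℕ → ℕ) :
    ∑ i ∈ Finset.range N, g (X i) (Y i) ≤ ∑ u, ∑ v ∈ nbrs G u, g (u : Fin n) v := by
  choose u v hnode hname using h
  have hinj : Function.Injective fun i => (u i, v i) := fun i j hij => by
    rw [Prod.mk.injEq] at hij
    exact name.injective (Subtype.ext (by rw [hname i, hname j, hij.1, hij.2]))
  calc ∑ i ∈ Finset.range N, g (X i) (Y i) = ∑ i, g (u i) (v i) := by
        rw [← Fin.sum_univ_eq_sum_range (fun i => g (X i) (Y i))]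
        exact Finset.sum_congr rfl fun i _ => by rw [(hnode i).left, (hnode i).right]
    _ = ∑ a ∈ Finset.univ.map ⟨_, hinj⟩, g a.1 a.2 := by simp
    _ ≤ ∑ a ∈ arcs G, g a.1 a.2 := by
        refine Finset.sum_le_sum_of_subset fun a ha => ?_
        obtain ⟨i, rfl⟩ : ∃ i, (u i, v i) = a := by simpa using ha
        exact mem_arcs.2 (hF (wedgeVerts_subset (hname i ▸ (name i).2)))
    _ = _ := sum_arcs fun u v => g u v

/-- The degree of the vertex with number `k`. -/
noncomputable def degAt (G : SimpleGraph (Fin n)) (k : ℕ) : ℕ :=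
  if h : k < n then (nbrs G ⟨k, h⟩).card else 0

@[simp] theorem degAt_coe (u : Fin n) : degAt G u = (nbrs G u).card := by
  simp [degAt]

theorem IsNumbering.sum_degAt_le (h : IsNumbering name X Y id) (hF : F ≤ G) :
    ∑ i ∈ Finset.range N, (degAt G (X i) + degAt G (Y i)) ≤ 2 * size G := by
  refine (h.sum_le hF fun x y => degAt G x + degAt G y).trans ?_
  simp only [degAt_coe, Finset.sum_add_distrib, sum_nbrs_card, Finset.sum_const, smul_eq_mul]
  rw [← Finset.sum_add_distrib]
  exact sum_le_size fun u => by nlinarith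

theorem IsNumbering.le_size (h : IsNumbering name X Y id) (hF : F ≤ G) : N ≤ size G := by
  have hle := h.sum_le hF fun _ _ => 1
  simp only [Finset.sum_const, Finset.card_range, smul_eq_mul, mul_one] at hle
  exact hle.trans (Finset.sum_le_sum fun u _ => by nlinarith)

end Size

section Lists

/-- The list in the cells below `e` of `nb` is extended by the elements of `S`, once each; the
result occupies the cells below `e'` of `nb'`. -/
structure IsExtension (nb : ℕ → ℕ) (e : ℕ) (nb' : ℕ → ℕ) (e' : ℕ) (S : Set ℕ) : Prop where
  le : e ≤ e'
  kept : ∀ p < e, nb' p = nb p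
  bijOn : Set.BijOn nb' (Set.Ico e e') S

variable {nb nb' nb'' : ℕ → ℕ} {e e' e'' j : ℕ} {S T : Set ℕ}

theorem IsExtension.refl : IsExtension nb e nb e ∅ :=
  ⟨le_rfl, fun _ _ => rfl, by simp⟩

theorem IsExtension.trans (h : IsExtension nb e nb' e' S) (h' : IsExtension nb' e' nb'' e'' T)
    (hST : Disjoint S T) : IsExtension nb e nb'' e'' (S ∪ T) := by
  have hS : Set.BijOn nb'' (Set.Ico e e') S :=
    h.bijOn.congr fun p hp => (h'.kept p hp.2).symm
  have hdisj : Disjoint (Set.Ico e e') (Set.Ico e' e'') :=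
    Set.disjoint_left.2 fun p hp hp' => hp.2.not_ge hp'.1
  refine ⟨h.le.trans h'.le, fun p hp => (h'.kept p (hp.trans_le h.le)).trans (h.kept p hp), ?_⟩
  rw [← Set.Ico_union_Ico_eq_Ico h.le h'.le]
  refine hS.union h'.bijOn ((Set.injOn_union hdisj).2 ⟨hS.injOn, h'.bijOn.injOn, ?_⟩)
  exact fun p hp q hq heq =>
    Set.disjoint_left.1 hST (hS.mapsTo hp) (heq ▸ h'.bijOn.mapsTo hq)

theorem IsExtension.snoc (h : IsExtension nb e nb' e' S) (hj : j ∉ S) :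
    IsExtension nb e (Function.update nb' e' j) (e' + 1) (insert j S) := by
  have hone : IsExtension nb' e' (Function.update nb' e' j) (e' + 1) {j} := by
    refine ⟨e'.le_succ, fun p hp => Function.update_of_ne hp.ne _ _, ?_⟩
    rw [Set.Ico_add_one_right_eq_Icc, Set.Icc_self, Set.bijOn_singleton, Function.update_self]
  have htrans := h.trans hone (Set.disjoint_singleton_right.2 hj)
  rwa [Set.union_singleton] at htrans

theorem IsExtension.eq_add_ncard (h : IsExtension nb e nb' e' S) : e' = e + S.ncard := by
  rw [← h.bijOn.image_eq, h.bijOn.injOn.ncard_image, ← Finset.coe_Ico,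
    Set.ncard_coe_finset, Nat.card_Ico]
  exact (Nat.add_sub_of_le h.le).symm

variable {V : Type*} {H : SimpleGraph V} {N : ℕ} {name : Fin N ≃ V} {off : ℕ → ℕ}

/-- The numbers of the neighbours of the vertex with number `i`. -/
def nbrIndices (H : SimpleGraph V) (name : Fin N ≃ V) (i : Fin N) : Set ℕ :=
  (fun k : Fin N => (k : ℕ)) '' {k | H.Adj (name i) (name k)}

/-- The arrays hold the adjacency lists of the first `i` vertices, and `e` is the next free
position. -/
structure IsPartialAdjList (H : SimpleGraph V) (name : Fin N ≃ V) (i e : ℕ) (off nb : ℕ → ℕ) :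
    Prop where
  zero : off 0 = 0
  last : off i = e
  mono : MonotoneOn off (Set.Iic i)
  bijOn : ∀ j : Fin N, j < i →
    Set.BijOn nb (Set.Ico (off j) (off (j + 1))) (nbrIndices H name j)

theorem isPartialAdjList_zero (h : off 0 = 0) : IsPartialAdjList H name 0 0 off nb where
  zero := h
  last := h
  mono a ha b hb _ := by rw [Nat.le_zero.1 ha, Nat.le_zero.1 hb]
  bijOn _ hj := absurd hj (Nat.not_lt_zero _)

theorem IsPartialAdjList.succ {i : Fin N} (h : IsPartialAdjList H name i e off nb)
    (hext : IsExtension nb e nb' e' (nbrIndices H name i)) :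
    IsPartialAdjList H name (i + 1) e' (Function.update off (i + 1) e') nb' := by
  have hold : ∀ j ≤ (i : ℕ), Function.update off (i + 1) e' j = off j := fun j hj =>
    Function.update_of_ne (by omega) _ _
  have hle : ∀ j ≤ (i : ℕ), off j ≤ e := fun j hj => h.last ▸ h.mono hj Set.self_mem_Iic hj
  refine ⟨by rw [hold 0 (Nat.zero_le _), h.zero], Function.update_self .., ?_, ?_⟩
  · intro a _ b (hb : b ≤ i + 1) hab
    rcases hb.eq_or_lt with rfl | hb
    · rcases hab.eq_or_lt with rfl | ha
      · exact le_rfl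
      · rw [hold a (by omega), Function.update_self]
        exact (hle a (by omega)).trans hext.le
    · rw [hold a (by omega), hold b (by omega)]
      exact h.mono (show a ≤ i by omega) (show b ≤ i by omega) hab
  · intro j hj
    rcases Nat.lt_succ_iff_lt_or_eq.1 hj with hj | hj
    · rw [hold j hj.le, hold (j + 1) hj]
      exact (h.bijOn j hj).congr fun p hp => (hext.kept p (hp.2.trans_le (hle _ hj))).symm
    · obtain rfl := Fin.ext hj
      rw [hold j le_rfl, Function.update_self, h.last]
      exact hext.bijOn

theorem IsPartialAdjList.isAdjList (h : IsPartialAdjList H name N e off nb) :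
    IsAdjList H name off nb where
  zero := h.zero
  mono i := h.mono i.2.le (show (i : ℕ) + 1 ≤ N from i.2) (Nat.le_succ _)
  sound i p hp hp' := by
    obtain ⟨k, hadj, hk⟩ := (h.bijOn i i.2).mapsTo ⟨hp, hp'⟩
    exact ⟨k, hk.symm, hadj⟩
  complete i j hij := by
    obtain ⟨p, hp, hpj⟩ := (h.bijOn i i.2).surjOn ⟨j, hij, rfl⟩
    exact ⟨p, ⟨hp.1, hp.2, hpj⟩, fun q hq =>
      (h.bijOn i i.2).injOn ⟨hq.1, hq.2.1⟩ hp (hq.2.2.trans hpj.symm)⟩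

end Lists

local notation "wFree" => 10
local notation "wNode" => 11
local notation "wCentre" => 12
local notation "wOuter" => 13
local notation "aOffZ" => 11
local notation "aNbZ" => 12

section WedgeLists

variable {n N : ℕ} {F G : SimpleGraph (Fin n)} {name : Fin N ≃ wedgeVerts F} {X Y id : ℕ → ℕ}
  {o c w : Fin n} {P : Set (Fin n)}

/-- The numbers of the edges `cw` that form a wedge `(o, c, w)` with `w ∈ P`. -/
def wedgeIndices (F : SimpleGraph (Fin n)) (id : ℕ → ℕ) (o c : Fin n) (P : Set (Fin n)) : Set ℕ :=
  (fun w : Fin n => id (c * n + w)) '' {w ∈ P | IsWedge F o c w}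

theorem wedgeIndices_empty : wedgeIndices F id o c ∅ = ∅ := by
  simp [wedgeIndices]

theorem wedgeIndices_insert (hw : IsWedge F o c w) :
    wedgeIndices F id o c (insert w P) = insert (id (c * n + w)) (wedgeIndices F id o c P) := by
  rw [wedgeIndices, wedgeIndices, ← Set.image_insert_eq (f := fun w : Fin n => id (c * n + w))]
  congr 1
  ext x
  simp only [Set.mem_insert_iff, Set.mem_ofPred_eq, or_and_right]
  exact or_congr_left (and_iff_left_of_imp fun hx => hx ▸ hw)

theorem wedgeIndices_insert_of_not (hw : ¬ IsWedge F o c w) :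
    wedgeIndices F id o c (insert w P) = wedgeIndices F id o c P := by
  rw [wedgeIndices, wedgeIndices]
  congr 1
  ext x
  simp only [Set.mem_insert_iff, Set.mem_ofPred_eq, or_and_right, or_iff_right_iff_imp]
  rintro ⟨rfl, hx⟩
  exact absurd hx hw

theorem wedgeIndices_nbrs (hF : F ≤ G) :
    wedgeIndices F id o c (nbrs G c : Set (Fin n)) = wedgeIndices F id o c Set.univ := by
  rw [wedgeIndices, wedgeIndices]
  congr 1
  ext w
  simp only [Finset.mem_coe, mem_nbrs, Set.mem_ofPred_eq, Set.mem_univ, true_and,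
    and_iff_right_iff_imp]
  exact fun hw => hF hw.2.1

theorem ncard_wedgeIndices_le (P : Finset (Fin n)) :
    (wedgeIndices F id o c (P : Set (Fin n))).ncard ≤ P.card :=
  calc _ ≤ {w ∈ (P : Set (Fin n)) | IsWedge F o c w}.ncard := Set.ncard_image_le
    _ ≤ (P : Set (Fin n)).ncard := Set.ncard_le_ncard (Set.sep_subset _ _)
    _ = P.card := Set.ncard_coe_finset P

theorem ncard_wedgeIndices_univ_le (hF : F ≤ G) :
    (wedgeIndices F id o c Set.univ).ncard ≤ (nbrs G c).card :=
  wedgeIndices_nbrs hF ▸ ncard_wedgeIndices_le _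

theorem IsNumbering.edge_eq_of_id_eq (h : IsNumbering name X Y id) {u v u' v' : Fin n}
    (huv : s(u, v) ∈ wedgeVerts F) (huv' : s(u', v') ∈ wedgeVerts F)
    (heq : id (u * n + v) = id (u' * n + v')) : s(u, v) = s(u', v') := by
  rw [h.id_eq huv, h.id_eq huv'] at heq
  exact congrArg Subtype.val (name.symm.injective (Fin.ext heq))

theorem IsNumbering.notMem_wedgeIndices (h : IsNumbering name X Y id) (hw : IsWedge F o c w)
    (hP : w ∉ P) : id (c * n + w) ∉ wedgeIndices F id o c P := by
  rintro ⟨x, ⟨hx, hwx⟩, heq⟩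
  have hedge := h.edge_eq_of_id_eq hwx.right_mem hw.right_mem heq
  exact hP (Sym2.congr_right.1 hedge ▸ hx)

theorem IsNumbering.disjoint_wedgeIndices (h : IsNumbering name X Y id) :
    Disjoint (wedgeIndices F id o c Set.univ) (wedgeIndices F id c o Set.univ) := by
  rw [Set.disjoint_left]
  rintro _ ⟨w, ⟨-, hw⟩, rfl⟩ ⟨w', ⟨-, hw'⟩, heq⟩
  rcases Sym2.eq_iff.1 (h.edge_eq_of_id_eq hw'.right_mem hw.right_mem heq) with ⟨hoc, -⟩ | ⟨how, -⟩
  · exact hw.1.ne hoc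
  · exact hw.2.2.1 how

theorem IsNumbering.nbrIndices_eq (h : IsNumbering name X Y id) {i : Fin N}
    (hi : (name i).1 = s(o, c)) : nbrIndices (wedgeGraph F) name i =
      wedgeIndices F id c o Set.univ ∪ wedgeIndices F id o c Set.univ := by
  ext j
  constructor
  · rintro ⟨k, ⟨x, y, z, hw, hx, hz⟩, rfl⟩
    have hk : id (y * n + z) = k := by
      rw [h.id_eq hw.right_mem, ← (Subtype.ext hz : name k = ⟨s(y, z), hw.right_mem⟩),
        Equiv.symm_apply_apply]
    rcases Sym2.eq_iff.1 (hi.symm.trans hx) with ⟨rfl, rfl⟩ | ⟨rfl, rfl⟩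
    · exact .inr ⟨z, ⟨trivial, hw⟩, hk⟩
    · exact .inl ⟨z, ⟨trivial, hw⟩, hk⟩
  · rintro (⟨w, ⟨-, hw⟩, rfl⟩ | ⟨w, ⟨-, hw⟩, rfl⟩)
    · exact ⟨_, ⟨c, o, w, hw, hi.trans Sym2.eq_swap, by rw [Equiv.apply_symm_apply]⟩,
        (h.id_eq hw.right_mem).symm⟩
    · exact ⟨_, ⟨o, c, w, hw, hi, by rw [Equiv.apply_symm_apply]⟩, (h.id_eq hw.right_mem).symm⟩

/-- The machine holds the adjacency matrix of `F` and a numbering of the nodes of its wedge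
graph. -/
structure HoldsNodes (F : SimpleGraph (Fin n)) (name : Fin N ≃ wedgeVerts F) (s : State) :
    Prop where
  adj : IsEdgeMatrix F.edgeSet (s.a aAdj)
  numbering : IsNumbering name (s.a aX) (s.a aY) (s.a aId)

variable {off nb : ℕ → ℕ} {W : ℕ} {lam : ℝ} {s s' : State}

theorem HoldsNodes.frame {p : Cmd} (h : HoldsNodes F name s) (hf : Frame W p s s')
    (hp : ∀ A ∈ [aAdj, aX, aY, aId], p.writes (.wordArray A) = false) : HoldsNodes F name s' where
  adj := by
    rw [hf.a _ (hp aAdj (by decide))]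
    exact h.adj
  numbering := by
    rw [hf.a _ (hp aX (by decide)), hf.a _ (hp aY (by decide)), hf.a _ (hp aId (by decide))]
    exact h.numbering

/-- The test whether `(o, c, z)` is a wedge, given that `oc` and `cz` are edges of `G`. -/
def outerWedgeTest : Test :=
  .and (.not (.eq (.var wZ) (.var wOuter))) (.and
    (.eq (.arr aAdj (pairIndex wCentre wZ)) (.const 1))
    (.eq (.arr aAdj (pairIndex wOuter wZ)) (.const 0)))

/-- Appends the numbers of the edges that form a wedge with `oc` at `c`. -/
def listWedges : Cmd :=
  eachNb wCentre wPosZ wEndZ wZ (.cond outerWedgeTest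
    (.store aNbZ (.var wFree) (.arr aId (pairIndex wCentre wZ)) ;;
      .set wFree (.var wFree +ₑ .const 1))
    .skip)

theorem outerWedgeTest_holds (hn : s.w wN = n) (hc : s.w wCentre = c) (ho : s.w wOuter = o)
    (hz : s.w wZ = w) (hadj : IsEdgeMatrix F.edgeSet (s.a aAdj)) (hoc : F.Adj o c) :
    outerWedgeTest.holds s ↔ IsWedge F o c w := by
  simp only [outerWedgeTest, Test.holds, WExp.eval, pairIndex_eval, hn, hc, ho, hz,
    hadj.eq_one_iff, hadj.eq_zero_iff, SimpleGraph.mem_edgeSet, Fin.val_inj, IsWedge, hoc, true_and,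
    eq_comm (a := w)]
  tauto

theorem wp_listWedges (hF : F ≤ G) (hG : IsInput G off nb) (hs : HoldsInput off nb n lam W s)
    (hZ : HoldsNodes F name s) (hoc : F.Adj o c) (hc : s.w wCentre = c) (ho : s.w wOuter = o)
    (hW : s.w wFree + (nbrs G c).card < W) :
    WP W listWedges s fun t s' => t ≤ ∑ _z ∈ nbrs G c, 60 + 11 ∧
      IsExtension (s.a aNbZ) (s.w wFree) (s'.a aNbZ) (s'.w wFree)
        (wedgeIndices F (s.a aId) o c Set.univ) := by
  classical
  refine wp_eachNb hG c (fun P s' => IsExtension (s.a aNbZ) (s.w wFree) (s'.a aNbZ) (s'.w wFree)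
      (wedgeIndices F (s.a aId) o c P)) (fun _ => 50) (by decide) (by decide) hs.bdd hs.off_eq
    hs.nb_eq hc (fun P s₁ s₂ heq h => by rwa [heq.a, heq.w wFree (by decide)])
    (by simpa [wedgeIndices_empty] using IsExtension.refl) ?_ ?_
  · intro P w s₁ hP hcw hw hf hz _ hext
    have hs₁ := hs.frame hf (by decide)
    have hc₁ : s₁.w wCentre = c := (hf.w wCentre rfl).trans hc
    have ho₁ : s₁.w wOuter = o := (hf.w wOuter rfl).trans ho
    have hid : s₁.a aId = s.a aId := hf.a aId rfl
    have hfree : s₁.w wFree + 1 < W := by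
      have hcard : P.card + 1 ≤ (nbrs G c).card := by
        rw [← Finset.card_insert_of_notMem hw]
        exact Finset.card_le_card (Finset.insert_subset (mem_nbrs.2 hcw) hP)
      have := ncard_wedgeIndices_le (F := F) (id := s.a aId) (o := o) (c := c) P
      rw [hext.eq_add_ncard]
      omega
    rw [wp_cond, outerWedgeTest_holds hs₁.n_eq hc₁ ho₁ hz (hZ.frame hf (by decide)).adj hoc,
      Finset.coe_insert]
    refine ⟨fun hwedge => ?_, fun hwedge => ?_⟩
    · rw [wedgeIndices_insert hwedge]
      have hidW : s.a aId (c * n + w) < W := hs.bdd.a _ _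
      simpa [hc₁, hz, hs₁.n_eq, hid, hidW, hfree, outerWedgeTest] using
        hext.snoc (hZ.numbering.notMem_wedgeIndices hwedge (Finset.mem_coe.not.2 hw))
    · rw [wedgeIndices_insert_of_not hwedge]
      exact wp_skip.2 ⟨by decide, hext⟩
  · intro t s' ht _ hext
    exact ⟨ht, wedgeIndices_nbrs hF ▸ hext⟩

/-- `listWedges` for the edge with number `wNode` at its end stored in `A`. -/
def listWedgesAt (A B : ℕ) : Cmd :=
  .set wCentre (.arr A (.var wNode)) ;; .set wOuter (.arr B (.var wNode)) ;; listWedges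

theorem wp_listWedgesAt {A B : ℕ} (hF : F ≤ G) (hG : IsInput G off nb)
    (hs : HoldsInput off nb n lam W s) (hZ : HoldsNodes F name s) (hoc : F.Adj o c)
    (hc : s.a A (s.w wNode) = c) (ho : s.a B (s.w wNode) = o)
    (hW : s.w wFree + (nbrs G c).card < W) :
    WP W (listWedgesAt A B) s fun t s' => t ≤ ∑ _z ∈ nbrs G c, 60 + 17 ∧
      IsExtension (s.a aNbZ) (s.w wFree) (s'.a aNbZ) (s'.w wFree)
        (wedgeIndices F (s.a aId) o c Set.univ) := by
  have hcW : (c : ℕ) < W := hc ▸ hs.bdd.a _ _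
  have hoW : (o : ℕ) < W := ho ▸ hs.bdd.a _ _
  have hf : Frame W (listWedgesAt A B) s ((s.setW wCentre c).setW wOuter o) :=
    (frame_set hcW).seq_left.trans (frame_set hoW).seq_left.seq_right
  simp only [listWedgesAt, wp_seq, wp_set, WExp.eval, WExp.cost, State.setW_w, State.setW_a, hc,
    Nat.reduceEqDiff, if_false, ho]
  have hsub := wp_listWedges hF hG (hs.frame hf (show ∀ l ∈ inputLocs,
    (listWedgesAt 0 0).writes l = false by decide)) (hZ.frame hf
      (show ∀ C ∈ [aAdj, aX, aY, aId], (listWedgesAt 0 0).writes (.wordArray C) = false by decide))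
    hoc (by simp) (by simp) (by simpa using hW)
  refine ⟨hcW, hoW, hsub.mono fun t s' ⟨_, hext⟩ => ⟨by omega, ?_⟩⟩
  simpa using hext

end WedgeLists

section BuildLists

variable {n N : ℕ} {F G : SimpleGraph (Fin n)} {name : Fin N ≃ wedgeVerts F} {off nb : ℕ → ℕ}
  {W : ℕ} {lam : ℝ} {s : State}

/-- Appends the adjacency list of node `wNode` of the wedge graph. -/
def listNbrs : Cmd :=
  listWedgesAt aX aY ;; listWedgesAt aY aX ;;
    .store aOffZ (.var wNode +ₑ .const 1) (.var wFree)

theorem wp_listNbrs (hF : F ≤ G) (hG : IsInput G off nb) (hs : HoldsInput off nb n lam W s)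
    (hZ : HoldsNodes F name s) {i : Fin N} (hi : s.w wNode = i)
    (hlist : IsPartialAdjList (wedgeGraph F) name i (s.w wFree) (s.a aOffZ) (s.a aNbZ))
    (hW : s.w wFree + (degAt G (s.a aX i) + degAt G (s.a aY i)) < W) :
    WP W listNbrs s fun t s' => t ≤ 60 * (degAt G (s.a aX i) + degAt G (s.a aY i)) + 40 ∧
      s'.w wFree ≤ s.w wFree + (degAt G (s.a aX i) + degAt G (s.a aY i)) ∧
      IsPartialAdjList (wedgeGraph F) name (i + 1) (s'.w wFree) (s'.a aOffZ) (s'.a aNbZ) := by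
  obtain ⟨u, v, hnode, hname⟩ := hZ.numbering i
  have huv : F.Adj u v := wedgeVerts_subset (hname ▸ (name i).2)
  rw [hnode.left, hnode.right, degAt_coe, degAt_coe] at hW ⊢
  rw [listNbrs, wp_seq]
  refine (wp_listWedgesAt hF hG hs hZ huv.symm (hi ▸ hnode.left) (hi ▸ hnode.right)
    (by omega)).mono_frame fun t₁ s₁ ⟨ht₁, hext₁⟩ hf₁ => ?_
  have hfree₁ := hext₁.eq_add_ncard
  have hcard₁ := ncard_wedgeIndices_univ_le (id := s.a aId) (o := v) (c := u) hF
  have hs₁ := hs.frame hf₁ (by decide)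
  have hZ₁ := hZ.frame hf₁ (by decide)
  have hi₁ : s₁.w wNode = i := (hf₁.w wNode rfl).trans hi
  have hX₁ : s₁.a aX i = u := (congrFun (hf₁.a aX rfl) i).trans hnode.left
  have hY₁ : s₁.a aY i = v := (congrFun (hf₁.a aY rfl) i).trans hnode.right
  rw [wp_seq]
  refine (wp_listWedgesAt hF hG hs₁ hZ₁ huv (hi₁ ▸ hY₁) (hi₁ ▸ hX₁) (by omega)).mono_frame
    fun t₂ s₂ ⟨ht₂, hext₂⟩ hf₂ => ?_
  have hfree₂ := hext₂.eq_add_ncard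
  have hcard₂ := ncard_wedgeIndices_univ_le (id := s₁.a aId) (o := u) (c := v) hF
  have hext := hext₁.trans (hf₁.a aId rfl ▸ hext₂) hZ.numbering.disjoint_wedgeIndices
  rw [← hZ.numbering.nbrIndices_eq hname] at hext
  have hi₂ : s₂.w wNode = i := (hf₂.w wNode rfl).trans hi₁
  have hoff₂ : s₂.a aOffZ = s.a aOffZ := (hf₂.a aOffZ rfl).trans (hf₁.a aOffZ rfl)
  simp only [Finset.sum_const, smul_eq_mul] at ht₁ ht₂
  refine wp_store.2 ⟨(hf₂.bdd hs₁.bdd).w _, ?_⟩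
  simp only [WExp.eval, WExp.cost, hi₂, State.setA_w, State.setA_a_self, hoff₂]
  exact ⟨by omega, by omega, by simpa using hlist.succ hext⟩

/-- Builds the adjacency lists of the wedge graph. -/
def buildLists : Cmd :=
  .set wFree (.const 0) ;; .store aOffZ (.const 0) (.const 0) ;; upTo wNode wNodes listNbrs

theorem wp_buildLists (hF : F ≤ G) (hG : IsInput G off nb) (hs : HoldsInput off nb n lam W s)
    (hZ : HoldsNodes F name s) (hN : s.w wNodes = N) (hW : 2 * size G < W) :
    WP W buildLists s fun t s' => t ≤ 300 * size G + 20 ∧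
      IsAdjList (wedgeGraph F) name (s'.a aOffZ) (s'.a aNbZ) ∧ s'.a aOffZ N ≤ 2 * size G := by
  let D : ℕ → ℕ := fun i => degAt G (s.a aX i) + degAt G (s.a aY i)
  have hsize : ∑ i ∈ Finset.range N, D i ≤ 2 * size G := hZ.numbering.sum_degAt_le hF
  have hW0 : 0 < W := by omega
  have hf₀ : Frame W buildLists s ((s.setW wFree 0).setA aOffZ 0 0) :=
    (frame_set hW0).seq_left.trans (frame_store hW0).seq_left.seq_right
  simp only [buildLists, wp_seq, wp_set, wp_store, WExp.eval, WExp.cost]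
  refine ⟨hW0, hW0, wp_upTo (N := N) (fun i s' =>
      IsPartialAdjList (wedgeGraph F) name i (s'.w wFree) (s'.a aOffZ) (s'.a aNbZ) ∧
        s'.w wFree ≤ ∑ j ∈ Finset.range i, D j) (fun i => 60 * D i + 40) rfl rfl (by decide)
    (hf₀.bdd hs.bdd) (by simpa using hN) ?_ ?_ ?_⟩
  · exact ⟨by simpa using isPartialAdjList_zero (by simp), by simp⟩
  · intro i s₁ hi hf hi₁ ⟨hlist, hfree⟩
    have hs₁ := (hs.frame hf₀ (by decide)).frame hf (by decide)
    have hZ₁ := (hZ.frame hf₀ (by decide)).frame hf (by decide)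
    have hDi : degAt G (s₁.a aX i) + degAt G (s₁.a aY i) = D i := by
      rw [hf.a aX rfl, hf.a aY rfl, hf₀.a aX rfl, hf₀.a aY rfl]
    have hsum : ∑ j ∈ Finset.range i, D j + D i ≤ 2 * size G := by
      rw [← Finset.sum_range_succ]
      exact (Finset.sum_le_sum_of_subset (Finset.range_mono hi)).trans hsize
    refine (wp_listNbrs hF hG hs₁ hZ₁ (i := ⟨i, hi⟩) hi₁ hlist (by simp only [hDi]; omega)).mono ?_
    rintro t s₂ ⟨ht, hfree₂, hlist₂⟩
    rw [hDi] at ht hfree₂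
    refine ⟨ht, by simpa using hlist₂, ?_⟩
    rw [Finset.sum_range_succ]
    exact hfree₂.trans (Nat.add_le_add_right hfree _)
  · rintro t s' ht - ⟨hlist, hfree⟩
    have hNsize := hZ.numbering.le_size hF
    simp only [add_assoc, Finset.sum_add_distrib, ← Finset.mul_sum, Finset.sum_const,
      Finset.card_range, smul_eq_mul] at ht
    exact ⟨by omega, hlist.isAdjList, hlist.last ▸ hfree.trans hsize⟩

end BuildLists

local notation "aLabel" => 13

section AdjList

variable {X : Type*} {N : ℕ} {H : SimpleGraph X} {name : Fin N ≃ X} {off nb off' nb' : ℕ → ℕ}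

theorem IsAdjList.monotoneOn (h : IsAdjList H name off nb) : MonotoneOn off (Set.Iic N) :=
  monotoneOn_of_le_add_one Set.ordConnected_Iic fun i _ _ hi => h.mono ⟨i, hi⟩

theorem IsAdjList.bijOn (h : IsAdjList H name off nb) (i : Fin N) :
    Set.BijOn nb (Set.Ico (off i) (off (i + 1))) (nbrIndices H name i) := by
  refine ⟨fun p hp => ?_, fun p hp q hq hpq => ?_, ?_⟩
  · obtain ⟨j, hj, hadj⟩ := h.sound i p hp.1 hp.2
    exact ⟨j, hadj, hj.symm⟩
  · obtain ⟨j, hj, hadj⟩ := h.sound i p hp.1 hp.2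
    exact (h.complete i j hadj).unique ⟨hp.1, hp.2, hj⟩ ⟨hq.1, hq.2, hpq ▸ hj⟩
  · rintro _ ⟨j, hadj, rfl⟩
    obtain ⟨p, hp, hp', hj⟩ := (h.complete i j hadj).exists
    exact ⟨p, ⟨hp, hp'⟩, hj⟩

theorem IsAdjList.congr (h : IsAdjList H name off nb) (hoff : ∀ i ≤ N, off' i = off i)
    (hnb : ∀ p < off N, nb' p = nb p) : IsAdjList H name off' nb' := by
  refine IsPartialAdjList.isAdjList (e := off N) ⟨?_, hoff N le_rfl, ?_, fun j _ => ?_⟩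
  · rw [hoff 0 (Nat.zero_le N), h.zero]
  · exact h.monotoneOn.congr fun i hi => (hoff i hi).symm
  · rw [hoff j j.2.le, hoff (j + 1) j.2]
    refine (h.bijOn j).congr fun p hp => (hnb p (hp.2.trans_le ?_)).symm
    exact h.monotoneOn (Nat.succ_le_of_lt j.2) Set.self_mem_Iic j.2

end AdjList

section Labels

variable {n : ℕ} {G F : SimpleGraph (Fin n)} {off nb : ℕ → ℕ} {W : ℕ} {lam : ℝ} {s : State}
  {weak : Set (Sym2 (Fin n))}

theorem IsInput.off_succ (hG : IsInput G off nb) (u : Fin n) :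
    off (u + 1) = off u + (nbrs G u).card := by
  have hbij := hG.adj.bijOn u
  have hcard : (nbrIndices G (Equiv.refl (Fin n)) u).ncard = (nbrs G u).card := by
    rw [nbrIndices, Set.ncard_image_of_injective _ Fin.val_injective, ← Set.ncard_coe_finset]
    congr 1
    ext v
    simp
  rw [← hbij.image_eq, hbij.injOn.ncard_image, ← Finset.coe_Ico, Set.ncard_coe_finset,
    Nat.card_Ico] at hcard
  have := hG.adj.mono u
  omega

theorem IsInput.off_eq_sum (hG : IsInput G off nb) {i : ℕ} (hi : i ≤ n) :
    off i = ∑ j ∈ Finset.range i, degAt G j := by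
  induction i with
  | zero => simpa using hG.adj.zero
  | succ i ih =>
    rw [Finset.sum_range_succ, ← ih (by omega), ← Fin.val_mk hi, degAt_coe]
    exact hG.off_succ ⟨i, hi⟩

theorem IsInput.off_le_size (hG : IsInput G off nb) : off n ≤ size G := by
  rw [hG.off_eq_sum le_rfl, ← Fin.sum_univ_eq_sum_range]
  exact Finset.sum_le_sum fun u _ => by rw [degAt_coe]; nlinarith

theorem IsEntry.eq_of_eq (hG : IsInput G off nb) {u v u' v' : Fin n} {p : ℕ}
    (h : IsEntry off nb u v p) (h' : IsEntry off nb u' v' p) : u = u' ∧ v = v' := by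
  have hlt : ∀ a b : Fin n, a < b → p < off (a + 1) → ¬ off b ≤ p := fun a b hab ha hb =>
    (hb.trans_lt ha).not_ge (hG.adj.monotoneOn a.2 b.2.le hab)
  refine ⟨?_, Fin.ext (h.nb_eq.symm.trans h'.nb_eq)⟩
  rcases lt_trichotomy u u' with huu' | heq | huu'
  · exact absurd h'.le (hlt u u' huu' h.lt)
  · exact heq
  · exact absurd h.le (hlt u' u huu' h'.lt)

/-- Copies the matrix of the weak edges to the positions of the adjacency lists. -/
def writeLabels : Cmd := eachArc (.store aLabel (.var wPos) (.arr aWeak (pairIndex wU wV)))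

theorem wp_writeLabels (hG : IsInput G off nb) (hs : HoldsInput off nb n lam W s)
    (hweak : IsEdgeMatrix weak (s.a aWeak)) :
    WP W writeLabels s fun t s' => t ≤ ∑ u, (∑ _v ∈ nbrs G u, 20 + 18) + 5 ∧
      IsEdgeArray G off nb (weak.indicator fun _ => 1) (s'.a aLabel) := by
  refine wp_eachArc hG (fun D s' => ∀ u v, (u, v) ∈ D → ∀ p, IsEntry off nb u v p →
      s'.a aLabel p = weak.indicator (fun _ => 1) s(u, v)) (fun _ _ => 10)
    (by decide) (by decide) hs (fun D s₁ s₂ heq h => by rwa [heq.a]) (by simp) ?_ ?_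
  · intro D u v s₁ _ hadj _ hf hat hI
    have hval : s₁.a aWeak (u * n + v) = weak.indicator (fun _ => 1) s(u, v) := by
      rw [hf.a aWeak rfl, hweak]
    rw [wp_store]
    simp only [WExp.eval, WExp.cost, pairIndex_eval, pairIndex_cost, hat.u_eq, hat.v_eq, hat.n_eq,
      State.setA_a_self]
    refine ⟨hat.bdd.a _ _, by omega, fun u' v' huv' p hp => ?_⟩
    rcases eq_or_ne p (s₁.w wPos) with rfl | hne
    · obtain ⟨rfl, rfl⟩ := hat.entry.eq_of_eq hG hp
      rw [Function.update_self, hval]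
    · rw [Function.update_of_ne hne]
      refine hI u' v' ((Finset.mem_insert.1 huv').resolve_left ?_) p hp
      rintro ⟨rfl, rfl⟩
      exact hne (hp.unique hG hadj hat.entry)
  · intro t s' ht _ _ hI
    exact ⟨ht, fun u v huv p hp hp' hnb => hI u v (mem_arcs.2 huv) p ⟨hp, hp', hnb⟩⟩

end Labels

local notation "wNodesOut" => 1
local notation "wCopy" => 10
local notation "wCopyEnd" => 11
local notation "aXOut" => 2
local notation "aYOut" => 3
local notation "aOffOut" => 4
local notation "aNbOut" => 5
local notation "aLabelOut" => 6

section Apr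

variable {n : ℕ} {G F : SimpleGraph (Fin n)} {off nb : ℕ → ℕ} {W : ℕ} {lam : ℝ} {s : State}
  {weak : Set (Sym2 (Fin n))} {U : Finset (Fin n)}

theorem sum_sum_nbrs_le_size {a b : ℕ} (hab : b ≤ a) :
    ∑ u, (∑ _v ∈ nbrs G u, a + b) ≤ a * size G :=
  sum_le_size fun u => by
    calc ∑ _v ∈ nbrs G u, a + b ≤ a * ((nbrs G u).card + 1) := by
          rw [Finset.sum_const, smul_eq_mul]
          linarith
      _ ≤ a * ((nbrs G u).card + 1) ^ 2 := Nat.mul_le_mul_left _ (Nat.le_self_pow two_ne_zero _)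

theorem IsAprMinSTC.subset (h : IsAprMinSTC F weak) : weak ⊆ F.edgeSet := by
  obtain ⟨M, -, rfl⟩ := h
  rintro _ ⟨e, -, rfl⟩
  exact wedgeVerts_subset e.2

theorem VanishOutside.of_isEdgeMatrix {S T : Set (Sym2 (Fin n))}
    (hF : F ≤ G) (hS : S ⊆ F.edgeSet) (hT : T ⊆ F.edgeSet)
    (hadj : IsEdgeMatrix F.edgeSet (s.a aAdj)) (hmark : IsEdgeMatrix S (s.a aMark))
    (hweak : IsEdgeMatrix T (s.a aWeak)) : VanishOutside G s := by
  intro A hA u v huv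
  have hnot : s(u, v) ∉ F.edgeSet := fun h => huv (hF h)
  simp only [List.mem_cons, List.not_mem_nil, or_false] at hA
  rcases hA with rfl | rfl | rfl
  · exact hadj.eq_zero_iff.2 hnot
  · exact hmark.eq_zero_iff.2 fun h => hnot (hS h)
  · exact hweak.eq_zero_iff.2 fun h => hnot (hT h)

/-- Apr-MinSTC on the subgraph induced by the flags, with the weak edges as a matrix. -/
def labelEdges : Cmd := loadGraph ;; scanWedges

theorem wp_labelEdges (hG : IsInput G off nb) (hW : 1 < W) (hs : HoldsInput off nb n lam W s)
    (hU : IsFlags U (s.a aFlag)) (h : VanishOutside G s) :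
    WP W labelEdges s fun t s' => t ≤ 240 * size G + 10 ∧
      IsEdgeMatrix (sub G U).edgeSet (s'.a aAdj) ∧
      IsEdgeMatrix (wedgeVerts (sub G U)) (s'.a aMark) ∧
      ∃ weak, IsAprMinSTC (sub G U) weak ∧ IsEdgeMatrix weak (s'.a aWeak) := by
  rw [labelEdges, wp_seq]
  refine (wp_loadGraph hG hW hs hU h).mono_frame fun t₁ s₁ ⟨_, hadj, hmark, hweak⟩ hf₁ => ?_
  refine (wp_scanWedges sub_le hG hW (hs.frame hf₁ (by decide)) hadj hmark hweak).mono_frame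
    fun t₂ s₂ ⟨_, hmark₂, hweak₂⟩ hf₂ => ⟨?_, hf₂.a aAdj rfl ▸ hadj, hmark₂, hweak₂⟩
  have hload := sum_sum_nbrs_le_size (G := G) (show 18 ≤ 40 by decide)
  have hscan : ∑ u, (∑ _v ∈ nbrs G u, (∑ _z ∈ nbrs G u, 130 + 21) + 18) ≤ 200 * size G :=
    sum_le_size fun u => by
      simp only [Finset.sum_const, smul_eq_mul]
      nlinarith
  omega

/-- Builds the wedge graph of the graph in the adjacency matrix from the matrix of its nodes. -/
def buildWedgeGraph : Cmd := numberNodes ;; buildLists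

theorem IsNumbering.isWedgeGraphArrays {N : ℕ} {name : Fin N ≃ wedgeVerts F}
    {X Y id offZ nbZ : ℕ → ℕ} (h : IsNumbering name X Y id)
    (hadj : IsAdjList (wedgeGraph F) name offZ nbZ) : IsWedgeGraphArrays F N X Y offZ nbZ := by
  refine ⟨name, fun i => ?_, hadj⟩
  obtain ⟨u, v, hnode, hname⟩ := h i
  rw [hname, hnode.left, hnode.right, Sym2.map_mk]

theorem wp_buildWedgeGraph (hF : F ≤ G) (hG : IsInput G off nb) (hW : 2 * n ^ 3 + n * n + 2 ≤ W)
    (hs : HoldsInput off nb n lam W s) (hadj : IsEdgeMatrix F.edgeSet (s.a aAdj))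
    (hmark : IsEdgeMatrix (wedgeVerts F) (s.a aMark)) :
    WP W buildWedgeGraph s fun t s' => t ≤ 360 * size G + 30 ∧
      IsWedgeGraphArrays F (s'.w wNodes) (s'.a aX) (s'.a aY) (s'.a aOffZ) (s'.a aNbZ) ∧
      s'.w wNodes ≤ size G ∧ s'.a aOffZ (s'.w wNodes) ≤ 2 * size G := by
  have hsize := size_le (G := G)
  rw [buildWedgeGraph, wp_seq]
  refine (wp_numberNodes hF hG (by omega) hs hmark).mono_frame
    fun t₁ s₁ ⟨_, _, name, hname⟩ hf₁ => ?_
  have hnodes : HoldsNodes F name s₁ := ⟨hf₁.a aAdj rfl ▸ hadj, hname⟩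
  refine (wp_buildLists hF hG (hs.frame hf₁ (by decide)) hnodes rfl (by omega)).mono_frame
    fun t₂ s₂ ⟨_, hlist, hlen⟩ hf₂ => ?_
  have htime := sum_sum_nbrs_le_size (G := G) (show 18 ≤ 60 by decide)
  rw [hf₂.w wNodes rfl, hf₂.a aX rfl, hf₂.a aY rfl]
  exact ⟨by omega, hname.isWedgeGraphArrays hlist, hname.le_size hF, hlen⟩

/-- The machine holds the wedge graph of the subgraph `F` of the input graph and a labeling of `F`,
and the matrices are ready for another run of Apr-MinSTC. -/
structure HoldsLabeling (G F : SimpleGraph (Fin n)) (off nb : ℕ → ℕ) (weak : Set (Sym2 (Fin n)))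
    (s : State) : Prop where
  label : IsAprMinSTC F weak
  graph : IsWedgeGraphArrays F (s.w wNodes) (s.a aX) (s.a aY) (s.a aOffZ) (s.a aNbZ)
  edges : IsEdgeArray G off nb (weak.indicator fun _ => 1) (s.a aLabel)
  matrix : IsEdgeMatrix weak (s.a aWeak)
  vanish : VanishOutside G s
  nodes_le : s.w wNodes ≤ size G
  arcs_le : s.a aOffZ (s.w wNodes) ≤ 2 * size G

/-- Apr-MinSTC on the subgraph induced by the flags. -/
def apr : Cmd := labelEdges ;; buildWedgeGraph ;; writeLabels

theorem wp_apr (hG : IsInput G off nb) (hW : 2 * n ^ 3 + n * n + 2 ≤ W)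
    (hs : HoldsInput off nb n lam W s) (hU : IsFlags U (s.a aFlag)) (h : VanishOutside G s) :
    WP W apr s fun t s' => t ≤ 620 * size G + 50 ∧
      ∃ weak, HoldsLabeling G (sub G U) off nb weak s' := by
  rw [apr, wp_seq]
  refine (wp_labelEdges hG (by omega) hs hU h).mono_frame
    fun t₁ s₁ ⟨_, hadj, hmark, weak, hlabel, hweak⟩ hf₁ => ?_
  have hs₁ := hs.frame hf₁ (by decide)
  rw [wp_seq]
  refine (wp_buildWedgeGraph sub_le hG hW hs₁ hadj hmark).mono_frame
    fun t₂ s₂ ⟨_, hgraph, hnodes, harcs⟩ hf₂ => ?_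
  refine (wp_writeLabels hG (hs₁.frame hf₂ (by decide)) (hf₂.a aWeak rfl ▸ hweak)).mono_frame
    fun t₃ s₃ ⟨_, hedges⟩ hf₃ => ?_
  have hf := hf₂.seq_left.trans hf₃.seq_right
  have htime := sum_sum_nbrs_le_size (G := G) (show 18 ≤ 20 by decide)
  refine ⟨by omega, weak, hlabel, ?_, hedges, hf.a aWeak rfl ▸ hweak, ?_, ?_, ?_⟩
  · rwa [hf₃.w wNodes rfl, hf₃.a aX rfl, hf₃.a aY rfl, hf₃.a aOffZ rfl, hf₃.a aNbZ rfl]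
  · exact VanishOutside.of_isEdgeMatrix sub_le wedgeVerts_subset hlabel.subset
      (hf.a aAdj rfl ▸ hadj) (hf.a aMark rfl ▸ hmark) (hf.a aWeak rfl ▸ hweak)
  · rwa [hf₃.w wNodes rfl]
  · rwa [hf₃.w wNodes rfl, hf₃.a aOffZ rfl]

/-- Copies cell `wCopy` of each array with results of `apr`, which is moved from `A + 7` to `A`. -/
def copyCells : Cmd :=
  .store aXOut (.var wCopy) (.arr aX (.var wCopy)) ;;
    .store aYOut (.var wCopy) (.arr aY (.var wCopy)) ;;
    .store aOffOut (.var wCopy) (.arr aOffZ (.var wCopy)) ;;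
    .store aNbOut (.var wCopy) (.arr aNbZ (.var wCopy)) ;;
    .store aLabelOut (.var wCopy) (.arr aLabel (.var wCopy))

theorem wp_copyCells (hb : s.Bdd W) : WP W copyCells s fun t s' => t ≤ 20 ∧
    ∀ A ∈ [aXOut, aYOut, aOffOut, aNbOut, aLabelOut], s'.a A =
      Function.update (s.a A) (s.w wCopy) (s.a (A + 7) (s.w wCopy)) := by
  simp [copyCells, hb.a _ _]

theorem IsWedgeGraphArrays.congr {N : ℕ} {X Y offZ nbZ X' Y' offZ' nbZ' : ℕ → ℕ}
    (h : IsWedgeGraphArrays F N X Y offZ nbZ) (hX : ∀ i < N, X' i = X i) (hY : ∀ i < N, Y' i = Y i)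
    (hoff : ∀ i ≤ N, offZ' i = offZ i) (hnb : ∀ p < offZ N, nbZ' p = nbZ p) :
    IsWedgeGraphArrays F N X' Y' offZ' nbZ' := by
  obtain ⟨name, hends, hadj⟩ := h
  exact ⟨name, fun i => by rw [hends i, hX i i.2, hY i i.2], hadj.congr hoff hnb⟩

theorem IsEdgeArray.congr {α : Type*} {f : Sym2 (Fin n) → α} {arr arr' : ℕ → α}
    (h : IsEdgeArray G off nb f arr) (hG : IsInput G off nb) (harr : ∀ p < off n, arr' p = arr p) :
    IsEdgeArray G off nb f arr' := fun u v huv p hp hp' hnb => by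
  rw [harr p (hp'.trans_le (hG.adj.monotoneOn u.2 Set.self_mem_Iic u.2)), h u v huv p hp hp' hnb]

/-- Copies the results of `apr` to the output for `G`. -/
def copyOut : Cmd :=
  .set wCopyEnd (.var wNodes +ₑ .arr aOffZ (.var wNodes) +ₑ .arr aOff (.var wN) +ₑ .const 1) ;;
    upTo wCopy wCopyEnd copyCells ;; .set wNodesOut (.var wNodes)

theorem wp_copyOut (hG : IsInput G off nb) (hW : 4 * n ^ 3 + 2 ≤ W)
    (hs : HoldsInput off nb n lam W s) (h : HoldsLabeling G F off nb weak s) :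
    WP W copyOut s fun t s' => t ≤ 150 * size G + 60 ∧
      IsWedgeGraphArrays F (s'.w wNodesOut) (s'.a aXOut) (s'.a aYOut) (s'.a aOffOut) (s'.a aNbOut) ∧
      IsEdgeArray G off nb (weak.indicator fun _ => 1) (s'.a aLabelOut) := by
  have hsize := size_le (G := G)
  have hoff := hG.off_le_size
  have hnodes := h.nodes_le
  have harcs := h.arcs_le
  set L := s.w wNodes + s.a aOffZ (s.w wNodes) + off n + 1 with hL
  have hLW : L < W := by omega
  simp only [copyOut, wp_seq, wp_set, WExp.eval, WExp.cost, hs.n_eq, hs.off_eq, ← hL]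
  refine ⟨hLW, wp_upTo (N := L) (fun i s' => ∀ A ∈ [aXOut, aYOut, aOffOut, aNbOut, aLabelOut],
      ∀ j < i, s'.a A j = s.a (A + 7) j) (fun _ => 20) rfl rfl (by decide) (hs.bdd.setW hLW)
    (by simp) (by simp) ?_ ?_⟩
  · intro i s₁ _ hf hi₁ hcopied
    have hkept : ∀ A ∈ [aXOut, aYOut, aOffOut, aNbOut, aLabelOut],
        (upTo wCopy wCopyEnd copyCells).writes (.wordArray (A + 7)) = false := by decide
    refine (wp_copyCells (hf.bdd (hs.bdd.setW hLW))).mono fun t s₂ ⟨ht, hcells⟩ => ⟨ht, ?_⟩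
    intro A hA j hj
    have hsource : s₁.a (A + 7) = s.a (A + 7) := hf.a _ (hkept A hA)
    rw [State.setW_a, hcells A hA, hi₁, hsource, Function.update_apply]
    split_ifs with hji
    · rw [hji]
    · exact hcopied A hA j (by omega)
  · intro t s' ht hf hcopied
    have hN : s'.w wNodes = s.w wNodes := by simpa using hf.w wNodes rfl
    rw [Finset.sum_const, Finset.card_range, smul_eq_mul] at ht
    simp only [State.setW_w, State.setW_a, if_true, hN]
    refine ⟨hN ▸ (hf.bdd (hs.bdd.setW hLW)).w _, by omega, h.graph.congr ?_ ?_ ?_ ?_,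
      h.edges.congr hG ?_⟩ <;>
      exact fun j hj => hcopied _ (by decide) j (by omega)

end Apr

/-! ## The tree of the keys `a + lam * b` -/

local notation "wKeyA" => 21
local notation "wKeyB" => 22
local notation "wSteps" => 23
local notation "wStep" => 24
local notation "wA" => 25
local notation "wB" => 26
local notation "wCell" => 27
local notation "wBest" => 28
local notation "aCount" => 20
local notation "aBest" => 23
local notation "rBest" => 3
local notation "raBest" => 1

section Cells

variable {n a b A B i : ℕ} {lam : ℝ} {count : ℕ → ℕ} {p q : ℕ × ℕ} {P Q : Set (ℕ × ℕ)}
  {v v' : ℝ} {c c' : ℕ}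

/-- The number of the cell `q` in the arrays. The cell `(a, b)` collects the vertices with `a`
strong and `b` weak neighbours, so that `b ≤ n`. -/
def cell (n : ℕ) (q : ℕ × ℕ) : ℕ := q.1 * (n + 1) + q.2

theorem cell_inj (hp : p.2 ≤ n) (hq : q.2 ≤ n) : cell n p = cell n q ↔ p = q := by
  refine ⟨fun h => ?_, fun h => h ▸ rfl⟩
  have hfst : p.1 = q.1 := by
    have hdiv := congrArg (· / (n + 1)) h
    simpa [cell, mul_comm _ (n + 1), Nat.mul_add_div, Nat.div_eq_of_lt, Nat.lt_succ_of_le hp,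
      Nat.lt_succ_of_le hq] using hdiv
  refine Prod.ext hfst ?_
  simp only [cell, hfst] at h
  omega

theorem cell_lt (ha : q.1 < n) (hb : q.2 ≤ n) : cell n q < (n + 1) * (n + 1) := by
  simp only [cell]
  nlinarith

/-- The key `a + lam * b` of the cell `(a, b)`, with an offset that makes it negative: the value `0`
of uninitialised memory then stands for an empty subtree. -/
noncomputable def cellKey (n : ℕ) (lam : ℝ) (q : ℕ × ℕ) : ℝ := q.1 + lam * q.2 - (n + n : ℕ)

theorem cellKey_neg (hlam : lam ≤ 1) (ha : q.1 < n) (hb : q.2 < n) : cellKey n lam q < 0 := by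
  have ha' : (q.1 : ℝ) < n := by exact_mod_cast ha
  have hb' : (q.2 : ℝ) < n := by exact_mod_cast hb
  have hmul : lam * q.2 ≤ q.2 := mul_le_of_le_one_left (Nat.cast_nonneg _) hlam
  simp only [cellKey, Nat.cast_add]
  linarith

/-- The cells with a positive counter. -/
def occupied (n : ℕ) (count : ℕ → ℕ) : Set (ℕ × ℕ) := {q | q.2 ≤ n ∧ 0 < count (cell n q)}

theorem inter_occupied_update (hq : q.2 ≤ n) (hP : q ∉ P) (k : ℕ) :
    P ∩ occupied n (Function.update count (cell n q) k) = P ∩ occupied n count := by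
  ext p
  refine and_congr_right fun hp => and_congr_right fun hp₂ => ?_
  rw [Function.update_of_ne]
  rw [Ne, cell_inj hp₂ hq]
  rintro rfl
  exact hP hp

/-- The subtree of the cell `q`. The parent of the cell `(a, b)` is `(a - 1, b)` if `0 < a`, and
`(0, b - 1)` if `a = 0 < b`. -/
def subtree (q : ℕ × ℕ) : Set (ℕ × ℕ) := {p | q.1 = 0 ∧ q.2 ≤ p.2 ∨ p.2 = q.2 ∧ q.1 ≤ p.1}

theorem subtree_of_ne_zero (hq : q.1 ≠ 0) : subtree q = {q} ∪ subtree (q.1 + 1, q.2) := by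
  ext p
  simp only [subtree, Set.mem_ofPred_eq, Set.mem_union, Set.mem_singleton_iff, Prod.ext_iff]
  omega

theorem subtree_of_eq_zero (hq : q.1 = 0) :
    subtree q = {q} ∪ subtree (q.1 + 1, q.2) ∪ subtree (q.1, q.2 + 1) := by
  ext p
  simp only [subtree, Set.mem_ofPred_eq, Set.mem_union, Set.mem_singleton_iff, Prod.ext_iff]
  omega

/-- The cell `i` steps above `q` on the path to the root. -/
def ancestor (q : ℕ × ℕ) (i : ℕ) : ℕ × ℕ := (q.1 - i, q.2 - (i - q.1))

theorem exists_eq_ancestor (h : q ∈ subtree p) : ∃ i ≤ q.1 + q.2, p = ancestor q i := by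
  simp only [ancestor, Prod.ext_iff]
  rcases h with ⟨hp, hle⟩ | ⟨heq, hle⟩
  · exact ⟨q.1 + q.2 - p.2, by omega, by omega, by omega⟩
  · exact ⟨q.1 - p.1, by omega, by omega, by omega⟩

/-- `v` is the least key of a cell of `P`, attained by the cell with number `c`, or `0` if `P` is
empty. -/
structure IsLeastKey (n : ℕ) (lam : ℝ) (P : Set (ℕ × ℕ)) (v : ℝ) (c : ℕ) : Prop where
  nonpos : v ≤ 0
  lower : ∀ q ∈ P, v ≤ cellKey n lam q
  attained : v < 0 → ∃ q ∈ P, c = cell n q ∧ v = cellKey n lam q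

theorem isLeastKey_empty (n : ℕ) (lam : ℝ) (c : ℕ) : IsLeastKey n lam ∅ 0 c :=
  ⟨le_rfl, fun _ h => h.elim, fun h => (lt_irrefl _ h).elim⟩

theorem isLeastKey_singleton (h : cellKey n lam q ≤ 0) :
    IsLeastKey n lam {q} (cellKey n lam q) (cell n q) :=
  ⟨h, fun _ hp => hp ▸ le_rfl, fun _ => ⟨q, rfl, rfl, rfl⟩⟩

theorem IsLeastKey.union_left (h : IsLeastKey n lam P v c) (h' : IsLeastKey n lam Q v' c')
    (hv : v ≤ v') : IsLeastKey n lam (P ∪ Q) v c := by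
  refine ⟨h.nonpos, ?_, fun hneg => ?_⟩
  · rintro q (hq | hq)
    exacts [h.lower q hq, hv.trans (h'.lower q hq)]
  · obtain ⟨q, hq, hc⟩ := h.attained hneg
    exact ⟨q, Or.inl hq, hc⟩

theorem IsLeastKey.union_right (h : IsLeastKey n lam P v c) (h' : IsLeastKey n lam Q v' c')
    (hv : v' ≤ v) : IsLeastKey n lam (P ∪ Q) v' c' :=
  Set.union_comm Q P ▸ h'.union_left h hv

end Cells

section Repair

variable {n W : ℕ} {lam : ℝ} {off nb : ℕ → ℕ} {s : State} {p q : ℕ × ℕ}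

/-- The machine holds the least key of an occupied cell in the subtree of `q`. -/
def HoldsLeastKey (n : ℕ) (lam : ℝ) (s : State) (q : ℕ × ℕ) : Prop :=
  IsLeastKey n lam (subtree q ∩ occupied n (s.a aCount)) (s.ra raBest (cell n q))
    (s.a aBest (cell n q))

theorem HoldsLeastKey.frame {c : Cmd} {s' : State} (h : HoldsLeastKey n lam s q)
    (hf : Frame W c s s') (hc : ∀ l ∈ [.wordArray aCount, .wordArray aBest, .realArray raBest],
      c.writes l = false) : HoldsLeastKey n lam s' q := by
  rwa [HoldsLeastKey, hf.a aCount (hc _ (by simp)), hf.a aBest (hc _ (by simp)),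
    hf.ra raBest (hc _ (by simp))]

/-- The number of the cell with the given coordinates. -/
def cellIndex (x y : WExp) : WExp := x *ₑ (.var wN +ₑ .const 1) +ₑ y

@[simp] theorem cellIndex_eval (x y : WExp) (s : State) :
    (cellIndex x y).eval s = cell (s.w wN) (x.eval s, y.eval s) := rfl

@[simp] theorem cellIndex_cost (x y : WExp) : (cellIndex x y).cost = x.cost + y.cost + 5 := by
  simp only [cellIndex, WExp.cost]
  omega

@[simp] theorem WExp.eval_setR (e : WExp) (s : State) (x : ℕ) (v : ℝ) :
    e.eval (s.setR x v) = e.eval s := by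
  induction e <;> simp only [WExp.eval, State.setR_w, State.setR_a, *]

/-- Replaces the current least key by the one stored at the cell with number `e` if that is
smaller. -/
def takeMin (e : WExp) : Cmd :=
  .cond (.rlt (.arr raBest e) (.var rBest))
    (.rset rBest (.arr raBest e) ;; .set wBest (.arr aBest e)) .skip

theorem wp_takeMin {e : WExp} {P Q : Set (ℕ × ℕ)} (hb : s.Bdd W)
    (hP : IsLeastKey n lam P (s.r rBest) (s.w wBest))
    (hQ : IsLeastKey n lam Q (s.ra raBest (e.eval s)) (s.a aBest (e.eval s))) :
    WP W (takeMin e) s fun t s' => t ≤ 3 * e.cost + 8 ∧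
      IsLeastKey n lam (P ∪ Q) (s'.r rBest) (s'.w wBest) := by
  simp only [takeMin, wp_cond, Test.holds, Test.cost, wp_seq, wp_rset, wp_set, wp_skip,
    RExp.eval, RExp.cost, WExp.eval, WExp.cost, WExp.eval_setR, State.setR_a, State.setR_r,
    State.setW_r, State.setW_w, if_true]
  exact ⟨fun hlt => ⟨hb.a _ _, by omega, hP.union_right hQ hlt.le⟩,
    fun hle => ⟨by omega, hP.union_left hQ (not_lt.1 hle)⟩⟩

/-- Starts the computation of a least key with the current cell. -/
def startMin : Cmd := .cond (.lt (.const 0) (.arr aCount (.var wCell)))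
  (.rset rBest (.sub (.add (.ofWord (.var wA)) (.mul (.var rLam) (.ofWord (.var wB))))
    (.ofWord (.var wN +ₑ .var wN))) ;; .set wBest (.var wCell))
  (.rset rBest (.ofWord (.const 0)) ;; .set wBest (.const 0))

/-- The machine has selected the cell `q`. -/
structure AtCell (n : ℕ) (q : ℕ × ℕ) (s : State) : Prop where
  fst_eq : s.w wA = q.1
  snd_eq : s.w wB = q.2
  cell_eq : s.w wCell = cell n q
  fst_lt : q.1 < n
  snd_lt : q.2 < n

theorem wp_startMin (hlam : lam ≤ 1) (hs : HoldsInput off nb n lam W s) (hq : AtCell n q s) :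
    WP W startMin s fun t s' => t ≤ 20 ∧
      IsLeastKey n lam ({q} ∩ occupied n (s.a aCount)) (s'.r rBest) (s'.w wBest) := by
  have hcell := hs.bdd.w wCell
  simp only [startMin, wp_cond, Test.holds, Test.cost, wp_seq, wp_rset, wp_set, RExp.eval,
    RExp.cost, WExp.eval, WExp.cost, State.setR_w, State.setR_r, State.setW_r, State.setW_w,
    if_true, hq.fst_eq, hq.snd_eq, hq.cell_eq, hs.n_eq, hs.lam_eq] at hcell ⊢
  refine ⟨fun hpos => ⟨hcell, by omega, ?_⟩, fun hzero => ⟨by omega, by omega, ?_⟩⟩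
  · have hocc : q ∈ occupied n (s.a aCount) := ⟨hq.snd_lt.le, hpos⟩
    rw [Set.inter_eq_left.2 (Set.singleton_subset_iff.2 hocc)]
    exact isLeastKey_singleton (cellKey_neg hlam hq.fst_lt hq.snd_lt).le
  · rw [Set.singleton_inter_eq_empty.2 fun h => hzero h.2, Nat.cast_zero]
    exact isLeastKey_empty n lam 0

/-- Computes the least key in the subtree of the current cell from those stored at its children. -/
def findMin : Cmd :=
  startMin ;; takeMin (.var wCell +ₑ (.var wN +ₑ .const 1)) ;;
  .cond (.eq (.var wA) (.const 0)) (takeMin (.var wCell +ₑ .const 1)) .skip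

theorem wp_findMin (hlam : lam ≤ 1) (hs : HoldsInput off nb n lam W s) (hq : AtCell n q s)
    (hright : HoldsLeastKey n lam s (q.1 + 1, q.2))
    (hup : q.1 = 0 → HoldsLeastKey n lam s (q.1, q.2 + 1)) :
    WP W findMin s fun t s' => t ≤ 70 ∧
      IsLeastKey n lam (subtree q ∩ occupied n (s.a aCount)) (s'.r rBest) (s'.w wBest) := by
  have hcell_right : cell n q + (n + 1) = cell n (q.1 + 1, q.2) := by
    simp only [cell]
    ring
  have hcell_up : cell n q + 1 = cell n (q.1, q.2 + 1) := rfl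
  rw [findMin, wp_seq]
  refine (wp_startMin hlam hs hq).mono_frame fun t₁ s₁ ⟨_, hmin₁⟩ hf₁ => ?_
  have hs₁ := hs.frame hf₁ (by decide)
  rw [wp_seq]
  refine (wp_takeMin hs₁.bdd hmin₁ (Q := subtree (q.1 + 1, q.2) ∩ occupied n (s.a aCount))
    ?_).mono_frame fun t₂ s₂ ⟨ht₂, hmin₂⟩ hf₂ => ?_
  · simp only [WExp.eval, hs₁.n_eq, hf₁.w wCell rfl, hf₁.ra raBest rfl, hf₁.a aBest rfl,
      hq.cell_eq, hcell_right]
    exact hright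
  have hf := hf₁.seq_left.trans hf₂.seq_right
  rw [← Set.union_inter_distrib_right] at hmin₂
  simp only [WExp.cost] at ht₂
  simp only [wp_cond, wp_skip, Test.holds, Test.cost, WExp.eval, WExp.cost, hf.w wA rfl,
    hq.fst_eq]
  refine ⟨fun hzero => ?_, fun hne => ⟨by omega, subtree_of_ne_zero hne ▸ hmin₂⟩⟩
  refine (wp_takeMin (hf.bdd hs.bdd) hmin₂ (Q := subtree (q.1, q.2 + 1) ∩ occupied n (s.a aCount))
    ?_).mono fun t₃ s₃ ⟨ht₃, hmin₃⟩ => ?_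
  · simp only [WExp.eval, hf.w wCell rfl, hf.ra raBest rfl, hf.a aBest rfl, hq.cell_eq, hcell_up]
    exact hup hzero
  rw [← Set.union_inter_distrib_right, ← subtree_of_eq_zero hzero] at hmin₃
  simp only [WExp.cost] at ht₃
  exact ⟨by omega, hmin₃⟩

/-- Selects the ancestor of the key cell that is the given number of steps above it. -/
def selectAncestor : Cmd :=
  .set wA (.var wKeyA -ₑ .var wStep) ;; .set wB (.var wKeyB -ₑ (.var wStep -ₑ .var wKeyA)) ;;
  .set wCell (cellIndex (.var wA) (.var wB))

/-- Recomputes the least key stored at an ancestor of the key cell. -/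
def repairCell : Cmd :=
  selectAncestor ;; findMin ;; .rstore raBest (.var wCell) (.var rBest) ;;
  .store aBest (.var wCell) (.var wBest)

theorem wp_selectAncestor (hW : (n + 1) * (n + 1) ≤ W) (hs : HoldsInput off nb n lam W s)
    (hA : s.w wKeyA < n) (hB : s.w wKeyB < n) :
    WP W selectAncestor s fun t s' => t ≤ 25 ∧
      AtCell n (ancestor (s.w wKeyA, s.w wKeyB) (s.w wStep)) s' := by
  have hcell := cell_lt (n := n) (q := ancestor (s.w wKeyA, s.w wKeyB) (s.w wStep))
    ((Nat.sub_le _ _).trans_lt hA) ((Nat.sub_le _ _).trans hB.le)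
  have hn : n ≤ (n + 1) * (n + 1) := by nlinarith
  simp only [ancestor] at hcell ⊢
  simp only [selectAncestor, wp_seq, wp_set, cellIndex_eval, cellIndex_cost, WExp.eval, WExp.cost,
    State.setW_w, if_true, Nat.reduceEqDiff, if_false, hs.n_eq]
  refine ⟨by omega, by omega, by omega, by omega, ?_, ?_, ?_, ?_, ?_⟩ <;>
    simp only [State.setW_w, if_true, Nat.reduceEqDiff, if_false] <;> omega

theorem wp_repairCell (hlam : lam ≤ 1) (hW : (n + 1) * (n + 1) ≤ W)
    (hs : HoldsInput off nb n lam W s) (hA : s.w wKeyA < n) (hB : s.w wKeyB < n)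
    (hq : q = ancestor (s.w wKeyA, s.w wKeyB) (s.w wStep))
    (hright : HoldsLeastKey n lam s (q.1 + 1, q.2))
    (hup : q.1 = 0 → HoldsLeastKey n lam s (q.1, q.2 + 1)) :
    WP W repairCell s fun t s' => t ≤ 110 ∧ HoldsLeastKey n lam s' q ∧
      ∀ p, p ≠ q → p.2 ≤ n → HoldsLeastKey n lam s p → HoldsLeastKey n lam s' p := by
  rw [repairCell, wp_seq]
  refine (wp_selectAncestor hW hs hA hB).mono_frame fun t₁ s₁ ⟨_, hat⟩ hf₁ => ?_
  rw [← hq] at hat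
  have hs₁ := hs.frame hf₁ (by decide)
  rw [wp_seq]
  refine (wp_findMin hlam hs₁ hat (hright.frame hf₁ (by decide)) fun h =>
    (hup h).frame hf₁ (by decide)).mono_frame fun t₂ s₂ ⟨_, hmin⟩ hf₂ => ?_
  have hf := hf₁.seq_left.trans hf₂.seq_right
  have hcell : s₂.w wCell = cell n q := (hf₂.w wCell rfl).trans hat.cell_eq
  rw [hf₁.a aCount rfl] at hmin
  simp only [wp_seq, wp_rstore, wp_store, WExp.eval, WExp.cost, RExp.eval, RExp.cost,
    State.setRA_w, hcell]
  refine ⟨(hf.bdd hs.bdd).w wBest, by omega, ?_, fun p hpq hp h => ?_⟩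
  · simpa only [HoldsLeastKey, State.setA_a_self, State.setA_ra, State.setRA_ra_self,
      State.setRA_a, Function.update_self, State.setA_a_of_ne, Nat.reduceEqDiff, ne_eq,
      not_false_eq_true, hf.a aCount rfl] using hmin
  · have hne : cell n p ≠ cell n q := mt (cell_inj hp hat.snd_lt.le).1 hpq
    simpa only [HoldsLeastKey, State.setA_a_self, State.setA_ra, State.setRA_ra_self,
      State.setRA_a, Function.update_of_ne hne, State.setA_a_of_ne, Nat.reduceEqDiff, ne_eq,
      not_false_eq_true, hf.a aCount rfl, hf.a aBest rfl, hf.ra raBest rfl] using h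

/-- Recomputes the least keys on the path from the key cell to the root. -/
def repair : Cmd :=
  .set wSteps (.var wKeyA +ₑ .var wKeyB +ₑ .const 1) ;; upTo wStep wSteps repairCell

theorem wp_repair (hlam : lam ≤ 1) (hW : (n + 1) * (n + 1) ≤ W)
    (hs : HoldsInput off nb n lam W s) (hA : s.w wKeyA < n) (hB : s.w wKeyB < n)
    (h : ∀ p, p.2 ≤ n → (s.w wKeyA, s.w wKeyB) ∉ subtree p → HoldsLeastKey n lam s p) :
    WP W repair s fun t s' => t ≤ 150 * (s.w wKeyA + s.w wKeyB + 1) ∧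
      ∀ p, p.2 ≤ n → HoldsLeastKey n lam s' p := by
  set q := (s.w wKeyA, s.w wKeyB)
  have hN : s.w wKeyA + s.w wKeyB + 1 < W := by nlinarith
  rw [repair, wp_seq]
  simp only [wp_set, WExp.eval, WExp.cost]
  refine ⟨hN, ?_⟩
  have hf₀ : Frame W repair s (s.setW wSteps _) := (frame_set hN).seq_left
  refine wp_upTo (N := s.w wKeyA + s.w wKeyB + 1)
    (fun i s' => ∀ p, p.2 ≤ n → (∀ j, i ≤ j → j ≤ s.w wKeyA + s.w wKeyB → p ≠ ancestor q j) →
      HoldsLeastKey n lam s' p) (fun _ => 110) rfl rfl (by decide) (hs.bdd.setW hN) rfl ?_ ?_ ?_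
  · intro p hp hne
    refine h p hp fun hmem => ?_
    obtain ⟨i, hi, hpi⟩ := exists_eq_ancestor hmem
    exact hne i (Nat.zero_le i) hi hpi
  · intro i s₁ _ hf hx hI
    have hf := hf₀.trans hf.seq_right
    have hchild (p : ℕ × ℕ) (hp : p.2 ≤ n)
        (hlt : (ancestor q i).1 + (ancestor q i).2 < p.1 + p.2) : HoldsLeastKey n lam s₁ p := by
      refine hI p hp fun j hj _ heq => ?_
      simp only [heq, ancestor] at hlt
      omega
    have hsnd : (ancestor q i).2 < n := (Nat.sub_le _ _).trans_lt hB
    refine (wp_repairCell hlam hW (hs.frame hf (by decide)) (hf.w wKeyA rfl ▸ hA)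
      (hf.w wKeyB rfl ▸ hB) (q := ancestor q i)
      (by rw [hf.w wKeyA rfl, hf.w wKeyB rfl, hx])
      (hchild _ hsnd.le (by simp only; omega)) fun _ => hchild _ hsnd (by simp only; omega)).mono
      fun t s₂ ⟨ht, hself, hother⟩ => ⟨ht, fun p hp hne => ?_⟩
    by_cases hpi : p = ancestor q i
    · exact hpi ▸ hself
    · refine hother p hpi hp (hI p hp fun j hj hj' => ?_)
      obtain rfl | hlt := hj.eq_or_lt
      exacts [hpi, hne j hlt hj']
  · intro t s' ht _ hI
    rw [Finset.sum_const, Finset.card_range, smul_eq_mul] at ht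
    exact ⟨by omega, fun p hp => hI p hp fun j hj hj' => by omega⟩

end Repair

/-! ## The priority queue -/

local notation "aStrong" => 18
local notation "aWeakDeg" => 19
local notation "wVertex" => 20
local notation "aMember" => 21
local notation "aPos" => 22
local notation "wMoved" => 29

section BijOn

variable {α : Type*} [DecidableEq α] {S : Set α} {f : α → ℕ} {a l : α} {k : ℕ}

theorem bijOn_update_insert (h : Set.BijOn f S (Set.Iio k)) (ha : a ∉ S) :
    Set.BijOn (Function.update f a k) (insert a S) (Set.Iio (k + 1)) := by
  have hins := (h.congr fun v hv => (Function.update_of_ne (ne_of_mem_of_not_mem hv ha) k f).symm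
    ).insert (a := a) (by simp)
  rwa [Function.update_self, ← Order.Iio_succ_eq_insert] at hins

theorem bijOn_update_sdiff (h : Set.BijOn f S (Set.Iio k)) (ha : a ∈ S) (hl : l ∈ S)
    (hlast : f l + 1 = k) :
    Set.BijOn (Function.update f l (f a)) (S \ {a}) (Set.Iio (k - 1)) := by
  have hswap : Set.BijOn (f ∘ Equiv.swap a l) S (Set.Iio k) :=
    h.comp (Equiv.bijOn_swap ha hl)
  have hdiff := hswap.sdiff_singleton ha
  rw [Function.comp_apply, Equiv.swap_apply_left] at hdiff
  have hIio : Set.Iio k \ {f l} = Set.Iio (k - 1) := by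
    ext i
    simp only [Set.mem_sdiff, Set.mem_Iio, Set.mem_singleton_iff]
    omega
  refine hIio ▸ hdiff.congr fun v hv => ?_
  by_cases hvl : v = l
  · rw [hvl, Function.update_self, Function.comp_apply, Equiv.swap_apply_right]
  · rw [Function.update_of_ne hvl, Function.comp_apply, Equiv.swap_apply_of_ne_of_ne hv.2 hvl]

end BijOn

section Filed

variable {n : ℕ} {R : Finset (Fin n)} {key key' : Fin n → ℕ × ℕ} {count member : ℕ → ℕ}
  {pos : Fin n → ℕ} {u v l : Fin n} {q : ℕ × ℕ}

/-- The vertices of `R` are filed in the cells of their keys: `count` holds the sizes of the cells,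
`member` their members, and `pos` the position of each vertex in its cell. -/
structure IsFiled (R : Finset (Fin n)) (key : Fin n → ℕ × ℕ) (count member : ℕ → ℕ)
    (pos : Fin n → ℕ) : Prop where
  key_lt : ∀ v ∈ R, (key v).1 < n ∧ (key v).2 < n
  bijOn : ∀ q, q.2 ≤ n → Set.BijOn pos {v | v ∈ R ∧ key v = q} (Set.Iio (count (cell n q)))
  member_eq : ∀ v ∈ R, member (cell n (cell n (key v), pos v)) = v

namespace IsFiled

theorem bijOn_key (h : IsFiled R key count member pos) (hv : v ∈ R) :
    Set.BijOn pos {x | x ∈ R ∧ key x = key v} (Set.Iio (count (cell n (key v)))) :=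
  h.bijOn _ (h.key_lt v hv).2.le

theorem count_le (h : IsFiled R key count member pos) (hq : q.2 ≤ n) : count (cell n q) ≤ n := by
  have hcard := (h.bijOn q hq).injOn.ncard_image
  rw [(h.bijOn q hq).image_eq, ← Finset.coe_Iio, Set.ncard_coe_finset, Nat.card_Iio] at hcard
  rw [hcard]
  exact (Set.ncard_le_card _).trans_eq (Nat.card_fin n)

theorem pos_lt (h : IsFiled R key count member pos) (hv : v ∈ R) :
    pos v < count (cell n (key v)) :=
  (h.bijOn_key hv).mapsTo ⟨hv, rfl⟩

theorem pos_le (h : IsFiled R key count member pos) (hv : v ∈ R) : pos v ≤ n :=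
  (h.pos_lt hv).le.trans (h.count_le (h.key_lt v hv).2.le)

theorem congr_key (h : IsFiled R key count member pos) (hkey : ∀ v ∈ R, key' v = key v) :
    IsFiled R key' count member pos := by
  refine ⟨fun v hv => hkey v hv ▸ h.key_lt v hv, fun q hq => ?_,
    fun v hv => hkey v hv ▸ h.member_eq v hv⟩
  have hset : {v | v ∈ R ∧ key' v = q} = {v | v ∈ R ∧ key v = q} :=
    Set.ext fun v => and_congr_right fun hv => by rw [hkey v hv]
  exact hset ▸ h.bijOn q hq

theorem insert (h : IsFiled R key count member pos) (hu : u ∉ R)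
    (hkey : (key u).1 < n ∧ (key u).2 < n) :
    IsFiled (insert u R) key
      (Function.update count (cell n (key u)) (count (cell n (key u)) + 1))
      (Function.update member (cell n (cell n (key u), count (cell n (key u)))) u)
      (Function.update pos u (count (cell n (key u)))) := by
  refine ⟨(Finset.forall_mem_insert _ _ _).2 ⟨hkey, h.key_lt⟩, fun q hq => ?_,
    (Finset.forall_mem_insert _ _ _).2 ⟨?_, fun v hv => ?_⟩⟩
  · by_cases hqu : key u = q
    · subst hqu
      have hset : {v | v ∈ Insert.insert u R ∧ key v = key u} =
          Insert.insert u {v | v ∈ R ∧ key v = key u} := by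
        ext v
        aesop
      rw [hset, Function.update_self]
      exact bijOn_update_insert (h.bijOn _ hq) fun hmem => hu hmem.1
    · have hset : {v | v ∈ Insert.insert u R ∧ key v = q} = {v | v ∈ R ∧ key v = q} := by
        ext v
        aesop
      rw [hset, Function.update_of_ne (mt (cell_inj hq hkey.2.le).1 (Ne.symm hqu))]
      exact (h.bijOn q hq).congr fun v hv =>
        (Function.update_of_ne (ne_of_mem_of_not_mem hv.1 hu) _ _).symm
  · rw [Function.update_self, Function.update_self]
  · rw [Function.update_of_ne (ne_of_mem_of_not_mem hv hu), Function.update_of_ne, h.member_eq v hv]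
    rw [Ne, cell_inj (h.pos_le hv) (h.count_le hkey.2.le), Prod.mk.injEq]
    rintro ⟨hcell, hpos⟩
    exact (hpos ▸ hcell ▸ h.pos_lt hv).false

theorem exists_last (h : IsFiled R key count member pos) (hu : u ∈ R) :
    ∃ l ∈ R, key l = key u ∧ pos l + 1 = count (cell n (key u)) := by
  have hpos := h.pos_lt hu
  obtain ⟨l, ⟨hl, hkey⟩, hlast⟩ := (h.bijOn_key hu).surjOn
    (show count (cell n (key u)) - 1 ∈ Set.Iio (count (cell n (key u))) from
      Nat.sub_lt (by omega) one_pos)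
  exact ⟨l, hl, hkey, by omega⟩

theorem erase (h : IsFiled R key count member pos) (hu : u ∈ R) (hl : l ∈ R)
    (hkey : key l = key u) (hlast : pos l + 1 = count (cell n (key u))) :
    IsFiled (R.erase u) key
      (Function.update count (cell n (key u)) (count (cell n (key u)) - 1))
      (Function.update member (cell n (cell n (key u), pos u)) l)
      (Function.update pos l (pos u)) := by
  refine ⟨fun v hv => h.key_lt v (Finset.mem_of_mem_erase hv), fun q hq => ?_, fun v hv => ?_⟩
  · by_cases hqu : key u = q
    · subst hqu
      have hset : {v | v ∈ R.erase u ∧ key v = key u} = {v | v ∈ R ∧ key v = key u} \ {u} := by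
        ext v
        aesop
      rw [hset, Function.update_self]
      exact bijOn_update_sdiff (h.bijOn _ hq) ⟨hu, rfl⟩ ⟨hl, hkey⟩ hlast
    · have hset : {v | v ∈ R.erase u ∧ key v = q} = {v | v ∈ R ∧ key v = q} := by
        ext v
        aesop
      rw [hset, Function.update_of_ne (mt (cell_inj hq (h.key_lt u hu).2.le).1 (Ne.symm hqu))]
      refine (h.bijOn q hq).congr fun v hv => (Function.update_of_ne ?_ _ _).symm
      rintro rfl
      exact hqu (hkey.symm.trans hv.2)
  · obtain ⟨hvu, hv⟩ := Finset.mem_erase.1 hv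
    by_cases hvl : v = l
    · rw [hvl, Function.update_self, hkey, Function.update_self]
    · rw [Function.update_of_ne hvl, Function.update_of_ne, h.member_eq v hv]
      intro heq
      refine hvu (Fin.ext ?_)
      rw [← h.member_eq v hv, heq, h.member_eq u hu]

end IsFiled

end Filed

section Queue

variable {n W : ℕ} {lam : ℝ} {off nb : ℕ → ℕ} {R : Finset (Fin n)} {s : State} {u : Fin n}

/-- The key of a vertex: its numbers of strong and of weak remaining neighbours. -/
def vertexKey (s : State) (v : Fin n) : ℕ × ℕ := (s.a aStrong v, s.a aWeakDeg v)

theorem vertexKey_eq_of_frame {c : Cmd} {s' : State} (hf : Frame W c s s')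
    (hc : ∀ l ∈ [.wordArray aStrong, .wordArray aWeakDeg], c.writes l = false) :
    vertexKey s' u = vertexKey s u := by
  rw [vertexKey, hf.a aStrong (hc _ (by simp)), hf.a aWeakDeg (hc _ (by simp)), vertexKey]

/-- The machine holds a priority queue for the vertices of `R`. -/
structure HoldsQueue (lam : ℝ) (R : Finset (Fin n)) (s : State) : Prop where
  filed : IsFiled R (vertexKey s) (s.a aCount) (s.a aMember) fun v => s.a aPos v
  least : ∀ q, q.2 ≤ n → HoldsLeastKey n lam s q

theorem HoldsQueue.frame {c : Cmd} {s' : State} (h : HoldsQueue lam R s) (hf : Frame W c s s')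
    (hc : ∀ l ∈ [.wordArray aCount, .wordArray aMember, .wordArray aPos, .wordArray aBest,
      .realArray raBest], c.writes l = false)
    (hkey : ∀ v ∈ R, vertexKey s' v = vertexKey s v) : HoldsQueue lam R s' := by
  refine ⟨?_, fun q hq => (h.least q hq).frame hf fun l hl => hc l (by aesop)⟩
  rw [hf.a aCount (hc _ (by simp)), hf.a aMember (hc _ (by simp)), hf.a aPos (hc _ (by simp))]
  exact h.filed.congr_key hkey

theorem HoldsQueue.exists_min (h : HoldsQueue lam R s) (hlam : lam ≤ 1) (hR : R.Nonempty) :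
    ∃ v ∈ R, s.a aMember (s.a aBest 0 * (n + 1)) = v ∧ ∀ x ∈ R,
      cellKey n lam (vertexKey s v) ≤ cellKey n lam (vertexKey s x) := by
  have hroot := h.least (0, 0) (Nat.zero_le n)
  have hzero : cell n (0, 0) = 0 := by simp [cell]
  rw [HoldsLeastKey, hzero] at hroot
  have hlower : ∀ x ∈ R, s.ra raBest 0 ≤ cellKey n lam (vertexKey s x) := fun x hx =>
    hroot.lower _ ⟨Or.inl ⟨rfl, Nat.zero_le _⟩, (h.filed.key_lt x hx).2.le,
      (Nat.zero_le _).trans_lt (h.filed.pos_lt hx)⟩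
  obtain ⟨x, hx⟩ := hR
  obtain ⟨hxa, hxb⟩ := h.filed.key_lt x hx
  obtain ⟨q, ⟨-, hq, hpos⟩, hcell, hval⟩ :=
    hroot.attained ((hlower x hx).trans_lt (cellKey_neg hlam hxa hxb))
  obtain ⟨v, ⟨hv, rfl⟩, hv₀⟩ := (h.filed.bijOn q hq).surjOn (Set.mem_Iio.2 hpos)
  refine ⟨v, hv, ?_, fun y hy => hval ▸ hlower y hy⟩
  rw [← h.filed.member_eq v hv, ← hcell]
  exact congrArg (fun i => s.a aMember (s.a aBest 0 * (n + 1) + i)) hv₀.symm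

/-- Finds the cell of the queue vertex. -/
def locate : Cmd :=
  .set wKeyA (.arr aStrong (.var wVertex)) ;; .set wKeyB (.arr aWeakDeg (.var wVertex)) ;;
  .set wCell (cellIndex (.var wKeyA) (.var wKeyB))

/-- The machine has found the cell of the queue vertex `u`. -/
structure AtVertex (n : ℕ) (u : Fin n) (s : State) : Prop where
  vertex_eq : s.w wVertex = u
  key_eq : (s.w wKeyA, s.w wKeyB) = vertexKey s u
  cell_eq : s.w wCell = cell n (vertexKey s u)

theorem wp_locate (hW : (n + 1) * (n + 1) ≤ W) (hs : HoldsInput off nb n lam W s)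
    (hu : s.w wVertex = u) (hkey : (vertexKey s u).1 < n ∧ (vertexKey s u).2 < n) :
    WP W locate s fun t s' => t ≤ 20 ∧ AtVertex n u s' := by
  have hcell := cell_lt hkey.1 hkey.2.le
  simp only [vertexKey] at hcell
  simp only [locate, wp_seq, wp_set, cellIndex_eval, cellIndex_cost, WExp.eval, WExp.cost,
    State.setW_w, State.setW_a, if_true, Nat.reduceEqDiff, if_false, hs.n_eq, hu]
  refine ⟨hs.bdd.a _ _, hs.bdd.a _ _, by omega, by omega, ?_, ?_, ?_⟩ <;>
    simp only [State.setW_w, if_true, Nat.reduceEqDiff, if_false, vertexKey, State.setW_a, hu]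

/-- Appends the queue vertex to its cell. -/
def appendMember : Cmd :=
  .store aMember (cellIndex (.var wCell) (.arr aCount (.var wCell))) (.var wVertex) ;;
  .store aPos (.var wVertex) (.arr aCount (.var wCell)) ;;
  .store aCount (.var wCell) (.arr aCount (.var wCell) +ₑ .const 1)

theorem HoldsLeastKey.of_update_count {s' : State} {p q : ℕ × ℕ} {k : ℕ}
    (h : HoldsLeastKey n lam s p) (hq : q.2 ≤ n) (hp : q ∉ subtree p)
    (hcount : s'.a aCount = Function.update (s.a aCount) (cell n q) k)
    (hbest : s'.a aBest = s.a aBest) (hbest' : s'.ra raBest = s.ra raBest) :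
    HoldsLeastKey n lam s' p := by
  rwa [HoldsLeastKey, hcount, hbest, hbest', inter_occupied_update hq hp]

theorem update_coe_fin {f : ℕ → ℕ} {k : ℕ} :
    (fun v : Fin n => Function.update f u k v) = Function.update (fun v : Fin n => f v) u k :=
  Function.update_comp_eq_of_injective f Fin.val_injective u k

theorem wp_appendMember (hW : (n + 1) * (n + 1) ≤ W) (hs : HoldsInput off nb n lam W s)
    (hu : AtVertex n u s) (hkey : (vertexKey s u).1 < n ∧ (vertexKey s u).2 < n) (huR : u ∉ R)
    (h : HoldsQueue lam R s) :
    WP W appendMember s fun t s' => t ≤ 30 ∧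
      IsFiled (insert u R) (vertexKey s) (s'.a aCount) (s'.a aMember) (fun v => s'.a aPos v) ∧
      ∀ p, p.2 ≤ n → vertexKey s u ∉ subtree p → HoldsLeastKey n lam s' p := by
  have hcount : s.a aCount (cell n (vertexKey s u)) ≤ n := h.filed.count_le hkey.2.le
  have hn : n + 1 < W := by nlinarith
  simp only [appendMember, wp_seq, wp_store, cellIndex_eval, cellIndex_cost, WExp.eval, WExp.cost,
    State.setA_w, State.setA_a_of_ne, Nat.reduceEqDiff, ne_eq, not_false_eq_true, hu.cell_eq,
    hu.vertex_eq, hs.n_eq]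
  refine ⟨hu.vertex_eq ▸ hs.bdd.w wVertex, by omega, by omega, by omega, ?_, fun p hp hup => ?_⟩
  · simpa only [State.setA_a_self, State.setA_a_of_ne, Nat.reduceEqDiff, ne_eq,
      not_false_eq_true, update_coe_fin] using h.filed.insert huR hkey
  · refine (h.least p hp).of_update_count (k := s.a aCount (cell n (vertexKey s u)) + 1)
      hkey.2.le hup ?_ ?_ ?_ <;>
      simp only [State.setA_a_self, State.setA_a_of_ne, State.setA_ra, Nat.reduceEqDiff, ne_eq,
        not_false_eq_true]

/-- Removes the queue vertex from its cell: the last member of the cell takes its position. -/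
def removeMember : Cmd :=
  .store aCount (.var wCell) (.arr aCount (.var wCell) -ₑ .const 1) ;;
  .set wMoved (.arr aMember (cellIndex (.var wCell) (.arr aCount (.var wCell)))) ;;
  .store aMember (cellIndex (.var wCell) (.arr aPos (.var wVertex))) (.var wMoved) ;;
  .store aPos (.var wMoved) (.arr aPos (.var wVertex))

theorem wp_removeMember (hs : HoldsInput off nb n lam W s) (hu : AtVertex n u s) (huR : u ∈ R)
    (h : HoldsQueue lam R s) :
    WP W removeMember s fun t s' => t ≤ 40 ∧
      IsFiled (R.erase u) (vertexKey s) (s'.a aCount) (s'.a aMember) (fun v => s'.a aPos v) ∧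
      ∀ p, p.2 ≤ n → vertexKey s u ∉ subtree p → HoldsLeastKey n lam s' p := by
  obtain ⟨l, hl, hkey, hlast⟩ := h.filed.exists_last huR
  have hmoved : s.a aMember (cell n (cell n (vertexKey s u),
      s.a aCount (cell n (vertexKey s u)) - 1)) = l := by
    rw [← h.filed.member_eq l hl, hkey, ← hlast, Nat.add_sub_cancel]
  have hcount := hs.bdd.a aCount (cell n (vertexKey s u))
  simp only [removeMember, wp_seq, wp_set, wp_store, cellIndex_eval, cellIndex_cost, WExp.eval,
    WExp.cost, State.setA_w, State.setW_w, State.setW_a, if_true, if_false, State.setA_a_self,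
    Function.update_self, State.setA_a_of_ne, Nat.reduceEqDiff, ne_eq, not_false_eq_true,
    hu.cell_eq, hu.vertex_eq, hs.n_eq, hmoved]
  have hl_lt : (l : ℕ) < W := hmoved ▸ hs.bdd.a aMember _
  refine ⟨by omega, hl_lt, hl_lt, hs.bdd.a aPos u, by omega, ?_, fun p hp hup => ?_⟩
  · simpa only [State.setA_a_self, State.setA_a_of_ne, State.setW_a, Nat.reduceEqDiff, ne_eq,
      not_false_eq_true, update_coe_fin] using h.filed.erase huR hl hkey hlast
  · refine (h.least p hp).of_update_count (k := s.a aCount (cell n (vertexKey s u)) - 1)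
      (h.filed.key_lt u huR).2.le hup ?_ ?_ ?_ <;>
      simp only [State.setA_a_self, State.setA_a_of_ne, State.setA_ra, State.setW_a, State.setW_ra,
        Nat.reduceEqDiff, ne_eq, not_false_eq_true]

/-- Puts the queue vertex into the queue. -/
def enqueue : Cmd := locate ;; appendMember ;; repair

/-- Takes the queue vertex out of the queue. -/
def dequeue : Cmd := locate ;; removeMember ;; repair

theorem wp_repairQueue (hlam : lam ≤ 1) (hW : (n + 1) * (n + 1) ≤ W)
    (hs : HoldsInput off nb n lam W s) (hkey : (vertexKey s u).1 < n ∧ (vertexKey s u).2 < n)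
    (hu : (s.w wKeyA, s.w wKeyB) = vertexKey s u)
    (hfiled : IsFiled R (vertexKey s) (s.a aCount) (s.a aMember) fun v => s.a aPos v)
    (hleast : ∀ p, p.2 ≤ n → vertexKey s u ∉ subtree p → HoldsLeastKey n lam s p) :
    WP W repair s fun t s' => t ≤ 150 * ((vertexKey s u).1 + (vertexKey s u).2 + 1) ∧
      HoldsQueue lam R s' := by
  rw [← hu] at hkey hleast ⊢
  refine (wp_repair hlam hW hs hkey.1 hkey.2 hleast).mono_frame
    fun t s' ⟨ht, hleast'⟩ hf => ⟨ht, ?_, hleast'⟩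
  rw [hf.a aCount rfl, hf.a aMember rfl, hf.a aPos rfl]
  exact hfiled.congr_key fun v _ => vertexKey_eq_of_frame hf (by decide)

theorem wp_enqueue (hlam : lam ≤ 1) (hW : (n + 1) * (n + 1) ≤ W)
    (hs : HoldsInput off nb n lam W s) (hu : s.w wVertex = u)
    (hkey : (vertexKey s u).1 < n ∧ (vertexKey s u).2 < n) (huR : u ∉ R)
    (h : HoldsQueue lam R s) :
    WP W enqueue s fun t s' => t ≤ 150 * ((vertexKey s u).1 + (vertexKey s u).2 + 1) + 50 ∧
      HoldsQueue lam (insert u R) s' := by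
  rw [enqueue, wp_seq]
  refine (wp_locate hW hs hu hkey).mono_frame fun t₁ s₁ ⟨_, hat⟩ hf₁ => ?_
  have hs₁ := hs.frame hf₁ (by decide)
  have hkey₁ (v : Fin n) : vertexKey s₁ v = vertexKey s v := vertexKey_eq_of_frame hf₁ (by decide)
  have h₁ := h.frame hf₁ (by decide) fun v _ => hkey₁ v
  rw [← hkey₁] at hkey ⊢
  rw [wp_seq]
  refine (wp_appendMember hW hs₁ hat hkey huR h₁).mono_frame
    fun t₂ s₂ ⟨_, hfiled, hleast⟩ hf₂ => ?_
  have hkey₂ (v : Fin n) : vertexKey s₂ v = vertexKey s₁ v := vertexKey_eq_of_frame hf₂ (by decide)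
  rw [← hkey₂] at hkey ⊢
  refine (wp_repairQueue hlam hW (hs₁.frame hf₂ (by decide)) hkey ?_
    (hfiled.congr_key fun v _ => hkey₂ v) (hkey₂ u ▸ hleast)).mono
    fun t₃ s₃ ⟨_, hqueue⟩ => ⟨by omega, hqueue⟩
  rw [hf₂.w wKeyA rfl, hf₂.w wKeyB rfl, hkey₂]
  exact hat.key_eq

theorem wp_dequeue (hlam : lam ≤ 1) (hW : (n + 1) * (n + 1) ≤ W)
    (hs : HoldsInput off nb n lam W s) (hu : s.w wVertex = u) (huR : u ∈ R)
    (h : HoldsQueue lam R s) :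
    WP W dequeue s fun t s' => t ≤ 150 * ((vertexKey s u).1 + (vertexKey s u).2 + 1) + 60 ∧
      HoldsQueue lam (R.erase u) s' := by
  have hkey := h.filed.key_lt u huR
  rw [dequeue, wp_seq]
  refine (wp_locate hW hs hu hkey).mono_frame fun t₁ s₁ ⟨_, hat⟩ hf₁ => ?_
  have hs₁ := hs.frame hf₁ (by decide)
  have hkey₁ (v : Fin n) : vertexKey s₁ v = vertexKey s v := vertexKey_eq_of_frame hf₁ (by decide)
  have h₁ := h.frame hf₁ (by decide) fun v _ => hkey₁ v
  rw [← hkey₁] at hkey ⊢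
  rw [wp_seq]
  refine (wp_removeMember hs₁ hat huR h₁).mono_frame fun t₂ s₂ ⟨_, hfiled, hleast⟩ hf₂ => ?_
  have hkey₂ (v : Fin n) : vertexKey s₂ v = vertexKey s₁ v := vertexKey_eq_of_frame hf₂ (by decide)
  rw [← hkey₂] at hkey ⊢
  refine (wp_repairQueue hlam hW (hs₁.frame hf₂ (by decide)) hkey ?_
    (hfiled.congr_key fun v _ => hkey₂ v) (hkey₂ u ▸ hleast)).mono
    fun t₃ s₃ ⟨_, hqueue⟩ => ⟨by omega, hqueue⟩
  rw [hf₂.w wKeyA rfl, hf₂.w wKeyB rfl, hkey₂]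
  exact hat.key_eq

end Queue

/-! ## Weighted degrees -/

local notation "raWeight" => 0

section DegKey

variable {n : ℕ} {G : SimpleGraph (Fin n)} {weak : Set (Sym2 (Fin n))} {R : Finset (Fin n)}
  {D : Finset (Fin n × Fin n)} {u v : Fin n}

open Classical in
/-- The key of an edge: `(1, 0)` for a strong edge and `(0, 1)` for a weak one, so that the key
`(a, b)` stands for the weight `a + lam * b`. -/
noncomputable def edgeKey (weak : Set (Sym2 (Fin n))) (e : Sym2 (Fin n)) : ℕ × ℕ :=
  if e ∈ weak then (0, 1) else (1, 0)

theorem edgeKey_fst_add_snd (weak : Set (Sym2 (Fin n))) (e : Sym2 (Fin n)) :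
    (edgeKey weak e).1 + (edgeKey weak e).2 = 1 := by
  rw [edgeKey]
  split_ifs <;> rfl

theorem indicator_eq_edgeKey_snd (weak : Set (Sym2 (Fin n))) (e : Sym2 (Fin n)) :
    weak.indicator (fun _ => 1) e = (edgeKey weak e).2 := by
  by_cases he : e ∈ weak <;> simp [edgeKey, he]

theorem one_sub_edgeKey_snd (weak : Set (Sym2 (Fin n))) (e : Sym2 (Fin n)) :
    1 - (edgeKey weak e).2 = (edgeKey weak e).1 := by
  have := edgeKey_fst_add_snd weak e
  omega

theorem weight_eq_edgeKey (weak : Set (Sym2 (Fin n))) (lam : ℝ) (e : Sym2 (Fin n)) :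
    weight weak lam e = (edgeKey weak e).1 + lam * (edgeKey weak e).2 := by
  rw [weight, edgeKey]
  split_ifs <;> simp

open Classical in
/-- The weighted degree as a key: the numbers of strong and of weak edges that join `v` to a vertex
of `R`. -/
noncomputable def degKey (G : SimpleGraph (Fin n)) (weak : Set (Sym2 (Fin n)))
    (R : Finset (Fin n)) (v : Fin n) : ℕ × ℕ :=
  ∑ u ∈ R with G.Adj v u, edgeKey weak s(v, u)

theorem degKey_fst_add_snd_le (G : SimpleGraph (Fin n)) (weak : Set (Sym2 (Fin n)))
    (R : Finset (Fin n)) (v : Fin n) :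
    (degKey G weak R v).1 + (degKey G weak R v).2 ≤ (nbrs G v).card := by
  classical
  simp only [degKey, Prod.fst_sum, Prod.snd_sum, ← Finset.sum_add_distrib, edgeKey_fst_add_snd,
    ← Finset.card_eq_sum_ones]
  exact Finset.card_le_card fun u hu => mem_nbrs.2 (Finset.mem_filter.1 hu).2

theorem degKey_erase_of_adj (hu : u ∈ R) (hadj : G.Adj v u) :
    degKey G weak (R.erase u) v + edgeKey weak s(v, u) = degKey G weak R v := by
  classical
  rw [degKey, degKey, Finset.filter_erase, Finset.sum_erase_add]
  exact Finset.mem_filter.2 ⟨hu, hadj⟩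

theorem degKey_erase_of_not_adj (hadj : ¬ G.Adj v u) :
    degKey G weak (R.erase u) v = degKey G weak R v := by
  classical
  rw [degKey, degKey, Finset.filter_erase, Finset.erase_eq_of_notMem]
  exact fun hu => hadj (Finset.mem_filter.1 hu).2

theorem wdeg_eq_degKey (G : SimpleGraph (Fin n)) (weak : Set (Sym2 (Fin n))) (lam : ℝ)
    (R : Finset (Fin n)) (v : Fin n) :
    wdeg G (weight weak lam) R v = (degKey G weak R v).1 + lam * (degKey G weak R v).2 := by
  simp only [wdeg, degKey, weight_eq_edgeKey, Finset.sum_add_distrib, Finset.mul_sum, Prod.fst_sum,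
    Prod.snd_sum, Nat.cast_sum]

/-- The sum of the keys of the edges that arcs of `D` from `u` stand for. -/
noncomputable def arcKey (weak : Set (Sym2 (Fin n))) (D : Finset (Fin n × Fin n)) (u : Fin n) :
    ℕ × ℕ :=
  ∑ a ∈ D, if a.1 = u then edgeKey weak s(a.1, a.2) else 0

theorem arcKey_arcs (G : SimpleGraph (Fin n)) (weak : Set (Sym2 (Fin n))) (u : Fin n) :
    arcKey weak (arcs G) u = degKey G weak Finset.univ u := by
  classical
  rw [arcKey, sum_arcs fun x y => if x = u then edgeKey weak s(x, y) else 0,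
    Finset.sum_eq_single u (fun x _ hx => by simp [hx]) (by simp)]
  simp [degKey, nbrs]

theorem arcKey_lt (hD : D ⊆ arcs G) (weak : Set (Sym2 (Fin n))) (u : Fin n) :
    (arcKey weak D u).1 < n ∧ (arcKey weak D u).2 < n := by
  have hle : arcKey weak D u ≤ degKey G weak Finset.univ u :=
    arcKey_arcs G weak u ▸ Finset.sum_le_sum_of_subset hD
  have := hle.1
  have := hle.2
  have := degKey_fst_add_snd_le G weak Finset.univ u
  have := card_nbrs_lt (G := G) u
  omega

theorem arcKey_insert (huv : (u, v) ∉ D) :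
    arcKey weak (insert (u, v) D) =
      Function.update (arcKey weak D) u (arcKey weak D u + edgeKey weak s(u, v)) := by
  funext w
  simp only [arcKey, Finset.sum_insert huv, Function.update_apply, eq_comm (a := u)]
  split_ifs with h
  · rw [h, add_comm]
  · rw [zero_add]

end DegKey

section InitDegrees

variable {n : ℕ} {G : SimpleGraph (Fin n)} {off nb : ℕ → ℕ} {W : ℕ} {lam : ℝ} {s : State}
  {weak : Set (Sym2 (Fin n))} {D : Finset (Fin n × Fin n)} {u v : Fin n}

/-- Counts the current arc as a strong or as a weak one and writes its weight. -/
def countArc : Cmd :=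
  .rstore raWeight (.var wPos) (.sub (.ofWord (.const 1))
    (.mul (.ofWord (.arr aWeak (pairIndex wU wV))) (.sub (.ofWord (.const 1)) (.var rLam)))) ;;
  .store aStrong (.var wU) (.arr aStrong (.var wU) +ₑ (.const 1 -ₑ .arr aWeak (pairIndex wU wV))) ;;
  .store aWeakDeg (.var wU) (.arr aWeakDeg (.var wU) +ₑ .arr aWeak (pairIndex wU wV))

/-- The arcs of `D` have been counted and their weights have been written. -/
structure HoldsArcKeys (off nb : ℕ → ℕ) (lam : ℝ) (weak : Set (Sym2 (Fin n)))
    (D : Finset (Fin n × Fin n)) (s : State) : Prop where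
  weights : ∀ u v, (u, v) ∈ D → ∀ p, IsEntry off nb u v p →
    s.ra raWeight p = weight weak lam s(u, v)
  keys : vertexKey s = arcKey weak D

theorem wp_countArc (hG : IsInput G off nb) (hadj : G.Adj u v) (hD : D ⊆ arcs G) (huv : (u, v) ∉ D)
    (hweak : IsEdgeMatrix weak (s.a aWeak)) (hs : AtArc off nb n lam W u v s)
    (h : HoldsArcKeys off nb lam weak D s) :
    WP W countArc s fun t s' => t ≤ 50 ∧ HoldsArcKeys off nb lam weak (insert (u, v) D) s' := by
  have hn := hs.n_eq ▸ hs.bdd.w wN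
  obtain ⟨hstrong, hweakDeg⟩ :=
    arcKey_lt (Finset.insert_subset (mem_arcs (a := (u, v)).2 hadj) hD) weak u
  rw [arcKey_insert huv, Function.update_self, ← h.keys] at hstrong hweakDeg
  simp only [countArc, wp_seq, wp_store, wp_rstore, WExp.eval, WExp.cost, RExp.eval, RExp.cost,
    pairIndex_eval, pairIndex_cost, State.setRA_w, State.setRA_a, State.setA_w, State.setA_a_of_ne,
    Nat.reduceEqDiff, ne_eq, not_false_eq_true, hs.u_eq, hs.v_eq, hs.n_eq, hs.lam_eq, hweak u v,
    indicator_eq_edgeKey_snd, one_sub_edgeKey_snd]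
  refine ⟨hstrong.trans hn, hweakDeg.trans hn, by omega, fun u' v' huv' p hp => ?_, ?_⟩
  · simp only [State.setA_ra, State.setRA_ra_self]
    rcases eq_or_ne p (s.w wPos) with rfl | hne
    · obtain ⟨rfl, rfl⟩ := hs.entry.eq_of_eq hG hp
      rw [Function.update_self, weight, edgeKey]
      split_ifs <;> simp
    · rw [Function.update_of_ne hne]
      refine h.weights u' v' ((Finset.mem_insert.1 huv').resolve_left ?_) p hp
      rintro ⟨rfl, rfl⟩
      exact hne (hp.unique hG hadj hs.entry)
  · rw [arcKey_insert huv, ← h.keys]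
    funext w
    rcases eq_or_ne w u with rfl | hne
    · simp [vertexKey, Prod.ext_iff]
    · simp [vertexKey, hne, Fin.val_inj]

/-- Computes the edge weights and the numbers of strong and of weak edges at every vertex. -/
def initDegrees : Cmd := eachArc countArc

theorem wp_initDegrees (hG : IsInput G off nb) (hs : HoldsInput off nb n lam W s)
    (hweak : IsEdgeMatrix weak (s.a aWeak)) (hkey : ∀ u : Fin n, vertexKey s u = 0) :
    WP W initDegrees s fun t s' => t ≤ ∑ u, (∑ _v ∈ nbrs G u, 60 + 18) + 5 ∧
      IsEdgeArray G off nb (weight weak lam) (s'.ra raWeight) ∧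
      ∀ u, vertexKey s' u = degKey G weak Finset.univ u := by
  refine wp_eachArc hG (HoldsArcKeys off nb lam weak) (fun _ _ => 50) (by decide) (by decide) hs
    (fun D s₁ s₂ heq h => ⟨heq.ra ▸ h.weights, ?_⟩) ⟨by simp, funext hkey⟩ ?_ ?_
  · rw [← h.keys]
    exact funext fun u => by rw [vertexKey, vertexKey, heq.a]
  · intro D u v s₁ hD hadj huv hf hat h
    exact wp_countArc hG hadj hD huv (hf.a aWeak rfl ▸ hweak) hat h
  · exact fun t s' ht _ _ h => ⟨ht, fun u v huv p hp hp' hnb =>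
      h.weights u v (mem_arcs.2 huv) p ⟨hp, hp', hnb⟩, fun u => h.keys ▸ arcKey_arcs G weak u⟩

theorem holdsQueue_empty (hcount : ∀ i, s.a aCount i = 0) (hbest : ∀ i, s.ra raBest i = 0) :
    HoldsQueue lam (∅ : Finset (Fin n)) s := by
  refine ⟨⟨by simp, fun q _ => by simp [hcount], by simp⟩, fun q _ => ?_⟩
  have hempty : subtree q ∩ occupied n (s.a aCount) = ∅ := by
    ext p
    simp [occupied, hcount]
  rw [HoldsLeastKey, hempty, hbest]
  exact isLeastKey_empty n lam _

/-- Puts all vertices into the queue. -/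
def fillQueue : Cmd := upTo wU wN (.set wVertex (.var wU) ;; enqueue)

theorem filter_lt_succ (u : Fin n) :
    (Finset.univ.filter fun v : Fin n => (v : ℕ) < u + 1) =
      insert u (Finset.univ.filter fun v : Fin n => (v : ℕ) < u) := by
  ext v
  simp only [Finset.mem_filter, Finset.mem_univ, true_and, Finset.mem_insert, Fin.ext_iff]
  omega

theorem wp_fillQueue (hlam : lam ≤ 1) (hW : (n + 1) * (n + 1) ≤ W)
    (hs : HoldsInput off nb n lam W s)
    (hkey : ∀ u : Fin n, (vertexKey s u).1 + (vertexKey s u).2 ≤ (nbrs G u).card)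
    (hcount : ∀ i, s.a aCount i = 0) (hbest : ∀ i, s.ra raBest i = 0) :
    WP W fillQueue s fun t s' => t ≤ ∑ u, (150 * ((nbrs G u).card + 1) + 60) + 5 ∧
      HoldsQueue lam (Finset.univ : Finset (Fin n)) s' := by
  refine wp_upTo (N := n)
    (fun i s => HoldsQueue lam (Finset.univ.filter fun v : Fin n => (v : ℕ) < i) s)
    (fun i => 150 * (degAt G i + 1) + 53) rfl rfl (by decide) hs.bdd hs.n_eq ?_ ?_ ?_
  · have h := holdsQueue_empty (n := n) (lam := lam) hcount hbest
    simpa using (⟨h.filed, h.least⟩ : HoldsQueue lam ∅ (s.setW wU 0))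
  · intro i s₁ hi hf hU h
    lift i to Fin n using hi with u
    have hu : (u : ℕ) < W := hU ▸ (hf.bdd hs.bdd).w wU
    have hf₁ : Frame W (.set wVertex (.var wU)) s₁ (s₁.setW wVertex u) := frame_set hu
    have hs₁ := (hs.frame hf (by decide)).frame hf₁ (by decide)
    have hkey₁ (v : Fin n) : vertexKey (s₁.setW wVertex u) v = vertexKey s v :=
      vertexKey_eq_of_frame (s' := s₁) hf (by decide)
    have hkey_u := hkey u
    have hcard := card_nbrs_lt (G := G) u
    simp only [wp_seq, wp_set, WExp.eval, WExp.cost, hU]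
    refine ⟨hu, (wp_enqueue (u := u) hlam hW hs₁ (by simp only [State.setW_w, if_true]) ?_ (by simp)
      (h.frame hf₁ (by decide) fun v _ => vertexKey_eq_of_frame hf₁ (by decide))).mono
      fun t s₂ ⟨ht, h₂⟩ => ⟨?_, ?_⟩⟩
    · rw [hkey₁]
      omega
    · rw [hkey₁] at ht
      rw [degAt_coe]
      omega
    · rw [filter_lt_succ]
      exact ⟨h₂.filed, h₂.least⟩
  · intro t s' ht _ h
    rw [← Fin.sum_univ_eq_sum_range (fun i => 150 * (degAt G i + 1) + 53 + 7)] at ht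
    exact ⟨by simpa only [degAt_coe] using ht, by simpa using h⟩

end InitDegrees

/-! ## Peeling -/

local notation "wRound" => 18
local notation "aOrder" => 7
local notation "aRemoved" => 24
local notation "raKey" => 2

section DecreaseKey

variable {n W : ℕ} {G : SimpleGraph (Fin n)} {off nb : ℕ → ℕ} {lam : ℝ} {s : State}
  {weak : Set (Sym2 (Fin n))} {R : Finset (Fin n)} {u v : Fin n}

/-- Subtracts the key of the edge between `wU` and `wV` from the key of `wV`. -/
def subtractKey : Cmd :=
  .store aStrong (.var wV) (.arr aStrong (.var wV) -ₑ (.const 1 -ₑ .arr aWeak (pairIndex wU wV))) ;;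
  .store aWeakDeg (.var wV) (.arr aWeakDeg (.var wV) -ₑ .arr aWeak (pairIndex wU wV))

theorem wp_subtractKey (hs : HoldsInput off nb n lam W s)
    (hweak : IsEdgeMatrix weak (s.a aWeak)) (hu : s.w wU = u) (hv : s.w wV = v) :
    WP W subtractKey s fun t s' => t ≤ 30 ∧
      vertexKey s' = Function.update (vertexKey s) v (vertexKey s v - edgeKey weak s(v, u)) := by
  simp only [subtractKey, wp_seq, wp_store, WExp.eval, WExp.cost, pairIndex_eval, pairIndex_cost,
    State.setA_w, State.setA_a_of_ne, Nat.reduceEqDiff, ne_eq, not_false_eq_true, hu, hv, hs.n_eq,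
    hweak u v, indicator_eq_edgeKey_snd, one_sub_edgeKey_snd]
  refine ⟨(Nat.sub_le _ _).trans_lt (hs.bdd.a _ _), (Nat.sub_le _ _).trans_lt (hs.bdd.a _ _),
    by omega, funext fun w => ?_⟩
  rw [Sym2.eq_swap]
  rcases eq_or_ne w v with rfl | hne
  · simp [vertexKey, Prod.ext_iff]
  · simp [vertexKey, hne, Fin.val_inj]

/-- Subtracts the key of the edge between `wU` and `wV` from the key of the queued vertex `wV`. -/
def decreaseKey : Cmd := .set wVertex (.var wV) ;; dequeue ;; subtractKey ;; enqueue

theorem wp_decreaseKey (hlam : lam ≤ 1) (hW : (n + 1) * (n + 1) ≤ W)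
    (hs : HoldsInput off nb n lam W s) (hweak : IsEdgeMatrix weak (s.a aWeak))
    (hu : s.w wU = u) (hv : s.w wV = v) (hvR : v ∈ R) (h : HoldsQueue lam R s) :
    WP W decreaseKey s fun t s' =>
      t ≤ 300 * ((vertexKey s v).1 + (vertexKey s v).2 + 1) + 150 ∧ HoldsQueue lam R s' ∧
      vertexKey s' = Function.update (vertexKey s) v (vertexKey s v - edgeKey weak s(v, u)) := by
  have hvW : (v : ℕ) < W := hv ▸ hs.bdd.w wV
  have hf₀ : Frame W (.set wVertex (.var wV)) s (s.setW wVertex v) := frame_set hvW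
  simp only [decreaseKey, wp_seq, wp_set, WExp.eval, WExp.cost, hv]
  have hs₀ := hs.frame hf₀ (by decide)
  refine ⟨hvW, (wp_dequeue (u := v) hlam hW hs₀ (by simp only [State.setW_w, if_true]) hvR
    ⟨h.filed, h.least⟩).mono_frame fun t₁ s₁ ⟨ht₁, h₁⟩ hf₁ => ?_⟩
  have hf₀₁ := hf₀.seq_left.trans hf₁.seq_right
  have hkey₁ : vertexKey (n := n) s₁ = vertexKey s :=
    funext fun w => vertexKey_eq_of_frame hf₀₁ (by decide)
  have hs₁ := hs₀.frame hf₁ (by decide)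
  refine (wp_subtractKey hs₁ (hf₀₁.a aWeak rfl ▸ hweak) ((hf₀₁.w wU rfl).trans hu)
    ((hf₀₁.w wV rfl).trans hv)).mono_frame fun t₂ s₂ ⟨ht₂, hkey₂⟩ hf₂ => ?_
  rw [hkey₁] at hkey₂
  have hlt := h.filed.key_lt v hvR
  have h₂ : HoldsQueue lam (R.erase v) s₂ := h₁.frame hf₂ (by decide) fun w hw => by
    rw [hkey₁, hkey₂, Function.update_of_ne (Finset.ne_of_mem_erase hw)]
  have hkey_v : vertexKey s₂ v = vertexKey s v - edgeKey weak s(v, u) := by simp [hkey₂]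
  refine (wp_enqueue (u := v) hlam hW (hs₁.frame hf₂ (by decide)) ?_ ?_ (by simp) h₂).mono_frame
    fun t₃ s₃ ⟨ht₃, h₃⟩ hf₃ => ⟨?_, Finset.insert_erase hvR ▸ h₃, ?_⟩
  · rw [hf₂.w wVertex rfl, hf₁.w wVertex rfl, State.setW_w, if_pos rfl]
  · rw [hkey_v]
    exact ⟨(Nat.sub_le _ _).trans_lt hlt.1, (Nat.sub_le _ _).trans_lt hlt.2⟩
  · rw [hkey_v, Prod.fst_sub, Prod.snd_sub] at ht₃
    rw [show vertexKey (s.setW wVertex v) v = vertexKey s v from rfl] at ht₁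
    omega
  · rw [← hkey₂]
    exact funext fun w => vertexKey_eq_of_frame hf₃ (by decide)

/-- Decreases the keys of the remaining neighbours of `wU`. -/
def decreaseAll : Cmd := eachNb wU wPos wEnd wV
  (.cond (.eq (.arr aRemoved (.var wV)) (.const 0)) decreaseKey .skip)

/-- The queue of the remaining vertices `R` during the removal of `u`, when the keys of the
neighbours in `P` have been decreased. -/
structure HoldsDecreased (G : SimpleGraph (Fin n)) (weak : Set (Sym2 (Fin n))) (lam : ℝ)
    (R : Finset (Fin n)) (u : Fin n) (P : Finset (Fin n)) (s : State) : Prop where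
  queue : HoldsQueue lam (R.erase u) s
  key_of_mem : ∀ v ∈ R.erase u, v ∈ P → vertexKey s v = degKey G weak (R.erase u) v
  key_of_notMem : ∀ v ∈ R.erase u, v ∉ P → vertexKey s v = degKey G weak R v

theorem HoldsDecreased.insert_of_notMem {P : Finset (Fin n)} (hv : v ∉ R.erase u)
    (h : HoldsDecreased G weak lam R u P s) : HoldsDecreased G weak lam R u (insert v P) s := by
  refine ⟨h.queue, fun w hw hwP => h.key_of_mem w hw ?_, fun w hw hwP => h.key_of_notMem w hw ?_⟩
  · exact (Finset.mem_insert.1 hwP).resolve_left fun hwv => hv (hwv ▸ hw)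
  · exact fun hwP' => hwP (Finset.mem_insert_of_mem hwP')

theorem HoldsDecreased.insert_of_adj {P : Finset (Fin n)} {s' : State} (hu : u ∈ R)
    (hadj : G.Adj u v) (hvP : v ∉ P) (hv : v ∈ R.erase u) (h : HoldsDecreased G weak lam R u P s)
    (hqueue : HoldsQueue lam (R.erase u) s')
    (hkey : vertexKey s' = Function.update (vertexKey s) v (vertexKey s v - edgeKey weak s(v, u))) :
    HoldsDecreased G weak lam R u (insert v P) s' := by
  refine ⟨hqueue, fun w hw hwP => ?_, fun w hw hwP => ?_⟩
  · rw [hkey]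
    rcases eq_or_ne w v with rfl | hne
    · rw [Function.update_self, h.key_of_notMem w hw hvP, ← degKey_erase_of_adj hu hadj.symm,
        add_tsub_cancel_right]
    · rw [Function.update_of_ne hne]
      exact h.key_of_mem w hw ((Finset.mem_insert.1 hwP).resolve_left hne)
  · have hne : w ≠ v := fun hwv => hwP (hwv ▸ Finset.mem_insert_self v P)
    rw [hkey, Function.update_of_ne hne]
    exact h.key_of_notMem w hw fun hwP' => hwP (Finset.mem_insert_of_mem hwP')

theorem wp_decreaseAll (hG : IsInput G off nb) (hlam : lam ≤ 1) (hW : (n + 1) * (n + 1) ≤ W)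
    (hs : HoldsInput off nb n lam W s) (hweak : IsEdgeMatrix weak (s.a aWeak))
    (hu : s.w wU = u) (huR : u ∈ R) (hqueue : HoldsQueue lam (R.erase u) s)
    (hkey : ∀ v ∈ R.erase u, vertexKey s v = degKey G weak R v)
    (hremoved : ∀ v : Fin n, s.a aRemoved v = 0 ↔ v ∈ R.erase u) :
    WP W decreaseAll s fun t s' =>
      t ≤ ∑ v ∈ nbrs G u, (300 * (nbrs G v).card + 500) + 11 ∧ HoldsQueue lam (R.erase u) s' ∧
      ∀ v ∈ R.erase u, vertexKey s' v = degKey G weak (R.erase u) v := by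
  refine wp_eachNb hG u (HoldsDecreased G weak lam R u) (fun v => 300 * (nbrs G v).card + 490)
    (by decide) (by decide) hs.bdd hs.off_eq hs.nb_eq hu ?_
    ⟨hqueue, by simp, fun v hv _ => hkey v hv⟩ ?_ ?_
  · rintro P s₁ s₂ heq ⟨h, h', h''⟩
    have hkey_eq : vertexKey (n := n) s₂ = vertexKey s₁ := by
      funext w
      rw [vertexKey, vertexKey, heq.a]
    refine ⟨⟨?_, fun q hq => ?_⟩, hkey_eq ▸ h', hkey_eq ▸ h''⟩
    · rw [hkey_eq, heq.a]
      exact h.filed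
    · rw [HoldsLeastKey, heq.a, heq.ra]
      exact h.least q hq
  · intro P v s₁ _ hadj hvP hf hv _ h
    simp only [wp_cond, Test.holds, WExp.eval, Test.cost, WExp.cost, hv, hf.a aRemoved rfl,
      hremoved v, wp_skip]
    refine ⟨fun hvR => (wp_decreaseKey hlam hW (hs.frame hf (by decide)) (hf.a aWeak rfl ▸ hweak)
      ((hf.w wU rfl).trans hu) hv hvR h.queue).mono fun t s₂ ⟨_, hqueue₂, hkey₂⟩ =>
        ⟨?_, h.insert_of_adj huR hadj hvP hvR hqueue₂ hkey₂⟩,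
      fun hvR => ⟨by omega, h.insert_of_notMem hvR⟩⟩
    have hcard := degKey_fst_add_snd_le G weak R v
    rw [← h.key_of_notMem v hvR hvP] at hcard
    omega
  · intro t s' ht _ h
    refine ⟨ht, h.queue, fun v hv => ?_⟩
    by_cases hadj : G.Adj u v
    · exact h.key_of_mem v hv (mem_nbrs.2 hadj)
    · rw [degKey_erase_of_not_adj fun hvu => hadj hvu.symm]
      exact h.key_of_notMem v hv fun hvP => hadj (mem_nbrs.1 hvP)

end DecreaseKey

section Peeling

variable {n : ℕ} {G : SimpleGraph (Fin n)} {w : Sym2 (Fin n) → ℝ} {f g : ℕ → ℕ} {k : ℕ → ℝ}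
  {i j : ℕ} {v : Fin n}

/-- The vertices that are left after the removal of `f 0, …, f (i - 1)`. -/
def unremoved (f : ℕ → ℕ) (i : ℕ) : Finset (Fin n) :=
  Finset.univ.filter fun v => ∀ j < i, f j ≠ v

@[simp] theorem mem_unremoved : v ∈ unremoved f i ↔ ∀ j < i, f j ≠ v := by
  simp [unremoved]

@[simp] theorem unremoved_zero : unremoved f 0 = (Finset.univ : Finset (Fin n)) := by
  simp [unremoved]

theorem unremoved_succ (h : f i = v) : unremoved f (i + 1) = (unremoved f i).erase v := by
  ext x
  simp only [mem_unremoved, Finset.mem_erase, Nat.forall_lt_succ_right, h, ne_eq, Fin.val_inj]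
  rw [and_comm, eq_comm]

theorem unremoved_congr (h : ∀ j < i, f j = g j) :
    (unremoved f i : Finset (Fin n)) = unremoved g i := by
  ext x
  simp only [mem_unremoved]
  exact forall₂_congr fun j hj => by rw [h j hj]

/-- In each of the first `i` rounds `j`, the vertex `f j` of minimum weighted degree `k j` is
removed. -/
def IsPeeling (G : SimpleGraph (Fin n)) (w : Sym2 (Fin n) → ℝ) (f : ℕ → ℕ) (k : ℕ → ℝ) (i : ℕ) :
    Prop :=
  ∀ j < i, ∃ v ∈ unremoved f j, f j = v ∧ k j = wdeg G w (unremoved f j) v ∧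
    ∀ x ∈ unremoved f j, wdeg G w (unremoved f j) v ≤ wdeg G w (unremoved f j) x

theorem IsPeeling.card_unremoved (h : IsPeeling G w f k i) (hj : j ≤ i) :
    (unremoved f j : Finset (Fin n)).card = n - j := by
  induction j with
  | zero => simp
  | succ j ih =>
    obtain ⟨v, hv, hfv, _⟩ := h j hj
    rw [unremoved_succ hfv, Finset.card_erase_of_mem hv, ih (by omega)]
    omega

theorem unremoved_update (f : ℕ → ℕ) (a : ℕ) (hj : j ≤ i) :
    (unremoved (Function.update f i a) j : Finset (Fin n)) = unremoved f j :=
  unremoved_congr fun l hl => Function.update_of_ne (by omega) _ _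

theorem unremoved_update_succ (f : ℕ → ℕ) (i : ℕ) (v : Fin n) :
    unremoved (Function.update f i (v : ℕ)) (i + 1) = (unremoved f i).erase v := by
  rw [unremoved_succ (Function.update_self i (v : ℕ) f), unremoved_update f v le_rfl]

theorem IsPeeling.update (h : IsPeeling G w f k i) (hv : v ∈ unremoved f i)
    (hmin : ∀ x ∈ unremoved f i, wdeg G w (unremoved f i) v ≤ wdeg G w (unremoved f i) x) :
    IsPeeling G w (Function.update f i v)
      (Function.update k i (wdeg G w (unremoved f i) v)) (i + 1) := by
  intro j hj
  rw [unremoved_update f v (Nat.lt_succ_iff.1 hj)]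
  rcases Nat.lt_succ_iff_lt_or_eq.1 hj with hj | rfl
  · simpa only [Function.update_of_ne hj.ne] using h j hj
  · exact ⟨v, hv, Function.update_self .., Function.update_self .., hmin⟩

end Peeling

section Peel

variable {n W : ℕ} {G : SimpleGraph (Fin n)} {off nb : ℕ → ℕ} {lam : ℝ} {s : State}
  {weak : Set (Sym2 (Fin n))} {R : Finset (Fin n)} {i : ℕ} {v : Fin n}

/-- The state of the peeling when the vertices of `R` are left. -/
structure HoldsPeeling (G : SimpleGraph (Fin n)) (weak : Set (Sym2 (Fin n))) (lam : ℝ)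
    (R : Finset (Fin n)) (s : State) : Prop where
  queue : HoldsQueue lam R s
  key_eq : ∀ v ∈ R, vertexKey s v = degKey G weak R v
  removed : ∀ v : Fin n, s.a aRemoved v = 0 ↔ v ∈ R

theorem HoldsPeeling.exists_min (h : HoldsPeeling G weak lam R s) (hlam : lam ≤ 1)
    (hR : R.Nonempty) : ∃ v ∈ R, s.a aMember (s.a aBest 0 * (n + 1)) = v ∧
      s.a aStrong v + lam * s.a aWeakDeg v = wdeg G (weight weak lam) R v ∧
      ∀ x ∈ R, wdeg G (weight weak lam) R v ≤ wdeg G (weight weak lam) R x := by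
  obtain ⟨v, hv, hval, hmin⟩ := h.queue.exists_min hlam hR
  have hwdeg : ∀ x ∈ R, ((vertexKey s x).1 + lam * (vertexKey s x).2 : ℝ) =
      wdeg G (weight weak lam) R x := fun x hx => by rw [wdeg_eq_degKey, h.key_eq x hx]
  refine ⟨v, hv, hval, hwdeg v hv, fun x hx => ?_⟩
  rw [← hwdeg v hv, ← hwdeg x hx]
  exact sub_le_sub_iff_right _ |>.1 (hmin x hx)

/-- Selects a queued vertex of minimum weighted degree and records its removal. -/
def selectMin : Cmd :=
  .set wVertex (.arr aMember (.arr aBest (.const 0) *ₑ (.var wN +ₑ .const 1))) ;;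
  .set wU (.var wVertex) ;;
  .store aOrder (.var wRound) (.var wVertex) ;;
  .rstore raKey (.var wRound) (.add (.ofWord (.arr aStrong (.var wVertex)))
    (.mul (.var rLam) (.ofWord (.arr aWeakDeg (.var wVertex))))) ;;
  .store aRemoved (.var wVertex) (.const 1)

/-- In round `i` the vertex `v` is removed; `R` are the vertices that were left in state `s`. -/
structure RecordsRemoval (G : SimpleGraph (Fin n)) (weak : Set (Sym2 (Fin n))) (lam : ℝ)
    (R : Finset (Fin n)) (i : ℕ) (v : Fin n) (s s' : State) : Prop where
  mem : v ∈ R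
  min : ∀ x ∈ R, wdeg G (weight weak lam) R v ≤ wdeg G (weight weak lam) R x
  order_eq : s'.a aOrder = Function.update (s.a aOrder) i v
  key_eq : s'.ra raKey = Function.update (s.ra raKey) i (wdeg G (weight weak lam) R v)

theorem wp_selectMin (hlam : lam ≤ 1) (hW : 1 < W) (hs : HoldsInput off nb n lam W s)
    (hR : R.Nonempty) (h : HoldsPeeling G weak lam R s) (hi : s.w wRound = i) :
    WP W selectMin s fun t s' => t ≤ 50 ∧ ∃ v, RecordsRemoval G weak lam R i v s s' ∧
      s'.w wVertex = v ∧ s'.w wU = v ∧ ∀ x : Fin n, s'.a aRemoved x = 0 ↔ x ∈ R.erase v := by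
  obtain ⟨v, hv, hval, hwdeg, hmin⟩ := h.exists_min hlam hR
  have hvW : (v : ℕ) < W := hval ▸ hs.bdd.a _ _
  simp only [selectMin, wp_seq, wp_set, wp_store, wp_rstore, WExp.eval, WExp.cost, RExp.eval,
    RExp.cost, hs.n_eq, hval, State.setW_w, State.setW_a, State.setW_r, State.setA_w, State.setA_r,
    State.setRA_w, State.setA_a_of_ne, Nat.reduceEqDiff, ne_eq, not_false_eq_true, if_true,
    if_false, hi, hs.lam_eq, hwdeg]
  refine ⟨hvW, hvW, hvW, hW, by omega, v, ⟨hv, hmin, ?_, ?_⟩, rfl, rfl, fun x => ?_⟩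
  · simp only [State.setA_a_self, State.setA_a_of_ne, State.setRA_a, State.setW_a,
      Nat.reduceEqDiff, ne_eq, not_false_eq_true]
  · simp only [State.setA_ra, State.setRA_ra_self, State.setW_ra]
  · simp only [State.setA_a_self, State.setA_a_of_ne, State.setRA_a, State.setW_a,
      Nat.reduceEqDiff, ne_eq, not_false_eq_true, Function.update_apply, Fin.val_inj,
      Finset.mem_erase, ← h.removed x]
    split_ifs with hxv <;> simp [hxv]

/-- One round of the peeling. -/
def peelRound : Cmd := selectMin ;; dequeue ;; decreaseAll

/-- A bound for the time of the round that removes `v`. -/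
noncomputable def removalTime (G : SimpleGraph (Fin n)) (v : Fin n) : ℕ :=
  ∑ u ∈ nbrs G v, (300 * (nbrs G u).card + 500) + (150 * (nbrs G v).card + 300)

theorem wp_peelRound (hG : IsInput G off nb) (hlam : lam ≤ 1) (hW : (n + 1) * (n + 1) ≤ W)
    (hs : HoldsInput off nb n lam W s) (hweak : IsEdgeMatrix weak (s.a aWeak)) (hR : R.Nonempty)
    (h : HoldsPeeling G weak lam R s) (hi : s.w wRound = i) :
    WP W peelRound s fun t s' => ∃ v, t + 7 ≤ removalTime G v ∧
      RecordsRemoval G weak lam R i v s s' ∧ HoldsPeeling G weak lam (R.erase v) s' := by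
  have h1W : 1 < W := by
    have := hR.choose.pos
    nlinarith
  rw [peelRound, wp_seq]
  refine (wp_selectMin hlam h1W hs hR h hi).mono_frame
    fun t₁ s₁ ⟨_, v, hrec, hvertex, hu, hremoved⟩ hf₁ => ?_
  have hs₁ := hs.frame hf₁ (by decide)
  have hkey₁ (x : Fin n) : vertexKey s₁ x = vertexKey s x := vertexKey_eq_of_frame hf₁ (by decide)
  rw [wp_seq]
  refine (wp_dequeue (u := v) hlam hW hs₁ hvertex hrec.mem
    (h.queue.frame hf₁ (by decide) fun x _ => hkey₁ x)).mono_frame fun t₂ s₂ ⟨ht₂, h₂⟩ hf₂ => ?_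
  have hkey₂ (x : Fin n) : vertexKey s₂ x = vertexKey s x :=
    (vertexKey_eq_of_frame hf₂ (by decide)).trans (hkey₁ x)
  have hf₁₂ := hf₁.seq_left.trans hf₂.seq_right
  have hremoved₂ (x : Fin n) : s₂.a aRemoved x = 0 ↔ x ∈ R.erase v := by
    rw [hf₂.a aRemoved rfl, hremoved]
  refine (wp_decreaseAll hG hlam hW (hs₁.frame hf₂ (by decide)) (hf₁₂.a aWeak rfl ▸ hweak)
    ((hf₂.w wU rfl).trans hu) hrec.mem h₂ (fun x hx => ?_) hremoved₂).mono_frame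
    fun t₃ s₃ ⟨_, hqueue, hkey₃⟩ hf₃ => ⟨v, ?_, ⟨hrec.mem, hrec.min, ?_, ?_⟩, hqueue, hkey₃, ?_⟩
  · rw [hkey₂, h.key_eq x (Finset.mem_of_mem_erase hx)]
  · have hcard := degKey_fst_add_snd_le G weak R v
    rw [hkey₁, h.key_eq v hrec.mem] at ht₂
    rw [removalTime]
    omega
  · rw [hf₃.a aOrder rfl, hf₂.a aOrder rfl, hrec.order_eq]
  · rw [hf₃.ra raKey rfl, hf₂.ra raKey rfl, hrec.key_eq]
  · rw [hf₃.a aRemoved rfl]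
    exact hremoved₂

/-- Removes vertices of minimum weighted degree until none is left. -/
def peel : Cmd := upTo wRound wN peelRound

theorem wp_peel (hG : IsInput G off nb) (hlam : lam ≤ 1) (hW : (n + 1) * (n + 1) ≤ W)
    (hs : HoldsInput off nb n lam W s) (hweak : IsEdgeMatrix weak (s.a aWeak))
    (h : HoldsPeeling G weak lam Finset.univ s) :
    WP W peel s fun t s' => t ≤ ∑ v, removalTime G v + 5 ∧
      IsPeeling G (weight weak lam) (s'.a aOrder) (s'.ra raKey) n := by
  refine wp_upTo_time (N := n) (fun i t s =>
      t + ∑ v ∈ unremoved (s.a aOrder) i, removalTime G v ≤ ∑ v, removalTime G v ∧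
      HoldsPeeling G weak lam (unremoved (s.a aOrder) i) s ∧
      IsPeeling G (weight weak lam) (s.a aOrder) (s.ra raKey) i)
    rfl rfl (by decide) hs.bdd hs.n_eq ?_ ?_ ?_
  · simp only [unremoved_zero, zero_add, le_refl, true_and]
    exact ⟨⟨⟨h.queue.filed, h.queue.least⟩, h.key_eq, h.removed⟩, fun j hj => absurd hj (by omega)⟩
  · intro i t s₁ hi hf hround ⟨ht, hpeel, horder⟩
    have hne : (unremoved (s₁.a aOrder) i : Finset (Fin n)).Nonempty := by
      rw [← Finset.card_pos, horder.card_unremoved le_rfl]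
      omega
    refine (wp_peelRound hG hlam hW (hs.frame hf (by decide)) (hf.a aWeak rfl ▸ hweak) hne hpeel
      hround).mono fun t' s₂ ⟨v, ht', hrec, h₂⟩ => ?_
    rw [State.setW_a, State.setW_ra, hrec.order_eq, hrec.key_eq, unremoved_update_succ]
    refine ⟨?_, ⟨⟨h₂.queue.filed, h₂.queue.least⟩, h₂.key_eq, h₂.removed⟩,
      horder.update hrec.mem hrec.min⟩
    have := Finset.add_sum_erase _ (removalTime G) hrec.mem
    omega
  · exact fun t s' _ ⟨_, _, horder⟩ => ⟨by omega, horder⟩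

theorem sum_removalTime_le (G : SimpleGraph (Fin n)) :
    ∑ v, removalTime G v ≤ 1600 * size G := by
  have hsum : ∑ v, removalTime G v = ∑ v, (300 * (nbrs G v).card ^ 2 +
      (650 * (nbrs G v).card + 300)) := by
    simp only [removalTime, Finset.sum_add_distrib, ← Finset.mul_sum, ← Finset.sum_mul,
      sum_nbrs_card, Finset.sum_const, smul_eq_mul]
    ring
  rw [hsum]
  exact sum_le_size fun v => by nlinarith

end Peel

/-! ## The densest remaining set -/

local notation "wBestRound" => 30
local notation "wReverse" => 31
local notation "rSum" => 1
local notation "rDensity" => 2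

section Density

variable {n : ℕ} {G : SimpleGraph (Fin n)} {w : Sym2 (Fin n) → ℝ} {R : Finset (Fin n)} {v : Fin n}
  {f : ℕ → ℕ} {k : ℕ → ℝ} {i j : ℕ} {order : Equiv.Perm (Fin n)}

open Classical in
/-- The total weight of the edges inside `R`. -/
noncomputable def insideWeight (G : SimpleGraph (Fin n)) (w : Sym2 (Fin n) → ℝ)
    (R : Finset (Fin n)) : ℝ :=
  ∑ e ∈ (sub G R).edgeFinset, w e

theorem density_nonneg (hw : ∀ e, 0 ≤ w e) : 0 ≤ density G w R :=
  div_nonneg (Finset.sum_nonneg fun e _ => hw e) (Nat.cast_nonneg _)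

theorem insideWeight_empty : insideWeight G w ∅ = 0 := by
  refine Finset.sum_eq_zero fun e he => ?_
  induction e with
  | _ x y => simp at he

theorem edgeSet_sub_eq_union (hv : v ∈ R) :
    (sub G R).edgeSet = (sub G (R.erase v)).edgeSet ∪ (s(v, ·)) '' {u | u ∈ R ∧ G.Adj v u} := by
  ext e
  induction e with
  | _ x y =>
    simp only [SimpleGraph.mem_edgeSet, sub_adj, Set.mem_union, Finset.mem_erase, Set.mem_image,
      Set.mem_ofPred_eq, Sym2.eq_iff]
    constructor
    · rintro ⟨hxy, hx, hy⟩
      by_cases hxv : x = v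
      · exact .inr ⟨y, ⟨hy, hxv ▸ hxy⟩, .inl ⟨hxv.symm, rfl⟩⟩
      by_cases hyv : y = v
      · exact .inr ⟨x, ⟨hx, hyv ▸ hxy.symm⟩, .inr ⟨hyv.symm, rfl⟩⟩
      exact .inl ⟨hxy, ⟨hxv, hx⟩, hyv, hy⟩
    · rintro (⟨hxy, ⟨_, hx⟩, _, hy⟩ | ⟨u, ⟨hu, hvu⟩, ⟨rfl, rfl⟩ | ⟨rfl, rfl⟩⟩)
      exacts [⟨hxy, hx, hy⟩, ⟨hvu, hv, hu⟩, ⟨hvu.symm, hu, hv⟩]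

theorem insideWeight_eq_erase_add_wdeg (hv : v ∈ R) :
    insideWeight G w R = insideWeight G w (R.erase v) + wdeg G w R v := by
  classical
  have hinj : Set.InjOn (s(v, ·)) (R.filter fun u => G.Adj v u : Finset (Fin n)) :=
    fun x _ y _ h => Sym2.congr_right.1 h
  rw [insideWeight, insideWeight, wdeg, ← Finset.sum_image hinj, ← Finset.sum_union]
  · refine Finset.sum_congr (Finset.coe_injective ?_) fun _ _ => rfl
    simpa using edgeSet_sub_eq_union hv
  · rw [Finset.disjoint_left]
    rintro e he he'
    obtain ⟨u, _, rfl⟩ := Finset.mem_image.1 he'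
    simp at he

theorem IsPeeling.density_eq (h : IsPeeling G w f k i) (hj : j ≤ i) :
    density G w (unremoved f j) = insideWeight G w (unremoved f j) / (n - j : ℕ) := by
  rw [← h.card_unremoved hj]
  rfl

theorem IsPeeling.insideWeight_unremoved (h : IsPeeling G w f k i) (hj : j < i) :
    insideWeight G w (unremoved f j) = insideWeight G w (unremoved f (j + 1)) + k j := by
  obtain ⟨v, hv, hfv, hkv, _⟩ := h j hj
  rw [insideWeight_eq_erase_add_wdeg hv, unremoved_succ hfv, hkv]

theorem IsPeeling.exists_perm (h : IsPeeling G w f k n) :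
    ∃ order : Equiv.Perm (Fin n), ∀ i : Fin n, f i = order i := by
  choose g hg hfg _ using fun i : Fin n => h i i.2
  have hinj : Function.Injective g := .of_lt_imp_ne fun i j hij he =>
    mem_unremoved.1 (hg j) i hij (by rw [hfg i, he])
  exact ⟨Equiv.ofBijective g (Finite.injective_iff_bijective.1 hinj), hfg⟩

theorem unremoved_eq_remaining (h : ∀ i : Fin n, f i = order i) (hi : i ≤ n) :
    unremoved f i = remaining order i := by
  ext v
  simp only [mem_unremoved, remaining, Finset.mem_filter, Finset.mem_univ, true_and]
  constructor
  · intro hv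
    by_contra hlt
    exact hv _ (not_le.1 hlt) (by rw [h, Equiv.apply_symm_apply])
  · rintro hv j hj he
    rw [h ⟨j, hj.trans_le hi⟩, Fin.val_inj, ← Equiv.eq_symm_apply] at he
    rw [← he] at hv
    exact hj.not_ge hv

theorem IsPeeling.isPeelOrder (h : IsPeeling G w f k n) (horder : ∀ i : Fin n, f i = order i) :
    IsPeelOrder G w order := by
  intro i v hv
  obtain ⟨x, _, hfx, _, hmin⟩ := h i i.2
  rw [← unremoved_eq_remaining horder i.2.le] at hv ⊢
  rw [Fin.val_inj.1 ((horder i).symm.trans hfx)]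
  exact hmin v hv

/-- `r` is the maximum of the values `d l` for `j ≤ l < n`, attained at `b`. For `j = n` there is
no such value, and `r` is only required to be negative. -/
def IsMaxFrom (d : ℕ → ℝ) (n j b : ℕ) (r : ℝ) : Prop :=
  (∀ l ∈ Set.Ico j n, d l ≤ r) ∧ (r < 0 ∨ b ∈ Set.Ico j n ∧ d b = r)

variable {d : ℕ → ℝ} {b : ℕ} {r : ℝ}

theorem IsMaxFrom.of_lt (h : IsMaxFrom d n (j + 1) b r) (hj : j < n) (hlt : r < d j) :
    IsMaxFrom d n j j (d j) := by
  refine ⟨fun l ⟨hjl, hl⟩ => ?_, .inr ⟨⟨le_rfl, hj⟩, rfl⟩⟩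
  rcases hjl.eq_or_lt with rfl | hjl
  exacts [le_rfl, (h.1 l ⟨hjl, hl⟩).trans hlt.le]

theorem IsMaxFrom.of_le (h : IsMaxFrom d n (j + 1) b r) (hle : d j ≤ r) (hd : 0 ≤ d j) :
    IsMaxFrom d n j b r := by
  refine ⟨fun l ⟨hjl, hl⟩ => ?_, ?_⟩
  · rcases hjl.eq_or_lt with rfl | hjl
    exacts [hle, h.1 l ⟨hjl, hl⟩]
  · obtain ⟨hb, hdb⟩ := h.2.resolve_left (hd.trans hle).not_gt
    exact .inr ⟨⟨(Nat.le_succ j).trans hb.1, hb.2⟩, hdb⟩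

end Density

section BestSet

variable {n W : ℕ} {G : SimpleGraph (Fin n)} {off nb f : ℕ → ℕ} {lam : ℝ} {s : State}
  {w : Sym2 (Fin n) → ℝ} {j : ℕ}

/-- In round `i`, replaces the current best set by the one before round `n - 1 - i` of the peeling
if the latter is denser. -/
def improveBest : Cmd :=
  .set wReverse ((.var wN -ₑ .const 1) -ₑ .var wRound) ;;
  .rset rSum (.add (.var rSum) (.arr raKey (.var wReverse))) ;;
  .cond (.rlt (.var rDensity) (.div (.var rSum) (.ofWord (.var wRound +ₑ .const 1))))
    (.rset rDensity (.div (.var rSum) (.ofWord (.var wRound +ₑ .const 1))) ;;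
     .set wBestRound (.var wReverse))
    .skip

theorem wp_improveBest (hs : HoldsInput off nb n lam W s) (hw : ∀ e, 0 ≤ w e)
    (hpeel : IsPeeling G w f (s.ra raKey) n) (hj : s.w wRound + 1 = n - j) (hjn : j < n)
    (hsum : s.r rSum = insideWeight G w (unremoved f (j + 1)))
    (hmax : IsMaxFrom (fun l => density G w (unremoved f l)) n (j + 1) (s.w wBestRound)
      (s.r rDensity)) :
    WP W improveBest s fun t s' => t ≤ 40 ∧ s'.r rSum = insideWeight G w (unremoved f j) ∧
      IsMaxFrom (fun l => density G w (unremoved f l)) n j (s'.w wBestRound) (s'.r rDensity) := by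
  have hnW : n < W := hs.n_eq ▸ hs.bdd.w wN
  have hreverse : n - 1 - s.w wRound = j := by omega
  have hsum' : s.r rSum + s.ra raKey j = insideWeight G w (unremoved f j) := by
    rw [hsum, hpeel.insideWeight_unremoved hjn]
  have hdensity : insideWeight G w (unremoved f j) / ((n - j : ℕ) : ℝ) =
      density G w (unremoved f j) := (hpeel.density_eq hjn.le).symm
  simp only [improveBest, wp_seq, wp_set, wp_rset, wp_cond, wp_skip, Test.holds, RExp.eval,
    WExp.eval, RExp.cost, WExp.cost, Test.cost, State.setW_w, State.setW_r, State.setW_ra,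
    State.setR_w, State.setR_r, hs.n_eq, Nat.reduceEqDiff, if_true, if_false, hreverse, hsum', hj,
    hdensity]
  refine ⟨by omega, fun hlt => ⟨by omega, by omega, trivial, hmax.of_lt hjn hlt⟩,
    fun hle => ⟨by omega, trivial, hmax.of_le (not_lt.1 hle) (density_nonneg hw)⟩⟩

/-- Finds the round of the peeling before which the remaining set is a densest one. -/
def findBest : Cmd :=
  .rset rSum (.ofWord (.const 0)) ;;
  .rset rDensity (.sub (.ofWord (.const 0)) (.ofWord (.const 1))) ;;
  upTo wRound wN improveBest

theorem wp_findBest (hn : 1 ≤ n) (hs : HoldsInput off nb n lam W s) (hw : ∀ e, 0 ≤ w e)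
    (hpeel : IsPeeling G w (s.a aOrder) (s.ra raKey) n) :
    WP W findBest s fun t s' => t ≤ 60 * n + 20 ∧ s'.w wBestRound < n ∧
      ∀ j < n, density G w (unremoved (s.a aOrder) j) ≤
        density G w (unremoved (s.a aOrder) (s'.w wBestRound)) := by
  have hempty : (unremoved (s.a aOrder) n : Finset (Fin n)) = ∅ := by
    rw [← Finset.card_eq_zero, hpeel.card_unremoved le_rfl, Nat.sub_self]
  simp only [findBest, wp_seq, wp_rset, RExp.eval, RExp.cost, WExp.eval, WExp.cost]
  set s₀ := (s.setR rSum _).setR rDensity _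
  have hs₀ : HoldsInput off nb n lam W s₀ :=
    ⟨hs.n_eq, hs.off_eq, hs.nb_eq, hs.lam_eq, hs.bdd.w, hs.bdd.a⟩
  refine wp_upTo (fun i s₁ => s₁.r rSum = insideWeight G w (unremoved (s.a aOrder) (n - i)) ∧
      IsMaxFrom (fun l => density G w (unremoved (s.a aOrder) l)) n (n - i) (s₁.w wBestRound)
        (s₁.r rDensity))
    (fun _ => 40) rfl rfl (by decide) hs₀.bdd hs₀.n_eq ⟨?_, ?_, ?_⟩ ?_ ?_
  · simp [s₀, hempty, insideWeight_empty]
  · exact fun l hl => absurd hl.2 hl.1.not_gt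
  · exact .inl (by simp [s₀])
  · intro i s₁ hi hf hround ⟨hsum, hmax⟩
    rw [show n - i = n - (i + 1) + 1 by omega] at hsum hmax
    exact wp_improveBest (hs₀.frame hf (by decide)) hw (hf.ra raKey rfl ▸ hpeel) (by omega)
      (by omega) hsum hmax
  · intro t s' ht _ ⟨_, hle, hbest⟩
    rw [Nat.sub_self] at hle hbest
    obtain ⟨hround, heq⟩ := hbest.resolve_left
      ((density_nonneg hw).trans (hle 0 ⟨le_rfl, hn⟩)).not_gt
    refine ⟨?_, hround.2, fun j hj => (hle j ⟨j.zero_le, hj⟩).trans_eq heq.symm⟩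
    simp only [Finset.sum_const, Finset.card_range, smul_eq_mul] at ht
    omega

/-- Writes the flags of the vertices that are left before round `wBestRound` of the peeling. -/
def writeFlags : Cmd :=
  upTo wRound wN
    (.cond (.lt (.var wRound) (.var wBestRound))
      (.store aFlag (.arr aOrder (.var wRound)) (.const 0))
      (.store aFlag (.arr aOrder (.var wRound)) (.const 1)))

theorem wp_writeFlags {order : Equiv.Perm (Fin n)} (hW : 1 < W) (hs : HoldsInput off nb n lam W s)
    (horder : ∀ i : Fin n, s.a aOrder i = order i) :
    WP W writeFlags s fun t s' => t ≤ 20 * n + 5 ∧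
      IsFlags (remaining order (s.w wBestRound)) (s'.a aFlag) := by
  refine wp_upTo (fun i s₁ => ∀ j : Fin n, j < i →
      s₁.a aFlag (order j) = if s.w wBestRound ≤ j then 1 else 0)
    (fun _ => 13) rfl rfl (by decide) hs.bdd hs.n_eq (fun j hj => absurd hj j.1.not_lt_zero) ?_ ?_
  · intro i s₁ hi hf hround hflags
    lift i to Fin n using hi
    have hvertex : s₁.a aOrder i = order i := (congrFun (hf.a aOrder rfl) i).trans (horder i)
    have hstore (c : ℕ) (hc : c = if s.w wBestRound ≤ i then 1 else 0) (j : Fin n)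
        (hj : (j : ℕ) < i + 1) : Function.update (s₁.a aFlag) (order i : ℕ) c (order j) =
          if s.w wBestRound ≤ j then 1 else 0 := by
      rcases Nat.lt_succ_iff_lt_or_eq.1 hj with hj | hj
      · rw [Function.update_of_ne fun h => hj.ne (congrArg _ (order.injective (Fin.ext h)))]
        exact hflags j hj
      · rw [Fin.ext hj, Function.update_self, hc]
    simp only [wp_cond, wp_store, Test.holds, WExp.eval, hround, hvertex, WExp.cost, Test.cost,
      hf.w wBestRound rfl, State.setW_a, State.setA_a_self, hW, zero_lt_one.trans hW, true_and]
    exact ⟨fun h => ⟨by omega, hstore 0 (if_neg h.not_ge).symm⟩,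
      fun h => ⟨by omega, hstore 1 (if_pos (not_lt.1 h)).symm⟩⟩
  · intro t s' ht _ hflags
    refine ⟨?_, fun v => ?_⟩
    · simp only [Finset.sum_const, Finset.card_range, smul_eq_mul] at ht
      omega
    · simpa [remaining] using hflags (order.symm v) (order.symm v).2

/-- Writes the flags of all vertices. -/
def initFlags : Cmd := upTo wRound wN (.store aFlag (.var wRound) (.const 1))

theorem wp_initFlags (hW : 1 < W) (hs : HoldsInput off nb n lam W s) :
    WP W initFlags s fun t s' => t ≤ 10 * n + 5 ∧
      IsFlags (Finset.univ : Finset (Fin n)) (s'.a aFlag) := by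
  refine wp_upTo (fun i s₁ => ∀ j < i, s₁.a aFlag j = 1) (fun _ => 3) rfl rfl (by decide) hs.bdd
    hs.n_eq (fun j hj => absurd hj j.not_lt_zero) ?_ ?_
  · intro i s₁ _ _ hround hflags
    simp only [wp_store, WExp.eval, hround, WExp.cost, State.setW_a, State.setA_a_self, hW,
      true_and]
    refine ⟨by omega, fun j hj => ?_⟩
    rcases Nat.lt_succ_iff_lt_or_eq.1 hj with hj | rfl
    · rw [Function.update_of_ne hj.ne, hflags j hj]
    · rw [Function.update_self]
  · intro t s' ht _ hflags
    refine ⟨?_, fun v => by simp [hflags v v.2]⟩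
    simp only [Finset.sum_const, Finset.card_range, smul_eq_mul] at ht
    omega

end BestSet

/-! ## The program -/

section Start

variable {n W : ℕ} {G : SimpleGraph (Fin n)} {off nb : ℕ → ℕ} {lam : ℝ}

theorem IsAdjList.exists_row {X : Type*} {N : ℕ} {H : SimpleGraph X} {name : Fin N ≃ X}
    (h : IsAdjList H name off nb) {p i : ℕ} (hi : i ≤ N) (hp : p < off i) :
    ∃ j : Fin N, off j ≤ p ∧ p < off (j + 1) := by
  induction i with
  | zero => exact absurd (h.zero ▸ hp) p.not_lt_zero
  | succ i ih =>
    by_cases hpi : p < off i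
    exacts [ih (by omega) hpi, ⟨⟨i, hi⟩, not_lt.1 hpi, hp⟩]

theorem IsInput.nb_le (hG : IsInput G off nb) (p : ℕ) : nb p ≤ n := by
  by_cases hp : p < off n
  · obtain ⟨u, hu, hu'⟩ := hG.adj.exists_row le_rfl hp
    obtain ⟨v, hv, _⟩ := hG.adj.sound u p hu hu'
    exact hv ▸ v.2.le
  · exact hG.nb_unused p (not_lt.1 hp) ▸ n.zero_le

theorem IsInput.off_le (hG : IsInput G off nb) (i : ℕ) : off i ≤ n ^ 3 := by
  rcases le_or_gt i n with hi | hi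
  · exact (hG.adj.monotoneOn hi Set.self_mem_Iic hi).trans (hG.off_le_size.trans size_le)
  · exact hG.off_unused i hi ▸ Nat.zero_le _

theorem holdsInput_initState (hG : IsInput G off nb) (hW : n ^ 3 + n < W) :
    HoldsInput off nb n lam W (initState n lam off nb) := by
  refine ⟨rfl, rfl, rfl, rfl, fun x => ?_, fun A i => ?_⟩
  · simp only [initState]
    split_ifs <;> omega
  · have hoff := hG.off_le i
    have hnb := hG.nb_le i
    simp only [initState]
    split_ifs
    exacts [by omega, by omega, hW.pos]

theorem VanishOutside.frame {c : Cmd} {s s' : State} (h : VanishOutside G s) (hf : Frame W c s s')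
    (hc : ∀ A ∈ [aAdj, aMark, aWeak], c.writes (.wordArray A) = false) : VanishOutside G s' :=
  fun A hA u v huv => by rw [hf.a A (hc A hA), h A hA u v huv]

theorem weight_nonneg {V : Type*} (weak : Set (Sym2 V)) (hlam : 0 ≤ lam) (e : Sym2 V) :
    0 ≤ weight weak lam e := by
  rw [weight]
  split_ifs
  exacts [hlam, zero_le_one]

end Start

section Program

variable {n W : ℕ} {G : SimpleGraph (Fin n)} {off nb : ℕ → ℕ} {lam : ℝ} {s : State}
  {weak : Set (Sym2 (Fin n))} {w : Sym2 (Fin n) → ℝ}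

/-- Step 1: labels the input graph and copies the labeling to the output arrays. -/
def labelGraph : Cmd := initFlags ;; apr ;; copyOut

theorem wp_labelGraph (hG : IsInput G off nb) (hW : 4 * n ^ 3 + n * n + 2 ≤ W)
    (hs : HoldsInput off nb n lam W s) (h : VanishOutside G s) :
    WP W labelGraph s fun t s' => t ≤ 780 * size G + 130 ∧ ∃ weak, IsAprMinSTC G weak ∧
      IsWedgeGraphArrays G (s'.w wNodesOut) (s'.a aXOut) (s'.a aYOut) (s'.a aOffOut) (s'.a aNbOut) ∧
      IsEdgeArray G off nb (weak.indicator fun _ => 1) (s'.a aLabelOut) ∧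
      IsEdgeMatrix weak (s'.a aWeak) ∧ VanishOutside G s' := by
  rw [labelGraph, wp_seq]
  refine (wp_initFlags (by omega) hs).mono_frame fun t₁ s₁ ⟨_, hflags⟩ hf₁ => ?_
  have hs₁ := hs.frame hf₁ (by decide)
  rw [wp_seq]
  refine (wp_apr hG (by omega) hs₁ hflags (h.frame hf₁ (by decide))).mono_frame
    fun t₂ s₂ ⟨_, weak, hlabeling⟩ hf₂ => ?_
  rw [sub_univ] at hlabeling
  refine (wp_copyOut hG (by omega) (hs₁.frame hf₂ (by decide)) hlabeling).mono_frame
    fun t₃ s₃ ⟨_, hgraph, hedges⟩ hf₃ => ⟨?_, weak, hlabeling.label, hgraph, hedges,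
      hf₃.a aWeak rfl ▸ hlabeling.matrix, hlabeling.vanish.frame hf₃ (by decide)⟩
  have := le_size (G := G)
  omega

/-- Steps 2 and 3: weights the edges, then removes vertices of minimum weighted degree. -/
def peelGraph : Cmd := initDegrees ;; fillQueue ;; peel

theorem wp_peelGraph (hG : IsInput G off nb) (hlam : lam ≤ 1) (hW : (n + 1) * (n + 1) ≤ W)
    (hs : HoldsInput off nb n lam W s) (hweak : IsEdgeMatrix weak (s.a aWeak))
    (hzero : ∀ A ∈ [aStrong, aWeakDeg, aCount, aRemoved], ∀ i, s.a A i = 0)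
    (hbest : ∀ i, s.ra raBest i = 0) :
    WP W peelGraph s fun t s' => t ≤ 2000 * size G + 20 ∧
      IsEdgeArray G off nb (weight weak lam) (s'.ra raWeight) ∧
      IsPeeling G (weight weak lam) (s'.a aOrder) (s'.ra raKey) n := by
  have hkey (u : Fin n) : vertexKey s u = 0 :=
    Prod.ext (hzero aStrong (by simp) u) (hzero aWeakDeg (by simp) u)
  rw [peelGraph, wp_seq]
  refine (wp_initDegrees hG hs hweak hkey).mono_frame fun t₁ s₁ ⟨_, hweights, hkey₁⟩ hf₁ => ?_
  have hs₁ := hs.frame hf₁ (by decide)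
  rw [wp_seq]
  refine (wp_fillQueue (G := G) hlam hW hs₁ (fun u => ?_)
    (fun i => by rw [hf₁.a aCount rfl, hzero aCount (by simp)])
    (fun i => by rw [hf₁.ra raBest rfl, hbest])).mono_frame fun t₂ s₂ ⟨_, hqueue⟩ hf₂ => ?_
  · rw [hkey₁]
    exact degKey_fst_add_snd_le G weak Finset.univ u
  have hpeeling : HoldsPeeling G weak lam Finset.univ s₂ := by
    refine ⟨hqueue, fun v _ => ?_, fun v => ?_⟩
    · rw [← hkey₁, vertexKey_eq_of_frame hf₂ (by decide)]
    · rw [hf₂.a aRemoved rfl, hf₁.a aRemoved rfl]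
      simpa using hzero aRemoved (by simp) v
  refine (wp_peel hG hlam hW (hs₁.frame hf₂ (by decide))
    (hf₂.a aWeak rfl ▸ hf₁.a aWeak rfl ▸ hweak) hpeeling).mono_frame
    fun t₃ s₃ ⟨_, hpeel⟩ hf₃ => ⟨?_, ?_, hpeel⟩
  · have hdegrees := sum_sum_nbrs_le_size (G := G) (a := 60) (b := 18) (by norm_num)
    have hfill : ∑ u, (150 * ((nbrs G u).card + 1) + 60) ≤ 210 * size G :=
      sum_le_size fun u => by
        have := Nat.le_self_pow two_ne_zero ((nbrs G u).card + 1)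
        omega
    have := sum_removalTime_le G
    omega
  · rw [hf₃.ra raWeight rfl, hf₂.ra raWeight rfl]
    exact hweights

/-- The choice of the densest remaining set in step 3. -/
def chooseSet : Cmd := findBest ;; writeFlags

theorem wp_chooseSet (hn : 1 ≤ n) (hs : HoldsInput off nb n lam W s) (hw : ∀ e, 0 ≤ w e)
    (hW : 1 < W) (hpeel : IsPeeling G w (s.a aOrder) (s.ra raKey) n) :
    WP W chooseSet s fun t s' => t ≤ 80 * n + 30 ∧ ∃ order U, IsPeelOrder G w order ∧
      IsBestRemaining G w order U ∧ (∀ i : Fin n, s'.a aOrder i = order i) ∧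
      IsFlags U (s'.a aFlag) := by
  obtain ⟨order, horder⟩ := hpeel.exists_perm
  rw [chooseSet, wp_seq]
  refine (wp_findBest hn hs hw hpeel).mono_frame fun t₁ s₁ ⟨_, hround, hmax⟩ hf₁ => ?_
  have horder₁ (i : Fin n) : s₁.a aOrder i = order i := by rw [hf₁.a aOrder rfl, horder]
  refine (wp_writeFlags hW (hs.frame hf₁ (by decide)) horder₁).mono_frame
    fun t₂ s₂ ⟨_, hflags⟩ hf₂ => ⟨by omega, order, remaining order (s₁.w wBestRound),
      hpeel.isPeelOrder horder, ⟨⟨_, hround⟩, rfl, fun j => ?_⟩,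
      fun i => by rw [hf₂.a aOrder rfl, horder₁], hflags⟩
  rw [← unremoved_eq_remaining horder j.2.le, ← unremoved_eq_remaining horder hround.le]
  exact hmax j j.2

/-- STC-Peel. -/
def stcPeel : Cmd := labelGraph ;; peelGraph ;; chooseSet ;; apr

theorem wp_stcPeel (hG : IsInput G off nb) (hn : 1 ≤ n) (h0 : 0 ≤ lam) (h1 : lam ≤ 1)
    (hW : 4 * n ^ 3 + n * n + 3 * n + 3 ≤ W) :
    WP W stcPeel (initState n lam off nb) fun t s' =>
      t ≤ 5000 * size G + 500 ∧ IsOutput G lam off nb s' := by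
  have hs : HoldsInput off nb n lam W (initState n lam off nb) :=
    holdsInput_initState hG (by omega)
  have hvanish : VanishOutside G (initState n lam off nb) := fun A hA u v _ => by
    fin_cases hA <;> rfl
  rw [stcPeel, wp_seq]
  refine (wp_labelGraph hG (by omega) hs hvanish).mono_frame
    fun t₁ s₁ ⟨_, weak, hlabel, hgraph, hedges, hweak, hvanish₁⟩ hf₁ => ?_
  have hs₁ := hs.frame hf₁ (by decide)
  rw [wp_seq]
  refine (wp_peelGraph hG h1 (by nlinarith) hs₁ hweak (fun A hA i => ?_) fun i => ?_).mono_frame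
    fun t₂ s₂ ⟨_, hweights, hpeel⟩ hf₂ => ?_
  · fin_cases hA <;> rw [hf₁.a _ rfl] <;> rfl
  · rw [hf₁.ra raBest rfl]
    rfl
  have hs₂ := hs₁.frame hf₂ (by decide)
  rw [wp_seq]
  refine (wp_chooseSet hn hs₂ (weight_nonneg weak h0) (by omega) hpeel).mono_frame
    fun t₃ s₃ ⟨_, order, U, hpeelOrder, hbest, horder, hflags⟩ hf₃ => ?_
  have hvanish₃ := (hvanish₁.frame hf₂ (by decide)).frame hf₃ (by decide)
  refine (wp_apr hG (by omega) (hs₂.frame hf₃ (by decide)) hflags hvanish₃).mono_frame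
    fun t₄ s₄ ⟨_, weak', hlabeling⟩ hf₄ => ⟨?_, weak, order, U, weak',
      ⟨hlabel, hpeelOrder, hbest, hlabeling.label⟩, ?_, ?_, ?_, ?_, ?_, hlabeling.graph,
      fun u v huv => hlabeling.edges u v (sub_le huv)⟩
  · have := le_size (G := G)
    omega
  all_goals have hf := hf₂.seq_left.trans (hf₃.seq_left.trans hf₄.seq_right).seq_right
  · rw [hf.w wNodesOut rfl, hf.a aXOut rfl, hf.a aYOut rfl, hf.a aOffOut rfl, hf.a aNbOut rfl]
    exact hgraph
  · exact hf.a aLabelOut rfl ▸ hedges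
  · rw [hf₄.ra raWeight rfl, hf₃.ra raWeight rfl]
    exact hweights
  · rw [hf₄.a aOrder rfl]
    exact horder
  · exact hf₄.a aFlag rfl ▸ hflags

end Program

/-! ## The time bound -/

section Bound

variable {n : ℕ} {G : SimpleGraph (Fin n)}

theorem card_nbrs (v : Fin n) [Fintype (G.neighborSet v)] : (nbrs G v).card = G.degree v := by
  rw [← SimpleGraph.card_neighborFinset_eq_degree]
  congr 1
  ext
  simp

theorem le_two_mul_log_add_one (n : ℕ) : (n : ℝ) ≤ 2 * (n * Real.log n) + 1 := by
  rcases Nat.lt_or_ge n 2 with hn | hn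
  · interval_cases n <;> simp
  · have hlog : Real.log 2 ≤ Real.log n := Real.log_le_log (by norm_num) (by exact_mod_cast hn)
    have hlog2 := Real.log_two_gt_d9
    nlinarith [(n.cast_nonneg : (0 : ℝ) ≤ n)]

theorem sum_sq_add_mul_log_le_timeBound :
    ∑ v, ((nbrs G v).card : ℝ) ^ 2 + n * Real.log n ≤ timeBound G := by
  simp only [timeBound, ← card_nbrs]
  linarith [(G.edgeSet.ncard.cast_nonneg : (0 : ℝ) ≤ _),
    ((wedgeGraph G).edgeSet.ncard.cast_nonneg : (0 : ℝ) ≤ _),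
    ((wedgeVerts G).ncard.cast_nonneg : (0 : ℝ) ≤ _)]

theorem size_le_timeBound (G : SimpleGraph (Fin n)) : (size G : ℝ) ≤ 4 * (timeBound G + 1) := by
  have hsize : (size G : ℝ) ≤ 2 * ∑ v, ((nbrs G v).card : ℝ) ^ 2 + 2 * n := by
    calc (size G : ℝ) = ∑ v, (((nbrs G v).card : ℝ) + 1) ^ 2 := by simp [size]
      _ ≤ ∑ v, (2 * ((nbrs G v).card : ℝ) ^ 2 + 2) :=
          Finset.sum_le_sum fun v _ => by nlinarith [sq_nonneg (((nbrs G v).card : ℝ) - 1)]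
      _ = 2 * ∑ v, ((nbrs G v).card : ℝ) ^ 2 + 2 * n := by
          simp [Finset.sum_add_distrib, Finset.mul_sum, mul_comm]
  have hsq : 0 ≤ ∑ v, ((nbrs G v).card : ℝ) ^ 2 := Finset.sum_nonneg fun v _ => sq_nonneg _
  linarith [le_two_mul_log_add_one n, sum_sq_add_mul_log_le_timeBound (G := G)]

theorem ncard_wedgeVerts_le : (wedgeVerts G).ncard ≤ G.edgeSet.ncard := by
  refine Set.ncard_le_ncard ?_ (Set.toFinite _)
  rintro e ⟨x, y, z, h, rfl | rfl⟩
  exacts [h.1, h.2.1]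

theorem ncard_edgeSet_wedgeGraph_le :
    (wedgeGraph G).edgeSet.ncard ≤ ∑ v, (nbrs G v).card ^ 2 := by
  classical
  let paths : Finset (Σ _ : Fin n, Fin n × Fin n) := Finset.univ.sigma fun y => nbrs G y ×ˢ nbrs G y
  let edgePair (t : Σ _ : Fin n, Fin n × Fin n) : Sym2 (Sym2 (Fin n)) :=
    s(s(t.2.1, t.1), s(t.1, t.2.2))
  have hpaths : paths.card = ∑ v, (nbrs G v).card ^ 2 := by
    simp [paths, Finset.card_sigma, sq]
  have hsub : Sym2.map Subtype.val '' (wedgeGraph G).edgeSet ⊆ paths.image edgePair := by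
    rintro _ ⟨e, he, rfl⟩
    induction e with
    | _ e f =>
      obtain ⟨x, y, z, h, he, hf⟩ := he
      rw [Finset.mem_coe, Finset.mem_image]
      refine ⟨⟨y, x, z⟩, by simp [paths, h.1.symm, h.2.1], ?_⟩
      simp only at he hf
      simp only [edgePair, Sym2.map_mk, he, hf]
  rw [← hpaths, ← Set.ncard_image_of_injective _ (Sym2.map.injective Subtype.val_injective)]
  refine (Set.ncard_le_ncard hsub (Set.toFinite _)).trans ?_
  rw [Set.ncard_coe_finset]
  exact Finset.card_image_le

theorem sum_card_nbrs_sq_le : ∑ v, (nbrs G v).card ^ 2 ≤ 2 * (n * G.edgeSet.ncard) := by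
  classical
  calc ∑ v, (nbrs G v).card ^ 2 ≤ ∑ v, n * G.degree v := Finset.sum_le_sum fun v _ => by
        rw [sq]
        exact Nat.mul_le_mul (card_nbrs_lt v).le (card_nbrs v).le
    _ = 2 * (n * G.edgeSet.ncard) := by
        rw [← Finset.mul_sum, G.sum_degrees_eq_twice_card_edges, ← Set.ncard_coe_finset,
          SimpleGraph.coe_edgeFinset]
        ring

theorem timeBound_le {K : ℝ} (h : Real.log n ≤ K * (G.edgeSet.ncard : ℝ)) :
    timeBound G ≤ (K + 6) * ((n : ℝ) * (G.edgeSet.ncard : ℝ)) := by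
  have hsq : ∑ v, ((nbrs G v).card : ℝ) ^ 2 ≤ 2 * (n * G.edgeSet.ncard) := by
    exact_mod_cast sum_card_nbrs_sq_le
  have hwedges : ((wedgeGraph G).edgeSet.ncard : ℝ) ≤ ∑ v, ((nbrs G v).card : ℝ) ^ 2 := by
    exact_mod_cast ncard_edgeSet_wedgeGraph_le
  have hnodes : ((wedgeVerts G).ncard : ℝ) ≤ G.edgeSet.ncard := by
    exact_mod_cast ncard_wedgeVerts_le
  have hedges : (G.edgeSet.ncard : ℝ) ≤ n * G.edgeSet.ncard := by
    rcases n.eq_zero_or_pos with rfl | hn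
    · simp [Set.eq_empty_of_isEmpty G.edgeSet]
    · exact le_mul_of_one_le_left (Nat.cast_nonneg _) (by exact_mod_cast hn)
  have hlog := mul_le_mul_of_nonneg_left h (n.cast_nonneg : (0 : ℝ) ≤ n)
  simp only [timeBound, ← card_nbrs]
  linarith

end Bound

end STCPeel

/-- STC-Peel can be implemented by one random access machine program, with words of `O(log n)` bits,
in time `O(Σ_v deg(v)² + (m + n log n) + (m' + n'))` (the `+ 1` matters only for `n = 1`), and this
bound is in `O(nm)` on graphs with `log n = O(m)`. -/
theorem mainTheorem10 :
    (∃ (P : STCPeel.Cmd) (k : ℕ) (C : ℝ), ∀ (n : ℕ), 1 ≤ n → ∀ (G : SimpleGraph (Fin n)) (lam : ℝ),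
      0 ≤ lam → lam ≤ 1 → ∀ off nb : ℕ → ℕ, STCPeel.IsInput G off nb →
        ∃ (t : ℕ) (s : STCPeel.State),
          STCPeel.Exec ((n + 2) ^ k) P (STCPeel.initState n lam off nb) t s ∧
          STCPeel.IsOutput G lam off nb s ∧
          (t : ℝ) ≤ C * (STCPeel.timeBound G + 1)) ∧
    (∀ K : ℝ, ∃ C : ℝ, ∀ (n : ℕ) (G : SimpleGraph (Fin n)),
      Real.log n ≤ K * (G.edgeSet.ncard : ℝ) →
        STCPeel.timeBound G ≤ C * ((n : ℝ) * (G.edgeSet.ncard : ℝ))) := by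
  refine ⟨⟨STCPeel.stcPeel, 5, 22000, fun n hn G lam h0 h1 off nb hG => ?_⟩,
    fun K => ⟨K + 6, fun _ _ => STCPeel.timeBound_le⟩⟩
  have hW : 4 * n ^ 3 + n * n + 3 * n + 3 ≤ (n + 2) ^ 5 := by
    have : n ≤ n ^ 2 := Nat.le_self_pow two_ne_zero n
    ring_nf
    omega
  obtain ⟨t, s, hexec, ht, hout⟩ := STCPeel.wp_stcPeel hG hn h0 h1 hW
  have htime : (t : ℝ) ≤ 5000 * STCPeel.size G + 500 := by exact_mod_cast ht
  have hsize : (1 : ℝ) ≤ STCPeel.size G := by exact_mod_cast hn.trans STCPeel.le_size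
  exact ⟨t, s, hexec, hout, by linarith [STCPeel.size_le_timeBound G]⟩
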